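/- **Theorem.** Let $c\in(0,\infty)$ and let $N_A=N_A(N)$, $N_D=N_D(N)$ be positive-integer-valued functions of $N$ (otherwise arbitrary) with $N_D\sim cN_A$ as $N\to\infty$. For every $N$ let $X_N\in\mathbb C^{N_A}\otimes\mathbb C^{N}\otimes\mathbb C^{N}\otimes\mathbb C^{N_D}$ be a random Gaussian tensor, i.e. its coordinates in the product basis are i.i.d. standard complex Gaussian variables (density $\pi^{-1}e^{-|z|^2}$ on $\mathbb C$). Write $A,B,C,D$ for the four tensor factors (so $\dim B=\dim C=N$), and let $$W_{AB}^{(N)}=[\mathrm{id}\otimes\mathrm{id}\otimes\mathrm{Tr}\otimes\mathrm{Tr}](X_NX_N^*),\qquad W_{AC}^{(N)}=[\mathrm{id}\otimes\mathrm{Tr}\otimes\mathrm{id}\otimes\mathrm{Tr}](X_NX_N^*),$$ both regarded as matrices on $\mathbb C^{N_A}\otimes\mathbb C^N$. 1. As $N\to\infty$, the pair $\big((N_AN)^{-1}W_{AB}^{(N)},(N_AN)^{-1}W_{AC}^{(N)}\big)$ converges in distribution, i.e. in all joint moments with respect to the expected normalized trace $\mathbb E\,(N_AN)^{-1}\mathrm{Tr}$,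 to a pair $(x_{AB},x_{AC})$ of free self-adjoint elements of some $*$-probability space, each of which has the Marchenko–Pastur distribution $$\mathrm{dMP}_c=\max(1-c,0)\,\delta_0+\frac{\sqrt{(b-x)(x-a)}}{2\pi x}\mathbf 1_{[a,b]}(x)\,\mathrm dx,\qquad a=(1-\sqrt c)^2,\ b=(1+\sqrt c)^2 .$$ 2. Equivalently, for every word $f\in\{AB,AC\}^p$ of length $p\ge 0$, the moments below are finite and $$\lim_{N\to\infty}\mathbb E\,(N_AN)^{-p-1}\,\mathrm{Tr}\big(W^{(N)}_{f(p)}\cdots W^{(N)}_{f(2)}W^{(N)}_{f(1)}\big)=\sum_{\alpha\in \mathrm{NC}(p),\ \alpha\le\ker f}c^{\#\alpha},$$ where $\mathrm{NC}(p)$ is the set of non-crossing partitions of $\{1,\dots,p\}$, $\#\alpha$ is the number of blocks of $\alpha$, $\le$ is the refinement order, and $\ker f$ is the partition of $\{1,\dots,p\}$ into the nonempty sets among $f^{-1}(AB)$ and $f^{-1}(AC)$. 3. For $p\ge1$ the limit in 2 also equals $$\sum_{\mathcal M\in\mathbb M_p^0,\ \Delta_f(\mathcal M)=0}c^{V(\mathcal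 M)-1}.$$ Here $\mathbb M_p$ is the set of bicolored maps with $p$ labelled edges and a single black vertex: pairs $\mathcal M=(\sigma_\circ,\sigma_\bullet)$ of permutations of $\{1,\dots,p\}$ with $\sigma_\bullet=\gamma=(1\,2\,\cdots\,p)$, whose white vertices, black vertex and faces are the cycles of $\sigma_\circ$, $\sigma_\bullet$ and $\sigma_\bullet\sigma_\circ$; $V(\mathcal M)$ and $F(\mathcal M)$ are the numbers of all vertices and of faces; $\mathbb M_p^0$ consists of the maps of genus $0$, the genus $g$ being given by $V(\mathcal M)+F(\mathcal M)-p=2-2g$; and $\Delta_f(\mathcal M)$ is the number of white vertices having both an incident edge $e$ with $f(e)=AB$ and an incident edge $e'$ with $f(e')=AC$. So the sum is over planar maps whose white vertices have incident edges of a single colour. -/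

import Mathlib

open MeasureTheory ProbabilityTheory Filter Topology Finset

/-! ### Gaussian tensors and the two marginals -/

/-- The law of a standard complex Gaussian variable: density `π⁻¹ exp (-|z|²)` with respect to
Lebesgue measure on `ℂ`. -/
noncomputable def stdComplexGaussian : Measure ℂ :=
  volume.withDensity fun z => ENNReal.ofReal (Real.pi⁻¹ * Real.exp (-‖z‖ ^ 2))

/-- The index set of the product basis of `ℂ^a ⊗ ℂ^b ⊗ ℂ^c ⊗ ℂ^d`. -/
abbrev TensorIndex (a b c d : ℕ) : Type := Fin a × Fin b × Fin c × Fin d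

/-- A random Gaussian tensor: the coordinates are i.i.d. standard complex Gaussian variables. -/
structure IsGaussianTensor {Ω : Type*} [MeasurableSpace Ω] (P : Measure Ω) {a b c d : ℕ}
    (X : Ω → TensorIndex a b c d → ℂ) : Prop where
  hasLaw : ∀ i, HasLaw (fun ω => X ω i) stdComplexGaussian P
  indep : iIndepFun (fun i ω => X ω i) P

/-- The matrix `X X^*` of a tensor `X`, regarded as a column vector. -/
def outerProduct {a b c d : ℕ} (X : TensorIndex a b c d → ℂ) :
    Matrix (TensorIndex a b c d) (TensorIndex a b c d) ℂ :=
  Matrix.vecMulVec X (star X)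

/-- The partial trace `id ⊗ id ⊗ Tr ⊗ Tr`. -/
def partialTraceCD {a b c d : ℕ} (M : Matrix (TensorIndex a b c d) (TensorIndex a b c d) ℂ) :
    Matrix (Fin a × Fin b) (Fin a × Fin b) ℂ :=
  Matrix.of fun i j => ∑ k : Fin c, ∑ l : Fin d, M (i.1, i.2, k, l) (j.1, j.2, k, l)

/-- The partial trace `id ⊗ Tr ⊗ id ⊗ Tr`. -/
def partialTraceBD {a b c d : ℕ} (M : Matrix (TensorIndex a b c d) (TensorIndex a b c d) ℂ) :
    Matrix (Fin a × Fin c) (Fin a × Fin c) ℂ :=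
  Matrix.of fun i j => ∑ k : Fin b, ∑ l : Fin d, M (i.1, k, i.2, l) (j.1, k, j.2, l)

/-- The two letters `AB` and `AC`. -/
inductive Marginal : Type
  | AB : Marginal
  | AC : Marginal

/-- The two marginals `W_AB` and `W_AC` of a tensor `X ∈ ℂ^a ⊗ ℂ^n ⊗ ℂ^n ⊗ ℂ^d`. -/
def marginal {a n d : ℕ} (X : TensorIndex a n n d → ℂ) :
    Marginal → Matrix (Fin a × Fin n) (Fin a × Fin n) ℂ
  | Marginal.AB => partialTraceCD (outerProduct X)
  | Marginal.AC => partialTraceBD (outerProduct X)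

/-- The product `W_f = W_{f(p)} ⋯ W_{f(2)} W_{f(1)}`, labelled from right to left. -/
noncomputable def wordMatrix {a n d p : ℕ} (X : TensorIndex a n n d → ℂ) (f : Fin p → Marginal) :
    Matrix (Fin a × Fin n) (Fin a × Fin n) ℂ :=
  (List.ofFn fun i => marginal X (f i)).reverse.prod

/-! ### Non-commutative probability -/

/-- `φ` is a state on the unital `*`-algebra `A`, i.e. `(A, φ)` is a `*`-probability space. -/
structure IsNCState {A : Type*} [Ring A] [StarRing A] [Algebra ℂ A] (φ : A →ₗ[ℂ] ℂ) : Prop where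
  map_one : φ 1 = 1
  re_nonneg : ∀ a : A, 0 ≤ (φ (star a * a)).re
  im_eq_zero : ∀ a : A, (φ (star a * a)).im = 0

/-- Free independence of a family of unital subalgebras: alternating products of centred elements
are centred. -/
def FreeSubalgebras {ι A : Type*} [Ring A] [Algebra ℂ A] (φ : A →ₗ[ℂ] ℂ)
    (B : ι → Subalgebra ℂ A) : Prop :=
  ∀ (n : ℕ) (i : Fin (n + 1) → ι) (a : Fin (n + 1) → A),
    (∀ k : Fin n, i k.castSucc ≠ i k.succ) →
    (∀ k, a k ∈ B (i k)) → (∀ k, φ (a k) = 0) → φ (List.ofFn a).prod = 0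

/-- Free independence of a family of elements: the unital subalgebras they generate are free. -/
def FreeElements {ι A : Type*} [Ring A] [Algebra ℂ A] (φ : A →ₗ[ℂ] ℂ) (x : ι → A) : Prop :=
  FreeSubalgebras φ fun i => Algebra.adjoin ℂ {x i}

/-- The Marchenko–Pastur distribution of parameter `c`:
`max (1 - c, 0) δ₀ + √((b - x)(x - a)) / (2 π x) 1_{[a, b]}(x) dx` with `a = (1 - √c)²` and
`b = (1 + √c)²`. -/
noncomputable def marchenkoPastur (c : ℝ) : Measure ℝ :=
  ENNReal.ofReal (max (1 - c) 0) • Measure.dirac 0 +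
    (volume.restrict (Set.Icc ((1 - √c) ^ 2) ((1 + √c) ^ 2))).withDensity fun x =>
      ENNReal.ofReal (√(((1 + √c) ^ 2 - x) * (x - (1 - √c) ^ 2)) / (2 * Real.pi * x))

/-- The self-adjoint element `x` has distribution `μ` with respect to `φ`: its moments are those
of `μ`, all of which exist. -/
structure HasDistribution {A : Type*} [Ring A] [StarRing A] [Algebra ℂ A] (φ : A →ₗ[ℂ] ℂ) (x : A)
    (μ : Measure ℝ) : Prop where
  isSelfAdjoint : IsSelfAdjoint x
  integrable : ∀ k : ℕ, Integrable (fun t : ℝ => t ^ k) μ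
  moment_eq : ∀ k : ℕ, φ (x ^ k) = ((∫ t, t ^ k ∂μ : ℝ) : ℂ)

/-- Convergence in distribution (in joint moments) of a sequence of families of random matrices,
with respect to the expected normalized trace, to the family `x` in `(A, φ)`. -/
def ConvergesInDistribution {ι A : Type*} [Ring A] [Algebra ℂ A] {Ω : ℕ → Type*}
    [∀ N, MeasurableSpace (Ω N)] (P : ∀ N, Measure (Ω N)) {n : ℕ → Type*} [∀ N, Fintype (n N)]
    [∀ N, DecidableEq (n N)] (M : ∀ N, Ω N → ι → Matrix (n N) (n N) ℂ)
    (φ : A →ₗ[ℂ] ℂ) (x : ι → A) : Prop :=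
  ∀ (p : ℕ) (f : Fin p → ι),
    (∀ N, Integrable (fun ω => (List.ofFn fun i => M N ω (f i)).prod.trace) (P N)) ∧
    Tendsto (fun N => (Fintype.card (n N) : ℂ)⁻¹ *
        ∫ ω, (List.ofFn fun i => M N ω (f i)).prod.trace ∂(P N)) atTop
      (𝓝 (φ (List.ofFn fun i => x (f i)).prod))

/-! ### Non-crossing partitions -/

/-- Partitions of the set of the `p` positions. -/
abbrev SetPartition (p : ℕ) : Type := Finpartition (Finset.univ : Finset (Fin p))

/-- A partition is non-crossing if there are no `i < j < k < l` with `i, k` in one block and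
`j, l` in another one. -/
def IsNonCrossing {p : ℕ} (π : SetPartition p) : Prop :=
  ∀ i j k l : Fin p, i < j → j < k → k < l → ∀ s ∈ π.parts, ∀ t ∈ π.parts,
    i ∈ s → k ∈ s → j ∈ t → l ∈ t → s = t

open Classical in
/-- The partition `ker f`, whose blocks are the nonempty level sets of the word `f`. -/
noncomputable def kerPartition {p : ℕ} (f : Fin p → Marginal) : SetPartition p :=
  Finpartition.ofSetoid (Setoid.ker f)

open Classical in
/-- The set of all `α ∈ NC(p)` with `α ≤ ker f` (refinement order). -/
noncomputable def ncBelowKer {p : ℕ} (f : Fin p → Marginal) : Finset (SetPartition p) :=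
  Finset.univ.filter fun α => IsNonCrossing α ∧ α ≤ kerPartition f

/-! ### Bicolored combinatorial maps -/

/-- The cycles (including fixed points) of a permutation. -/
abbrev PermCycle {E : Type*} (σ : Equiv.Perm E) : Type _ := Quotient (Equiv.Perm.SameCycle.setoid σ)

/-- The number of cycles (including fixed points) of a permutation. -/
noncomputable def numCycles {E : Type*} (σ : Equiv.Perm E) : ℕ := Nat.card (PermCycle σ)

/-- Connected labelled bicolored combinatorial maps with `p` edges. -/
@[ext]
structure BicoloredMap (p : ℕ) where
  white : Equiv.Perm (Fin p)
  black : Equiv.Perm (Fin p)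
  transitive : ∀ e e' : Fin p, ∃ g ∈ Subgroup.closure {white, black}, g e = e'

namespace BicoloredMap

variable {p : ℕ}

noncomputable instance : Fintype (BicoloredMap p) :=
  Fintype.ofInjective (fun M => (M.white, M.black)) fun _ _ h =>
    BicoloredMap.ext (congrArg Prod.fst h) (congrArg Prod.snd h)

/-- The total number of (white and black) vertices. -/
noncomputable def numVertices (M : BicoloredMap p) : ℕ := numCycles M.white + numCycles M.black

/-- The number of faces, i.e. of cycles of `σ_• σ_∘`. -/
noncomputable def numFaces (M : BicoloredMap p) : ℕ := numCycles (M.black * M.white)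

/-- The map has genus `g`: Euler's relation `V + F - p = 2 - 2 g`. -/
def HasGenus (M : BicoloredMap p) (g : ℕ) : Prop :=
  (M.numVertices : ℤ) + M.numFaces - p = 2 - 2 * g

/-- The number `Δ_f` of white vertices that have incident edges of both colours, the colour of the
edge `e` being given by the letter `f e`. -/
noncomputable def bicolouredVertices (f : Fin p → Marginal) (M : BicoloredMap p) : ℕ :=
  Nat.card {v : PermCycle M.white // ∃ e e' : Fin p, Quotient.mk _ e = v ∧ Quotient.mk _ e' = v ∧
    f e = Marginal.AB ∧ f e' = Marginal.AC}

open Classical in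
/-- The planar maps in `𝕄_p^0` with `Δ_f = 0`. The elements of `𝕄_p` are the maps with one black
vertex, around which the labels of the edges are increasing: `σ_• = γ = (1 2 … p)`. -/
noncomputable def planarMonochrome (f : Fin p → Marginal) : Finset (BicoloredMap p) :=
  Finset.univ.filter fun M => M.black = finRotate p ∧ M.HasGenus 0 ∧ M.bicolouredVertices f = 0

end BicoloredMap

/-! ### Cycle counts of permutations -/

namespace CycleCount

variable {E : Type*}

/-! Expanding the trace of a word of length p and applying Wick's formula gives a sum over
permutations σ of the p positions, with terms N_A^{#(γσ)} N^{L(σ)} N_D^{#σ} (`integral_trace_word`).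
Each exponent is a number of cycles, because the indices on a tensor leg that survive the
contraction are the functions invariant under one permutation. On the two legs of dimension N this
permutation lives on positions × {B, C}: it is σ on both legs, followed by the cycle that runs
through the leg carrying the matrix index at each position and fixes the traced legs.

After division by (N_A N)^{p+1}, the triangle inequality #(γσ) + #σ ≤ p + 1 (`numCycles_add_le`)
controls the powers of N_A, since N_D ∼ c N_A. As N_A need not grow, all decay must come from N. The
key fact is L(σ) ≤ p + 1, with equality exactly when σ is a geodesic (equality in the triangle
inequality) and the word is constant on the cycles of σ (`loops_eq_iff`). It follows from Euler's
inequality for a permutation and a cycle (`euler_inequality_formPerm`) and a bound on the number of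
connected components. Cycle counts are handled throughout as dimensions of spaces of invariant real
functions, so components are intersections and the triangle inequality is the dimension formula.
Each surviving σ contributes c^{#σ}.

Geodesics can be cut: either σ fixes the first point x, or σ y = x for some later y and σ · (x y) is
the product of a geodesic on the points strictly between x and y and one on the points from y
onwards. This gives the recursion m(x t) = c m(t) + ∑_{t_i = x} m(t_{<i}) m(t_{≥i}) for the limiting
moments (`sum_geodesics`). The same cut applied to non-crossing partitions matches them with
geodesics (`sum_ncBelowKer`); for planar maps, geodesicity is Euler's relation
(`sum_planarMonochrome`).

The limit object is the algebra of non-commutative polynomials with these moments. Positivity is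
inherited from the matrices. The recursion is the Schwinger–Dyson equation φ(x_i a) = c φ(a) + (φ ⊗
φ)(D_i a), from which alternating centred products vanish by induction (`map_pow_mul_alternating`).
On powers of one letter the recursion makes the generating function quadratic, so the moments
satisfy a linear recursion; integration by parts gives the same one for the Marchenko–Pastur law
(`integral_pow_eq`). -/

theorem apply_inv_self (σ : Equiv.Perm E) (a : E) : σ (σ⁻¹ a) = a := σ.apply_symm_apply a

/-- The function `v` is constant along the cycles of `σ`. -/
def Invariant {α : Type*} (σ : Equiv.Perm E) (v : E → α) : Prop := ∀ a, v (σ a) = v a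

theorem Invariant.eq_of_sameCycle {α : Type*} {σ : Equiv.Perm E} {v : E → α} (hv : Invariant σ v)
    {a b : E} (h : σ.SameCycle a b) : v a = v b := by
  obtain ⟨k, rfl⟩ := h
  induction k using Int.induction_on with
  | zero => simp
  | succ k ih => rw [add_comm, zpow_add, zpow_one, Equiv.Perm.mul_apply, hv]; exact ih
  | pred k ih =>
    rw [ih, ← hv ((σ ^ (-(k : ℤ) - 1)) a), ← Equiv.Perm.mul_apply, ← zpow_one_add]
    congr 3; ring

theorem invariant_iff_sameCycle {α : Type*} {σ : Equiv.Perm E} {v : E → α} :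
    Invariant σ v ↔ ∀ a b, σ.SameCycle a b → v a = v b :=
  ⟨fun hv _ _ h => hv.eq_of_sameCycle h,
    fun h a => (h a (σ a) (Equiv.Perm.sameCycle_apply_right.2 (Equiv.Perm.SameCycle.refl _ _))).symm⟩

theorem Invariant.mul {α : Type*} {σ τ : Equiv.Perm E} {v : E → α} (hσ : Invariant σ v)
    (hτ : Invariant τ v) : Invariant (σ * τ) v := fun a => by
  rw [Equiv.Perm.mul_apply, hσ, hτ]

/-- Functions that are constant along the cycles of `σ` are functions on the set of cycles. -/
def invariantEquiv (α : Type*) (σ : Equiv.Perm E) :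
    {v : E → α // Invariant σ v} ≃ (PermCycle σ → α) where
  toFun v q := Quotient.lift v.1 (fun _ _ h => v.2.eq_of_sameCycle h) q
  invFun w := ⟨fun a => w (Quotient.mk _ a), fun a => congrArg w
    (Quotient.sound (s := Equiv.Perm.SameCycle.setoid σ)
      (Equiv.Perm.sameCycle_apply_left.2 (Equiv.Perm.SameCycle.refl σ a)))⟩
  left_inv v := rfl
  right_inv w := by
    funext q
    induction q using Quotient.inductionOn with
    | h a => rfl

theorem card_invariant [Finite E] (N : ℕ) (σ : Equiv.Perm E) :
    Nat.card {v : E → Fin N // Invariant σ v} = N ^ numCycles σ := by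
  rw [Nat.card_congr (invariantEquiv (Fin N) σ), Nat.card_fun, Nat.card_fin]; rfl

/-- The space of real functions that are constant along the cycles of `σ`. -/
def invariantSubmodule (σ : Equiv.Perm E) : Submodule ℝ (E → ℝ) where
  carrier := {v | Invariant σ v}
  add_mem' := fun {v w} hv hw a => by simp only [Pi.add_apply]; rw [hv a, hw a]
  zero_mem' := fun _ => rfl
  smul_mem' := fun r v hv a => by simp only [Pi.smul_apply]; rw [hv a]

theorem mem_invariantSubmodule {σ : Equiv.Perm E} {v : E → ℝ} :
    v ∈ invariantSubmodule σ ↔ Invariant σ v := Iff.rfl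

/-- Cycle counting becomes linear algebra: the intersection of two such spaces consists of the
functions constant on the orbits of the group generated by both permutations. -/
theorem finrank_invariantSubmodule [Finite E] (σ : Equiv.Perm E) :
    Module.finrank ℝ (invariantSubmodule σ) = numCycles σ := by
  classical
  have e : invariantSubmodule σ ≃ₗ[ℝ] (PermCycle σ → ℝ) :=
    { (invariantEquiv ℝ σ) with
      map_add' := fun v w => by
        funext q
        induction q using Quotient.inductionOn with
        | h a => rfl
      map_smul' := fun r v => by
        funext q
        induction q using Quotient.inductionOn with
        | h a => rfl }
  have := Fintype.ofFinite (PermCycle σ)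
  rw [e.finrank_eq, Module.finrank_fintype_fun_eq_card, numCycles, Nat.card_eq_fintype_card]

open Classical in
/-- The indicator function of the cycle of `a`. -/
noncomputable def cycleIndicator (σ : Equiv.Perm E) (a : E) : E → ℝ :=
  fun b => if σ.SameCycle a b then 1 else 0

theorem invariant_cycleIndicator (σ : Equiv.Perm E) (a : E) :
    Invariant σ (cycleIndicator σ a) := fun b => by
  by_cases h : σ.SameCycle a b <;> simp [cycleIndicator, h]

/-- The indicator of the cycle of `a` is itself an admissible test function. -/
theorem sameCycle_of_forall_invariant {σ : Equiv.Perm E} {a b : E}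
    (h : ∀ v : E → ℝ, Invariant σ v → v a = v b) : σ.SameCycle a b := by
  have := h _ (invariant_cycleIndicator σ a)
  by_contra hab
  simp [cycleIndicator, hab, Equiv.Perm.SameCycle.refl σ a] at this

theorem invariantSubmodule_le_iff {σ τ : Equiv.Perm E} :
    invariantSubmodule σ ≤ invariantSubmodule τ ↔ ∀ a, σ.SameCycle a (τ a) := by
  constructor
  · intro h a
    exact sameCycle_of_forall_invariant fun v hv => (h hv a).symm
  · intro h v hv a
    exact (hv.eq_of_sameCycle (h a)).symm

section Finite

variable [Fintype E]

set_option linter.unusedSectionVars false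

theorem numCycles_one : numCycles (1 : Equiv.Perm E) = Fintype.card E := by
  rw [← finrank_invariantSubmodule, ← Module.finrank_fintype_fun_eq_card ℝ]
  have : invariantSubmodule (1 : Equiv.Perm E) = ⊤ := by
    ext v; simp [mem_invariantSubmodule, Invariant]
  rw [this, finrank_top]

/-- Precomposition with `σ` carries functions invariant under `σ * τ` to functions invariant under
`τ * σ`. -/
theorem numCycles_mul_comm (σ τ : Equiv.Perm E) : numCycles (σ * τ) = numCycles (τ * σ) := by
  rw [← finrank_invariantSubmodule, ← finrank_invariantSubmodule]
  refine LinearEquiv.finrank_eq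
    { toFun := fun v => ⟨fun a => v.1 (σ a), fun a => ?_⟩
      invFun := fun v => ⟨fun a => v.1 (σ⁻¹ a), fun a => ?_⟩
      left_inv := fun v => by ext; simp
      right_inv := fun v => by ext; simp
      map_add' := fun v w => rfl
      map_smul' := fun r v => rfl }
  · exact v.2 (σ a)
  · have := v.2 (σ⁻¹ a)
    simpa using this

/-- The triangle inequality for the number of cycles. -/
theorem numCycles_add_le (γ σ : Equiv.Perm E) :
    numCycles σ + numCycles (γ * σ) ≤ Fintype.card E + numCycles γ := by
  simp only [← finrank_invariantSubmodule]
  rw [← Submodule.finrank_sup_add_finrank_inf_eq, ← Module.finrank_fintype_fun_eq_card ℝ]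
  -- The sum of the two spaces sits in `E → ℝ`; their intersection sits in the invariants of `γ`, as
  -- one sees by testing both invariances at `σ⁻¹ a`.
  refine add_le_add (Submodule.finrank_le _) (Submodule.finrank_mono fun v hv a => ?_)
  have h1 := hv.2 (σ⁻¹ a)
  have h2 := hv.1 (σ⁻¹ a)
  simp only [Equiv.Perm.mul_apply, apply_inv_self] at h1 h2
  rw [h1, h2]

/-- `σ⁻¹` lies on a geodesic from `1` to `γ` in the Cayley graph generated by transpositions. -/
def Geodesic (γ σ : Equiv.Perm E) : Prop :=
  numCycles σ + numCycles (γ * σ) = Fintype.card E + numCycles γ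

/-- Equality in the triangle inequality forces the intersection of the two invariant spaces to be
all of the invariants of `γ`. So every `γ`-invariant function is `σ`-invariant, and cycles of `σ`
lie inside cycles of `γ`. -/
theorem Geodesic.sameCycle {γ σ : Equiv.Perm E} (h : Geodesic γ σ) (a : E) :
    γ.SameCycle a (σ a) := by
  refine invariantSubmodule_le_iff.1 ?_ a
  have hle : invariantSubmodule σ ⊓ invariantSubmodule (γ * σ) ≤ invariantSubmodule γ := by
    intro v hv a
    have h1 := hv.2 (σ⁻¹ a)
    have h2 := hv.1 (σ⁻¹ a)
    simp only [Equiv.Perm.mul_apply, apply_inv_self] at h1 h2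
    rw [h1, h2]
  have heq : invariantSubmodule σ ⊓ invariantSubmodule (γ * σ) = invariantSubmodule γ := by
    refine Submodule.eq_of_le_of_finrank_le hle ?_
    have h1 := Submodule.finrank_sup_add_finrank_inf_eq (invariantSubmodule σ)
      (invariantSubmodule (γ * σ))
    have h2 := Submodule.finrank_le (invariantSubmodule σ ⊔ invariantSubmodule (γ * σ))
    rw [Module.finrank_fintype_fun_eq_card] at h2
    simp only [finrank_invariantSubmodule] at h1 ⊢
    unfold Geodesic at h
    omega
  rw [← heq]
  exact inf_le_left

theorem Geodesic.apply_eq {γ σ : Equiv.Perm E} (h : Geodesic γ σ) {a : E} (ha : γ a = a) :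
    σ a = a := by
  obtain ⟨k, hk⟩ := h.sameCycle a
  rw [← hk]
  exact Function.IsFixedPt.perm_zpow ha k

theorem invariant_mul_of_disjoint {α : Type*} {σ τ : Equiv.Perm E} (S : Set E)
    (hσ : ∀ a ∉ S, σ a = a) (hτ : ∀ a ∈ S, τ a = a) {v : E → α} :
    Invariant (σ * τ) v ↔ Invariant σ v ∧ Invariant τ v := by
  refine ⟨fun h => ?_, fun h => h.1.mul h.2⟩
  have h1 : Invariant σ v := fun a => by
    by_cases ha : a ∈ S
    · have := h a
      rwa [Equiv.Perm.mul_apply, hτ a ha] at this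
    · rw [hσ a ha]
  refine ⟨h1, fun a => ?_⟩
  have := h a
  rwa [Equiv.Perm.mul_apply, h1] at this

/-- Cycles of the product of two permutations with disjoint supports. -/
theorem numCycles_mul_of_disjoint {σ τ : Equiv.Perm E} (S : Set E)
    (hσ : ∀ a ∉ S, σ a = a) (hτ : ∀ a ∈ S, τ a = a) :
    numCycles σ + numCycles τ = Fintype.card E + numCycles (σ * τ) := by
  classical
  have hσS : ∀ a, σ a ∈ S ↔ a ∈ S := by
    intro a
    by_cases ha : a ∈ S
    · refine iff_of_true ?_ ha
      by_contra h
      have := σ.injective (hσ _ h)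
      exact h (this.symm ▸ ha)
    · rw [hσ a ha]
  have hτS : ∀ a, τ a ∈ S ↔ a ∈ S := by
    intro a
    by_cases ha : a ∈ S
    · rw [hτ a ha]
    · refine iff_of_false (fun h => ?_) ha
      have := τ.injective (hτ _ h)
      exact ha (this ▸ h)
  simp only [← finrank_invariantSubmodule]
  rw [← Submodule.finrank_sup_add_finrank_inf_eq, ← Module.finrank_fintype_fun_eq_card ℝ]
  congr 1
  · have : invariantSubmodule σ ⊔ invariantSubmodule τ = ⊤ := by
      refine eq_top_iff.2 fun v _ => ?_
      -- Split `v` into its parts off `S` and on `S`: the first is invariant under `σ`, which only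
      -- moves points of `S`, the second under `τ`.
      refine Submodule.mem_sup.2 ⟨fun a => if a ∈ S then 0 else v a, fun a => ?_,
        fun a => if a ∈ S then v a else 0, fun a => ?_, ?_⟩
      · simp only [hσS]
        split_ifs with h
        · rfl
        · rw [hσ a h]
      · simp only [hτS]
        split_ifs with h
        · rw [hτ a h]
        · rfl
      · funext a
        by_cases h : a ∈ S <;> simp [h]
    rw [this, finrank_top]
  · refine congrArg (fun K : Submodule ℝ (E → ℝ) => Module.finrank ℝ K) ?_
    ext v
    exact (invariant_mul_of_disjoint S hσ hτ).symm

/-! ### Multiplication by a transposition and Euler's inequality -/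

variable [DecidableEq E]

theorem invariant_swap {α : Type*} {x y : E} {v : E → α} :
    Invariant (Equiv.swap x y) v ↔ v x = v y := by
  constructor
  · intro h
    have := h x
    rw [Equiv.swap_apply_left] at this
    exact this.symm
  · intro h a
    rw [Equiv.swap_apply_def]
    split_ifs with h1 h2
    · rw [h1, h]
    · rw [h2, h]
    · rfl

/-- The extra condition `v x = v y` is the vanishing of a single linear functional. -/
theorem finrank_inf_eq_le (K : Submodule ℝ (E → ℝ)) (x y : E) :
    Module.finrank ℝ K ≤
      Module.finrank ℝ (K ⊓ invariantSubmodule (Equiv.swap x y) : Submodule ℝ (E → ℝ)) + 1 := by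
  let φ : K →ₗ[ℝ] ℝ :=
    ((LinearMap.proj x : (E → ℝ) →ₗ[ℝ] ℝ) - LinearMap.proj y) ∘ₗ K.subtype
  have h1 := φ.finrank_range_add_finrank_ker
  have h2 : Module.finrank ℝ (LinearMap.range φ) ≤ 1 :=
    (Submodule.finrank_le _).trans (by simp)
  have h3 : (LinearMap.ker φ).map K.subtype = K ⊓ invariantSubmodule (Equiv.swap x y) := by
    ext v
    simp only [Submodule.mem_map, LinearMap.mem_ker, Submodule.mem_inf, mem_invariantSubmodule,
      invariant_swap]
    constructor
    · rintro ⟨w, hw, rfl⟩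
      exact ⟨w.2, sub_eq_zero.1 hw⟩
    · rintro ⟨hv, h⟩
      exact ⟨⟨v, hv⟩, sub_eq_zero.2 h, rfl⟩
  rw [← h3, ← (Submodule.equivMapOfInjective _ K.injective_subtype _).finrank_eq]
  omega

/-- The sums of `v ∘ σ` and of `v` over the `σ`-cycle of `x` agree. As `y` is not in that cycle,
invariance cancels every term except the one at `x`, leaving `v (σ x) = v x`; invariance at `y`
reads `v (σ x) = v y`. -/
theorem invariant_mul_swap {σ : Equiv.Perm E} {x y : E} (h : ¬ σ.SameCycle x y) {v : E → ℝ} :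
    Invariant (σ * Equiv.swap x y) v ↔ Invariant σ v ∧ v x = v y := by
  classical
  constructor
  · intro hv
    have hxy : v x = v y := by
      set C : Finset E := univ.filter fun a => σ.SameCycle x a
      have hC : ∑ a ∈ C, v (σ a) = ∑ a ∈ C, v a := by
        refine Finset.sum_equiv σ (fun a => ?_) (fun a _ => rfl)
        simp [C]
      have hxC : x ∈ C := by simp [C, Equiv.Perm.SameCycle.refl σ x]
      rw [← Finset.add_sum_erase _ _ hxC, ← Finset.add_sum_erase C v hxC] at hC
      have : ∑ a ∈ C.erase x, v (σ a) = ∑ a ∈ C.erase x, v a := by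
        refine Finset.sum_congr rfl fun a ha => ?_
        have hax : a ≠ x := Finset.ne_of_mem_erase ha
        have hay : a ≠ y := fun e => h (by
          have := Finset.mem_of_mem_erase ha
          simpa [C, e] using this)
        have := hv a
        rwa [Equiv.Perm.mul_apply, Equiv.swap_apply_of_ne_of_ne hax hay] at this
      rw [this] at hC
      have h1 := hv y
      rw [Equiv.Perm.mul_apply, Equiv.swap_apply_right] at h1
      linarith
    refine ⟨?_, hxy⟩
    have := hv.mul (invariant_swap.2 hxy)
    rwa [mul_assoc, Equiv.swap_mul_self, mul_one] at this
  · rintro ⟨h1, h2⟩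
    exact h1.mul (invariant_swap.2 h2)

theorem numCycles_mul_swap_of_not_sameCycle {σ : Equiv.Perm E} {x y : E}
    (h : ¬ σ.SameCycle x y) : numCycles (σ * Equiv.swap x y) + 1 = numCycles σ := by
  have h1 : invariantSubmodule (σ * Equiv.swap x y) =
      invariantSubmodule σ ⊓ invariantSubmodule (Equiv.swap x y) := by
    ext v
    simp only [Submodule.mem_inf, mem_invariantSubmodule, invariant_mul_swap h, invariant_swap]
  have h2 := finrank_inf_eq_le (invariantSubmodule σ) x y
  have h3 : Module.finrank ℝ (invariantSubmodule (σ * Equiv.swap x y)) <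
      Module.finrank ℝ (invariantSubmodule σ) := by
    refine Submodule.finrank_lt_finrank_of_lt (lt_of_le_of_ne (h1 ▸ inf_le_left) fun e => h ?_)
    have : cycleIndicator σ x ∈ invariantSubmodule (σ * Equiv.swap x y) :=
      e ▸ invariant_cycleIndicator σ x
    have := ((invariant_mul_swap h).1 this).2
    by_contra h'
    simp [cycleIndicator, h', Equiv.Perm.SameCycle.refl σ x] at this
  rw [← h1] at h2
  simp only [finrank_invariantSubmodule] at h2 h3
  omega

theorem not_sameCycle_mul_swap {σ : Equiv.Perm E} {x y : E} (hxy : x ≠ y) (h : σ.SameCycle x y) :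
    ¬ (σ * Equiv.swap x y).SameCycle x y := by
  classical
  have hex : ∃ k : ℕ, (σ ^ k) x = y := h.exists_nat_pow_eq
  set k := Nat.find hex
  have hk : (σ ^ k) x = y := Nat.find_spec hex
  have hmin : ∀ j < k, (σ ^ j) x ≠ y := fun j hj => Nat.find_min hex hj
  have hk0 : k ≠ 0 := fun e => hxy (by simpa [e] using hk)
  -- The arc `σ x, …, σ ^ k x = y`, with `k` the first time the orbit of `x` hits `y`, is one of the
  -- two cycles into which the transposition cuts the cycle of `x`. It contains `y` but not `x`.
  let v : E → Prop := fun z => ∃ j, 1 ≤ j ∧ j ≤ k ∧ (σ ^ j) x = z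
  have hvy : v y := ⟨k, by omega, le_rfl, hk⟩
  have hvx : ¬ v x := by
    rintro ⟨j, hj1, hj2, hj⟩
    refine hmin (k - j) (by omega) ?_
    rw [← hj, ← Equiv.Perm.mul_apply, ← pow_add, Nat.sub_add_cancel hj2, hk]
  have hv : Invariant (σ * Equiv.swap x y) v := by
    intro z
    rw [Equiv.Perm.mul_apply, Equiv.swap_apply_def]
    split_ifs with h1 h2
    · subst h1
      refine propext (iff_of_false ?_ hvx)
      rintro ⟨j, hj1, hj2, hj⟩
      obtain ⟨i, rfl⟩ : ∃ i, j = i + 1 := ⟨j - 1, by omega⟩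
      rw [pow_succ', Equiv.Perm.mul_apply] at hj
      exact hmin i (by omega) (σ.injective hj)
    · subst h2
      exact propext (iff_of_true ⟨1, le_rfl, by omega, by simp⟩ hvy)
    · refine propext ⟨?_, ?_⟩
      · rintro ⟨j, hj1, hj2, hj⟩
        obtain ⟨i, rfl⟩ : ∃ i, j = i + 1 := ⟨j - 1, by omega⟩
        rw [pow_succ', Equiv.Perm.mul_apply] at hj
        have hi := σ.injective hj
        refine ⟨i, ?_, by omega, hi⟩
        by_contra h0
        have : i = 0 := by omega
        subst this
        exact h1 (by simpa using hi.symm)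
      · rintro ⟨j, hj1, hj2, hj⟩
        refine ⟨j + 1, by omega, ?_, by rw [pow_succ', Equiv.Perm.mul_apply, hj]⟩
        by_contra h0
        have : j = k := by omega
        subst this
        exact h2 (hj.symm.trans hk)
  intro hs
  exact hvx ((hv.eq_of_sameCycle hs).symm ▸ hvy)

theorem numCycles_mul_swap_of_sameCycle {σ : Equiv.Perm E} {x y : E} (hxy : x ≠ y)
    (h : σ.SameCycle x y) : numCycles (σ * Equiv.swap x y) = numCycles σ + 1 := by
  have := numCycles_mul_swap_of_not_sameCycle (not_sameCycle_mul_swap hxy h)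
  rw [mul_assoc, Equiv.swap_mul_self, mul_one] at this
  omega

theorem numCycles_swap_mul_of_not_sameCycle {σ : Equiv.Perm E} {x y : E}
    (h : ¬ σ.SameCycle x y) : numCycles (Equiv.swap x y * σ) + 1 = numCycles σ := by
  rw [numCycles_mul_comm]; exact numCycles_mul_swap_of_not_sameCycle h

theorem numCycles_swap_mul_of_sameCycle {σ : Equiv.Perm E} {x y : E} (hxy : x ≠ y)
    (h : σ.SameCycle x y) : numCycles (Equiv.swap x y * σ) = numCycles σ + 1 := by
  rw [numCycles_mul_comm]; exact numCycles_mul_swap_of_sameCycle hxy h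

theorem numCycles_swap_mul_le (σ : Equiv.Perm E) (x y : E) :
    numCycles (Equiv.swap x y * σ) ≤ numCycles σ + 1 := by
  by_cases hxy : x = y
  · subst hxy
    rw [Equiv.swap_self]
    exact Nat.le_succ _
  · by_cases h : σ.SameCycle x y
    · exact (numCycles_swap_mul_of_sameCycle hxy h).le
    · have := numCycles_swap_mul_of_not_sameCycle h; omega

theorem not_sameCycle_of_apply_eq {σ : Equiv.Perm E} {x y : E} (hxy : x ≠ y) (h : σ x = x) :
    ¬ σ.SameCycle x y := by
  rintro ⟨k, hk⟩
  exact hxy ((Function.IsFixedPt.perm_zpow h k).symm.trans hk)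

theorem numCycles_formPerm {l : List E} (hl : l.Nodup) (h0 : l ≠ []) :
    numCycles l.formPerm + l.length = Fintype.card E + 1 := by
  induction l with
  | nil => exact absurd rfl h0
  | cons x t ih =>
    cases t with
    | nil => simp [numCycles_one]
    | cons y t =>
      rw [List.formPerm_cons_cons]
      have hx : (y :: t).formPerm x = x := List.formPerm_apply_of_notMem (List.nodup_cons.1 hl).1
      have hxy : x ≠ y := fun e => (List.nodup_cons.1 hl).1 (by simp [e])
      have h1 := numCycles_swap_mul_of_not_sameCycle (not_sameCycle_of_apply_eq hxy hx)
      have h2 := ih (List.nodup_cons.1 hl).2 (by simp)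
      simp only [List.length_cons] at h2 ⊢
      omega

/-- Euler's inequality for a permutation and a cycle, in terms of the number of connected
components. -/
theorem euler_inequality_formPerm (α : Equiv.Perm E) {l : List E} (hl : l.Nodup) :
    numCycles α + numCycles l.formPerm + numCycles (l.formPerm * α) ≤ Fintype.card E +
      2 * Module.finrank ℝ
        (invariantSubmodule α ⊓ invariantSubmodule l.formPerm : Submodule ℝ (E → ℝ)) := by
  have base : numCycles α + numCycles (1 : Equiv.Perm E) + numCycles (1 * α) ≤ Fintype.card E +
      2 * Module.finrank ℝ
        (invariantSubmodule α ⊓ invariantSubmodule (1 : Equiv.Perm E) : Submodule ℝ (E → ℝ)) := by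
    have : invariantSubmodule (1 : Equiv.Perm E) = ⊤ := by
      ext v; simp [mem_invariantSubmodule, Invariant]
    rw [this, inf_top_eq, one_mul, numCycles_one, finrank_invariantSubmodule]
    omega
  induction l with
  | nil => rw [List.formPerm_nil]; exact base
  | cons x t ih =>
    cases t with
    | nil => rw [List.formPerm_singleton]; exact base
    | cons y t =>
      rw [List.formPerm_cons_cons]
      have hx : (y :: t).formPerm x = x := List.formPerm_apply_of_notMem (List.nodup_cons.1 hl).1
      have hxy : x ≠ y := fun e => (List.nodup_cons.1 hl).1 (by simp [e])
      have ih := ih (List.nodup_cons.1 hl).2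
      set β := (y :: t).formPerm
      have hns := not_sameCycle_of_apply_eq hxy hx
      have h1 := numCycles_swap_mul_of_not_sameCycle hns
      have hK : invariantSubmodule α ⊓ invariantSubmodule (Equiv.swap x y * β) =
          (invariantSubmodule α ⊓ invariantSubmodule β) ⊓
            invariantSubmodule (Equiv.swap x y) := by
        rw [inf_assoc]
        congr 1
        have h2 : invariantSubmodule (Equiv.swap x y * β) =
            invariantSubmodule (Equiv.swap x y) ⊓ invariantSubmodule β := by
          refine (Submodule.eq_of_le_of_finrank_le ?_ ?_).symm
          · rintro v ⟨h1, h2⟩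
            exact Invariant.mul h1 h2
          have := finrank_inf_eq_le (invariantSubmodule β) x y
          rw [inf_comm] at this
          simp only [finrank_invariantSubmodule] at this ⊢
          omega
        rw [h2, inf_comm]
      rw [hK, mul_assoc]
      set K := invariantSubmodule α ⊓ invariantSubmodule β
      have h3 := finrank_inf_eq_le K x y
      have h4 := numCycles_swap_mul_le (β * α) x y
      -- If `x` and `y` are already in one component, the components do not change and a cycle
      -- gained by the product is paid for by the cycle lost by `β`. Otherwise `x` and `y` lie in
      -- different cycles of `β * α`, so two cycles are lost on the left, while the component count,
      -- which has weight 2, drops by at most one.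
      by_cases hall : K ≤ invariantSubmodule (Equiv.swap x y)
      · rw [inf_eq_left.2 hall]
        omega
      · have : ¬ (β * α).SameCycle x y := fun hs => hall fun v hv =>
          invariant_swap.2 ((Invariant.mul hv.2 hv.1).eq_of_sameCycle hs)
        have := numCycles_swap_mul_of_not_sameCycle this
        omega

end Finite

end CycleCount

namespace CycleCount

variable {E : Type*} [Fintype E] [DecidableEq E]

set_option linter.unusedSectionVars false

/-! ### Cutting geodesics to a cycle -/

theorem swap_mul_formPerm_append {x y : E} {l₀ l₁ : List E} (h : (x :: (l₀ ++ y :: l₁)).Nodup) :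
    Equiv.swap x y * (x :: (l₀ ++ y :: l₁)).formPerm =
      (x :: l₀).formPerm * (y :: l₁).formPerm := by
  induction l₀ generalizing x with
  | nil =>
    rw [List.nil_append, List.formPerm_cons_cons, ← mul_assoc, Equiv.swap_mul_self, one_mul,
      List.formPerm_singleton, one_mul]
  | cons z l₀ ih =>
    have hxy : x ≠ y := fun e => (List.nodup_cons.1 h).1 (by simp [e])
    have hxz : x ≠ z := fun e => (List.nodup_cons.1 h).1 (by simp [e])
    have h' := (List.nodup_cons.1 h).2
    have hzy : z ≠ y := fun e => (List.nodup_cons.1 h').1 (by simp [e])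
    have ih := ih h'
    rw [List.cons_append, List.formPerm_cons_cons, List.formPerm_cons_cons, mul_assoc, ← ih,
      ← mul_assoc, ← mul_assoc]
    congr 1
    ext a
    simp only [Equiv.Perm.mul_apply, Equiv.swap_apply_def]
    split_ifs <;> simp_all

/-- Prepending `x` to the cycle multiplies on the left by a transposition that attaches `x`, a fixed
point both of the old cycle and of its product with `σ`. Both sides of the geodesic equation lose
one cycle. -/
theorem geodesic_cons_of_apply_eq {x : E} {t : List E} (h : (x :: t).Nodup) {σ : Equiv.Perm E}
    (hσ : σ x = x) : Geodesic (x :: t).formPerm σ ↔ Geodesic t.formPerm σ := by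
  cases t with
  | nil => rw [List.formPerm_singleton, List.formPerm_nil]
  | cons y t =>
    have hx : (y :: t).formPerm x = x := List.formPerm_apply_of_notMem (List.nodup_cons.1 h).1
    have hxy : x ≠ y := fun e => (List.nodup_cons.1 h).1 (by simp [e])
    have h1 := numCycles_swap_mul_of_not_sameCycle (not_sameCycle_of_apply_eq hxy hx)
    have h2 := numCycles_swap_mul_of_not_sameCycle
      (not_sameCycle_of_apply_eq hxy (σ := (y :: t).formPerm * σ) (by simp [hσ, hx]))
    rw [List.formPerm_cons_cons]
    unfold Geodesic
    rw [mul_assoc]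
    omega

theorem Geodesic.apply_eq_of_notMem {l : List E} {σ : Equiv.Perm E} (h : Geodesic l.formPerm σ)
    {a : E} (ha : a ∉ l) : σ a = a :=
  h.apply_eq (List.formPerm_apply_of_notMem ha)

/-- Since `σ y = x`, moving the transposition from the cycle to `σ` cuts one cycle in each: `σ *
swap x y` and `swap x y * γ` both gain one. Their product with the two transpositions inside has as
many cycles as `γ * σ`, by cyclic invariance. -/
theorem geodesic_append_iff {x y : E} {l₀ l₁ : List E} (h : (x :: (l₀ ++ y :: l₁)).Nodup)
    {σ : Equiv.Perm E} (hσ : σ y = x) :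
    Geodesic (x :: (l₀ ++ y :: l₁)).formPerm σ ↔
      Geodesic ((x :: l₀).formPerm * (y :: l₁).formPerm) (σ * Equiv.swap x y) := by
  have hxy : x ≠ y := fun e => (List.nodup_cons.1 h).1 (by simp [e])
  have h1 := numCycles_mul_swap_of_sameCycle hxy
    (σ := σ) (Equiv.Perm.SameCycle.symm ⟨1, by simpa using hσ⟩)
  rw [← swap_mul_formPerm_append h]
  set γ := (x :: (l₀ ++ y :: l₁)).formPerm with hγ
  have h2 : numCycles (Equiv.swap x y * γ) = numCycles γ + 1 := by
    have e1 := numCycles_formPerm h (by simp)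
    have e2 : numCycles (x :: l₀).formPerm + numCycles (y :: l₁).formPerm =
        Fintype.card E + numCycles ((x :: l₀).formPerm * (y :: l₁).formPerm) := by
      refine numCycles_mul_of_disjoint {a | a ∈ x :: l₀}
        (fun a ha => List.formPerm_apply_of_notMem ha)
        (fun a ha => List.formPerm_apply_of_notMem fun ha' => ?_)
      rw [← List.cons_append] at h
      exact (List.nodup_append.1 h).2.2 a ha a ha' rfl
    rw [← List.cons_append] at h
    have e3 := numCycles_formPerm (List.nodup_append.1 h).1 (by simp)
    have e4 := numCycles_formPerm (List.nodup_append.1 h).2.1 (by simp)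
    rw [hγ, swap_mul_formPerm_append (by simpa using h)]
    simp only [List.length_cons, List.length_append] at e1 e3 e4
    omega
  unfold Geodesic
  have h3 : numCycles (Equiv.swap x y * γ * (σ * Equiv.swap x y)) = numCycles (γ * σ) := by
    rw [numCycles_mul_comm, numCycles_mul_comm γ]
    congr 1
    rw [mul_assoc, ← mul_assoc (Equiv.swap x y), Equiv.swap_mul_self, one_mul]
  rw [h1, h2, h3]
  omega

theorem commute_of_disjoint {σ τ : Equiv.Perm E} (S : Set E) (hσ : ∀ a ∉ S, σ a = a)
    (hτ : ∀ a ∈ S, τ a = a) : σ * τ = τ * σ := by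
  refine Equiv.Perm.Disjoint.commute fun a => ?_
  by_cases ha : a ∈ S
  · exact Or.inr (hτ a ha)
  · exact Or.inl (hσ a ha)

/-- The defects in the triangle inequality add up for disjoint supports, and they are non-negative,
so the sum vanishes only if both do. -/
theorem geodesic_mul_of_disjoint {γ₀ γ₁ σ₀ σ₁ : Equiv.Perm E} (S : Set E)
    (hγ₀ : ∀ a ∉ S, γ₀ a = a) (hσ₀ : ∀ a ∉ S, σ₀ a = a)
    (hγ₁ : ∀ a ∈ S, γ₁ a = a) (hσ₁ : ∀ a ∈ S, σ₁ a = a) :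
    Geodesic (γ₀ * γ₁) (σ₀ * σ₁) ↔ Geodesic γ₀ σ₀ ∧ Geodesic γ₁ σ₁ := by
  have h1 := numCycles_mul_of_disjoint S hγ₀ hγ₁
  have h2 := numCycles_mul_of_disjoint S hσ₀ hσ₁
  have h3 := numCycles_mul_of_disjoint (σ := γ₀ * σ₀) (τ := γ₁ * σ₁) S
    (fun a ha => by rw [Equiv.Perm.mul_apply, hσ₀ a ha, hγ₀ a ha])
    (fun a ha => by rw [Equiv.Perm.mul_apply, hσ₁ a ha, hγ₁ a ha])
  have h4 : γ₀ * σ₀ * (γ₁ * σ₁) = γ₀ * γ₁ * (σ₀ * σ₁) := by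
    rw [mul_assoc, ← mul_assoc σ₀, commute_of_disjoint S hσ₀ hγ₁, mul_assoc, mul_assoc]
  rw [h4] at h3
  have h5 := numCycles_add_le γ₀ σ₀
  have h6 := numCycles_add_le γ₁ σ₁
  unfold Geodesic
  omega

theorem exists_mul_of_mem_iff {σ : Equiv.Perm E} {S : Set E} (h : ∀ a, σ a ∈ S ↔ a ∈ S) :
    ∃ σ₀ σ₁ : Equiv.Perm E, σ = σ₀ * σ₁ ∧ (∀ a ∉ S, σ₀ a = a) ∧ ∀ a ∈ S, σ₁ a = a := by
  classical
  have hS : ∀ a, a ∈ S ↔ σ a ∈ S := fun a => (h a).symm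
  have hS' : ∀ a, a ∉ S ↔ σ a ∉ S := fun a => not_congr (hS a)
  have h0 : ∀ a ∉ S, Equiv.Perm.ofSubtype (σ.subtypePerm h) a = a := fun a ha =>
    Equiv.Perm.ofSubtype_apply_of_not_mem _ ha
  have h1 : ∀ a ∈ S, Equiv.Perm.ofSubtype (p := fun a => a ∉ S)
      (σ.subtypePerm fun a => (hS' a).symm) a = a :=
    fun a ha => Equiv.Perm.ofSubtype_apply_of_not_mem _ (not_not.2 ha)
  refine ⟨_, _, ?_, h0, h1⟩
  ext a
  rw [Equiv.Perm.mul_apply]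
  by_cases ha : a ∈ S
  · rw [h1 a ha, Equiv.Perm.ofSubtype_apply_of_mem _ ha]
    rfl
  · rw [Equiv.Perm.ofSubtype_apply_of_mem (p := fun a => a ∉ S) _ ha, h0]
    · rfl
    · exact (hS' a).1 ha

/-! ### Gluing a geodesic from its two pieces -/

section Split

variable {x y : E} {l₀ l₁ : List E}

theorem notMem_of_mem_left (h : (x :: (l₀ ++ y :: l₁)).Nodup) {a : E} (ha : a ∈ l₀) :
    a ≠ x ∧ a ∉ y :: l₁ :=
  ⟨fun e => (List.nodup_cons.1 h).1 (by simp [← e, ha]),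
    fun h' => (List.nodup_append.1 (List.nodup_cons.1 h).2).2.2 a ha a h' rfl⟩

theorem head_notMem (h : (x :: (l₀ ++ y :: l₁)).Nodup) : x ∉ l₀ ∧ x ∉ y :: l₁ :=
  ⟨fun e => (List.nodup_cons.1 h).1 (by simp [e]),
    fun e => (List.nodup_cons.1 h).1 (List.mem_append.2 (Or.inr e))⟩

theorem fixes_of_geodesic (h : (x :: (l₀ ++ y :: l₁)).Nodup) {σ₁ : Equiv.Perm E}
    (h₁ : Geodesic (y :: l₁).formPerm σ₁) : ∀ a ∈ {a | a ∈ x :: l₀}, σ₁ a = a := by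
  intro a ha
  refine h₁.apply_eq_of_notMem ?_
  rcases List.mem_cons.1 ha with rfl | ha
  · exact (head_notMem h).2
  · exact (notMem_of_mem_left h ha).2

theorem fixes_of_geodesic' {σ₀ : Equiv.Perm E}
    (h₀ : Geodesic l₀.formPerm σ₀) : ∀ a ∉ {a | a ∈ x :: l₀}, σ₀ a = a := fun _ ha =>
  h₀.apply_eq_of_notMem fun h => ha (List.mem_cons_of_mem _ h)

/-- Gluing two geodesics. -/
theorem geodesic_glue (h : (x :: (l₀ ++ y :: l₁)).Nodup) {σ₀ σ₁ : Equiv.Perm E}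
    (h₀ : Geodesic l₀.formPerm σ₀) (h₁ : Geodesic (y :: l₁).formPerm σ₁) :
    Geodesic (x :: (l₀ ++ y :: l₁)).formPerm (σ₀ * σ₁ * Equiv.swap x y) := by
  have hx₀ : σ₀ x = x := h₀.apply_eq_of_notMem (head_notMem h).1
  have hx₁ : σ₁ x = x := h₁.apply_eq_of_notMem (head_notMem h).2
  have hl₀ : (x :: l₀).Nodup := by
    rw [← List.cons_append] at h; exact (List.nodup_append.1 h).1
  rw [geodesic_append_iff h (by simp [hx₀, hx₁]), mul_assoc _ (Equiv.swap x y),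
    Equiv.swap_mul_self, mul_one]
  exact (geodesic_mul_of_disjoint {a | a ∈ x :: l₀}
    (fun a ha => List.formPerm_apply_of_notMem ha) (fixes_of_geodesic' h₀)
    (fun a ha => List.formPerm_apply_of_notMem fun ha' => by
      rcases List.mem_cons.1 ha with rfl | ha
      · exact (head_notMem h).2 ha'
      · exact (notMem_of_mem_left h ha).2 ha')
    (fixes_of_geodesic h h₁)).2 ⟨(geodesic_cons_of_apply_eq hl₀ hx₀).2 h₀, h₁⟩

/-- Every geodesic that moves the first point arises by gluing. -/
theorem Geodesic.exists_glue (h : (x :: (l₀ ++ y :: l₁)).Nodup) {σ : Equiv.Perm E}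
    (hg : Geodesic (x :: (l₀ ++ y :: l₁)).formPerm σ) (hσ : σ y = x) :
    ∃ σ₀ σ₁ : Equiv.Perm E, σ = σ₀ * σ₁ * Equiv.swap x y ∧ Geodesic l₀.formPerm σ₀ ∧
      Geodesic (y :: l₁).formPerm σ₁ := by
  have hl₀ : (x :: l₀).Nodup := by
    rw [← List.cons_append] at h; exact (List.nodup_append.1 h).1
  rw [geodesic_append_iff h hσ] at hg
  set S : Set E := {a | a ∈ x :: l₀}
  have hγ₀ : ∀ a ∉ S, (x :: l₀).formPerm a = a := fun a ha => List.formPerm_apply_of_notMem ha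
  have hγ₁ : ∀ a ∈ S, (y :: l₁).formPerm a = a := fun a ha =>
    List.formPerm_apply_of_notMem fun ha' => by
      rcases List.mem_cons.1 ha with rfl | ha
      · exact (head_notMem h).2 ha'
      · exact (notMem_of_mem_left h ha).2 ha'
  have hinv₀ : Invariant (x :: l₀).formPerm (fun a => a ∈ S) := fun a =>
    propext (List.formPerm_mem_iff_mem)
  have hinv₁ : Invariant (y :: l₁).formPerm (fun a => a ∈ S) := fun a => by
    by_cases ha : a ∈ S
    · rw [hγ₁ a ha]
    · refine propext (iff_of_false (fun h' => ?_) ha)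
      have := (y :: l₁).formPerm.injective (hγ₁ _ h')
      exact ha (this ▸ h')
  -- Membership in `x :: l₀` is constant on the cycles of the cut cycle, hence on those of `σ * swap
  -- x y`, because a geodesic stays inside the cycles of its target.
  have hS : ∀ a, (σ * Equiv.swap x y) a ∈ S ↔ a ∈ S := fun a =>
    Iff.of_eq ((hinv₀.mul hinv₁).eq_of_sameCycle (hg.sameCycle a)).symm
  obtain ⟨σ₀, σ₁, he, h₀, h₁⟩ := exists_mul_of_mem_iff hS
  rw [he, geodesic_mul_of_disjoint S hγ₀ h₀ hγ₁ h₁] at hg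
  have hxS : x ∈ S := List.mem_cons_self
  have hx₀ : σ₀ x = x := by
    have := congrArg (fun τ : Equiv.Perm E => τ x) he
    simpa [h₁ x hxS, hσ] using this.symm
  refine ⟨σ₀, σ₁, ?_, (geodesic_cons_of_apply_eq hl₀ hx₀).1 hg.1, hg.2⟩
  rw [← he, mul_assoc, Equiv.swap_mul_self, mul_one]

theorem glue_inj (h : (x :: (l₀ ++ y :: l₁)).Nodup) {σ₀ σ₁ τ₀ τ₁ : Equiv.Perm E}
    (h₀ : Geodesic l₀.formPerm σ₀) (h₁ : Geodesic (y :: l₁).formPerm σ₁)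
    (h₀' : Geodesic l₀.formPerm τ₀) (h₁' : Geodesic (y :: l₁).formPerm τ₁)
    (he : σ₀ * σ₁ * Equiv.swap x y = τ₀ * τ₁ * Equiv.swap x y) : σ₀ = τ₀ ∧ σ₁ = τ₁ := by
  have he := mul_right_cancel he
  have hσ₀ : σ₀ = τ₀ := by
    ext a
    by_cases ha : a ∈ x :: l₀
    · have := congrArg (fun τ : Equiv.Perm E => τ a) he
      simpa [fixes_of_geodesic h h₁ a ha, fixes_of_geodesic h h₁' a ha] using this
    · rw [fixes_of_geodesic' h₀ a ha, fixes_of_geodesic' h₀' a ha]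
  subst hσ₀
  exact ⟨rfl, mul_left_cancel he⟩

theorem invariant_glue (h : (x :: (l₀ ++ y :: l₁)).Nodup) {σ₀ σ₁ : Equiv.Perm E}
    (h₀ : Geodesic l₀.formPerm σ₀) (h₁ : Geodesic (y :: l₁).formPerm σ₁) {α : Type*} {v : E → α} :
    Invariant (σ₀ * σ₁ * Equiv.swap x y) v ↔ Invariant σ₀ v ∧ Invariant σ₁ v ∧ v x = v y := by
  have hx₀ : σ₀ x = x := h₀.apply_eq_of_notMem (head_notMem h).1
  have hx₁ : σ₁ x = x := h₁.apply_eq_of_notMem (head_notMem h).2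
  rw [← and_assoc, ← invariant_mul_of_disjoint _ (fixes_of_geodesic' h₀) (fixes_of_geodesic h h₁)]
  constructor
  · intro hv
    have hxy : v x = v y := by simpa [hx₀, hx₁] using hv y
    refine ⟨?_, hxy⟩
    have := hv.mul (invariant_swap.2 hxy)
    rwa [mul_assoc, Equiv.swap_mul_self, mul_one] at this
  · exact fun hv => hv.1.mul (invariant_swap.2 hv.2)

theorem numCycles_glue (h : (x :: (l₀ ++ y :: l₁)).Nodup) {σ₀ σ₁ : Equiv.Perm E}
    (h₀ : Geodesic l₀.formPerm σ₀) (h₁ : Geodesic (y :: l₁).formPerm σ₁) :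
    numCycles σ₀ + numCycles σ₁ =
      Fintype.card E + 1 + numCycles (σ₀ * σ₁ * Equiv.swap x y) := by
  have hxy : x ≠ y := fun e => (List.nodup_cons.1 h).1 (by simp [e])
  have hx₀ : σ₀ x = x := h₀.apply_eq_of_notMem (head_notMem h).1
  have hx₁ : σ₁ x = x := h₁.apply_eq_of_notMem (head_notMem h).2
  have e1 := numCycles_mul_of_disjoint _ (fixes_of_geodesic' h₀) (fixes_of_geodesic h h₁)
  have e2 := numCycles_mul_swap_of_not_sameCycle
    (not_sameCycle_of_apply_eq hxy (σ := σ₀ * σ₁) (by simp [hx₀, hx₁]))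
  omega

end Split

end CycleCount

namespace CycleCount

set_option linter.unusedSectionVars false

/-! ### Geodesics and non-crossing equivalence relations -/

section NonCrossing

variable {E : Type*} [LinearOrder E]

/-- An equivalence relation is non-crossing. -/
def NonCrossing (r : Setoid E) : Prop :=
  ∀ a b c d : E, a < b → b < c → c < d → r a c → r b d → r a b

/-- The function `v` is constant along the classes of `r`. -/
def ClassInvariant (r : Setoid E) (v : E → ℝ) : Prop := ∀ a b, r a b → v a = v b

/-- All classes of `r` that meet the complement of `l` are singletons. -/
def SupportedIn (r : Setoid E) (l : List E) : Prop := ∀ a b, r a b → a ≠ b → a ∈ l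

/-- The trace of an equivalence relation on a set; elements outside are singletons. -/
def restrictSetoid (r : Setoid E) (S : E → Prop) : Setoid E where
  r a b := a = b ∨ (S a ∧ S b ∧ r a b)
  iseqv :=
    { refl := fun _ => Or.inl rfl
      symm := by
        rintro a b (rfl | ⟨ha, hb, h⟩)
        · exact Or.inl rfl
        · exact Or.inr ⟨hb, ha, r.symm h⟩
      trans := by
        rintro a b c (rfl | ⟨ha, hb, h⟩) (rfl | ⟨hb', hc, h'⟩)
        · exact Or.inl rfl
        · exact Or.inr ⟨hb', hc, h'⟩
        · exact Or.inr ⟨ha, hb, h⟩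
        · exact Or.inr ⟨ha, hc, r.trans h h'⟩ }

theorem nonCrossing_restrictSetoid {r : Setoid E} (hr : NonCrossing r) (S : E → Prop) :
    NonCrossing (restrictSetoid r S) := by
  rintro a b c d hab hbc hcd (rfl | ⟨ha, _, h⟩) (rfl | ⟨hb, _, h'⟩)
  · exact absurd (hab.trans hbc) (lt_irrefl _)
  · exact absurd (hab.trans hbc) (lt_irrefl _)
  · exact absurd (hbc.trans hcd) (lt_irrefl _)
  · exact Or.inr ⟨ha, hb, hr a b c d hab hbc hcd h h'⟩

theorem supportedIn_restrictSetoid (r : Setoid E) (l : List E) :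
    SupportedIn (restrictSetoid r (· ∈ l)) l := by
  rintro a b (rfl | ⟨ha, _, _⟩) hab
  · exact absurd rfl hab
  · exact ha

theorem exists_first_split (P : E → Prop) {l : List E} (h : ∃ a ∈ l, P a) :
    ∃ l₀ y l₁, l = l₀ ++ y :: l₁ ∧ P y ∧ ∀ a ∈ l₀, ¬ P a := by
  induction l with
  | nil => simp at h
  | cons z t ih =>
    by_cases hz : P z
    · exact ⟨[], z, t, rfl, hz, by simp⟩
    · obtain ⟨a, ha, hPa⟩ := h
      rcases List.mem_cons.1 ha with rfl | ha
      · exact absurd hPa hz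
      · obtain ⟨l₀, y, l₁, rfl, hy, h0⟩ := ih ⟨a, ha, hPa⟩
        refine ⟨z :: l₀, y, l₁, rfl, hy, fun b hb => ?_⟩
        rcases List.mem_cons.1 hb with rfl | hb
        · exact hz
        · exact h0 b hb

theorem first_split_unique (P : E → Prop) {l₀ l₁ m₀ m₁ : List E} {y z : E}
    (h : l₀ ++ y :: l₁ = m₀ ++ z :: m₁) (hy : P y) (hz : P z) (h₀ : ∀ a ∈ l₀, ¬ P a)
    (h₁ : ∀ a ∈ m₀, ¬ P a) : l₀ = m₀ ∧ y = z ∧ l₁ = m₁ := by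
  induction l₀ generalizing m₀ with
  | nil =>
    cases m₀ with
    | nil => simpa using h
    | cons b m₀ =>
      simp only [List.nil_append, List.cons_append, List.cons.injEq] at h
      exact absurd (h.1 ▸ hy) (h₁ b List.mem_cons_self)
  | cons a l₀ ih =>
    cases m₀ with
    | nil =>
      simp only [List.nil_append, List.cons_append, List.cons.injEq] at h
      exact absurd (h.1 ▸ hz) (h₀ a List.mem_cons_self)
    | cons b m₀ =>
      simp only [List.cons_append, List.cons.injEq] at h
      obtain ⟨e1, e2, e3⟩ := ih h.2 (fun c hc => h₀ c (List.mem_cons_of_mem _ hc))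
        (fun c hc => h₁ c (List.mem_cons_of_mem _ hc))
      exact ⟨by rw [h.1, e1], e2, e3⟩

section Sorted

variable {x y : E} {l₀ l₁ : List E}

theorem sorted_left (h : (x :: (l₀ ++ y :: l₁)).Pairwise (· < ·)) {a : E} (ha : a ∈ l₀) :
    x < a ∧ a < y := by
  obtain ⟨h1, h2⟩ := List.pairwise_cons.1 h
  exact ⟨h1 a (by simp [ha]), (List.pairwise_append.1 h2).2.2 a ha y List.mem_cons_self⟩

theorem sorted_right (h : (x :: (l₀ ++ y :: l₁)).Pairwise (· < ·)) {a : E} (ha : a ∈ y :: l₁) :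
    x < a ∧ y ≤ a := by
  obtain ⟨h1, h2⟩ := List.pairwise_cons.1 h
  refine ⟨h1 a (by simp [List.mem_cons.1 ha]), ?_⟩
  rcases List.mem_cons.1 ha with rfl | ha
  · exact le_rfl
  · exact ((List.pairwise_cons.1 (List.pairwise_append.1 h2).2.1).1 a ha).le

theorem sorted_parts (h : (x :: (l₀ ++ y :: l₁)).Pairwise (· < ·)) :
    l₀.Pairwise (· < ·) ∧ (y :: l₁).Pairwise (· < ·) :=
  ⟨(List.pairwise_append.1 (List.pairwise_cons.1 h).2).1,
    (List.pairwise_append.1 (List.pairwise_cons.1 h).2).2.1⟩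

theorem nodup_of_sorted {l : List E} (h : l.Pairwise (· < ·)) : l.Nodup :=
  h.imp fun hab => hab.ne

/-- Functions constant along the classes of a non-crossing relation, in terms of its two pieces. -/
theorem classInvariant_split (h : (x :: (l₀ ++ y :: l₁)).Pairwise (· < ·)) {r : Setoid E}
    (hr : NonCrossing r) (hs : SupportedIn r (x :: (l₀ ++ y :: l₁))) (hxy : r x y)
    (hl₀ : ∀ a ∈ l₀, ¬ r x a) (v : E → ℝ) :
    ClassInvariant r v ↔ ClassInvariant (restrictSetoid r (· ∈ l₀)) v ∧
      ClassInvariant (restrictSetoid r (· ∈ y :: l₁)) v ∧ v x = v y := by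
  constructor
  · refine fun hv => ⟨?_, ?_, hv _ _ hxy⟩
    · rintro a b (rfl | ⟨_, _, hab⟩)
      · rfl
      · exact hv _ _ hab
    · rintro a b (rfl | ⟨_, _, hab⟩)
      · rfl
      · exact hv _ _ hab
  · rintro ⟨h₀, h₁, hv⟩
    -- No class meets both pieces: if `b = y`, then `a` would be related to `x` before the first
    -- such point `y`; if `y < b`, then `x < a < y < b` is a crossing, which again relates `a` to
    -- `x`.
    have hlr : ∀ a ∈ l₀, ∀ b ∈ y :: l₁, ¬ r a b := by
      intro a ha b hb hab
      rcases (sorted_right h hb).2.eq_or_lt with rfl | hlt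
      · exact hl₀ a ha (r.trans hxy (r.symm hab))
      · exact hl₀ a ha (hr x a y b (sorted_left h ha).1 (sorted_left h ha).2 hlt hxy hab)
    have hx : ∀ b, r x b → v x = v b := by
      intro b hb
      by_cases hbx : x = b
      · rw [hbx]
      have hmem := hs b x (r.symm hb) (Ne.symm hbx)
      rcases List.mem_cons.1 hmem with e | hmem
      · exact absurd e.symm hbx
      rcases List.mem_append.1 hmem with hmem | hmem
      · exact absurd hb (hl₀ b hmem)
      · rw [hv]
        exact h₁ y b (Or.inr ⟨List.mem_cons_self, hmem, r.trans (r.symm hxy) hb⟩)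
    intro a b hab
    by_cases hne : a = b
    · rw [hne]
    have ha := hs a b hab hne
    have hb := hs b a (r.symm hab) (Ne.symm hne)
    rcases List.mem_cons.1 ha with rfl | ha
    · exact hx b hab
    rcases List.mem_cons.1 hb with rfl | hb
    · exact (hx a (r.symm hab)).symm
    rcases List.mem_append.1 ha with ha | ha <;> rcases List.mem_append.1 hb with hb | hb
    · exact h₀ a b (Or.inr ⟨ha, hb, hab⟩)
    · exact absurd hab (hlr a ha b hb)
    · exact absurd (r.symm hab) (hlr b hb a ha)
    · exact h₁ a b (Or.inr ⟨ha, hb, hab⟩)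

end Sorted

variable [Fintype E]

theorem sameCycle_iff_of_invariant_iff {σ : Equiv.Perm E} {r : Setoid E}
    (h : ∀ v : E → ℝ, Invariant σ v ↔ ClassInvariant r v) (a b : E) :
    σ.SameCycle a b ↔ r a b := by
  classical
  constructor
  · intro hs
    have hv : ClassInvariant r (fun c => if r a c then 1 else 0) := by
      intro c d hcd
      have : r a c ↔ r a d := ⟨fun h => r.trans h hcd, fun h => r.trans h (r.symm hcd)⟩
      simp [this]
    have := ((h _).2 hv).eq_of_sameCycle hs
    by_contra hab
    simp [hab] at this
  · exact fun hr => sameCycle_of_forall_invariant fun v hv => (h v).1 hv a b hr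

/-- Every non-crossing equivalence relation is the cycle relation of a geodesic. -/
theorem exists_geodesic (n : ℕ) : ∀ (l : List E), l.length ≤ n → l.Pairwise (· < ·) →
    ∀ r : Setoid E, NonCrossing r → SupportedIn r l →
      ∃ σ : Equiv.Perm E, Geodesic l.formPerm σ ∧
        ∀ v : E → ℝ, Invariant σ v ↔ ClassInvariant r v := by
  induction n with
  | zero =>
    intro l hl _ r _ hs
    obtain rfl := List.eq_nil_of_length_eq_zero (Nat.le_zero.1 hl)
    refine ⟨1, by simp [Geodesic, numCycles_one], fun v => iff_of_true (fun a => rfl) fun a b hab => ?_⟩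
    by_contra hne
    exact absurd (hs a b hab fun e => hne (by rw [e])) (by simp)
  | succ n ih =>
    intro l hl hsort r hr hs
    cases l with
    | nil => exact ih [] (Nat.zero_le _) hsort r hr hs
    | cons x t =>
      rw [List.length_cons] at hl
      by_cases hx : ∃ a ∈ t, r x a
      -- The cut point is the next element of the class of `x`. The two pieces of the relation are
      -- non-crossing and shorter, and gluing their geodesics adds back the relation between `x` and
      -- `y`.
      · obtain ⟨l₀, y, l₁, rfl, hxy, hl₀⟩ := exists_first_split (r x) hx
        have hlen : l₀.length ≤ n ∧ (y :: l₁).length ≤ n := by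
          simp only [List.length_append, List.length_cons] at hl ⊢
          omega
        have hnd := nodup_of_sorted hsort
        obtain ⟨σ₀, g₀, h₀⟩ := ih l₀ hlen.1 (sorted_parts hsort).1 _
          (nonCrossing_restrictSetoid hr (· ∈ l₀)) (supportedIn_restrictSetoid r l₀)
        obtain ⟨σ₁, g₁, h₁⟩ := ih (y :: l₁) hlen.2 (sorted_parts hsort).2 _
          (nonCrossing_restrictSetoid hr (· ∈ y :: l₁)) (supportedIn_restrictSetoid r (y :: l₁))
        refine ⟨σ₀ * σ₁ * Equiv.swap x y, geodesic_glue hnd g₀ g₁, fun v => ?_⟩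
        rw [invariant_glue hnd g₀ g₁, h₀, h₁, classInvariant_split hsort hr hs hxy hl₀]
      · have hst : SupportedIn r t := by
          intro a b hab hne
          rcases List.mem_cons.1 (hs a b hab hne) with rfl | ha
          · rcases List.mem_cons.1 (hs b a (r.symm hab) (Ne.symm hne)) with rfl | hb
            · exact absurd rfl hne
            · exact absurd ⟨b, hb, hab⟩ hx
          · exact ha
        obtain ⟨σ, g, h⟩ := ih t (by omega) (List.pairwise_cons.1 hsort).2 r hr hst
        have hnd := nodup_of_sorted hsort
        exact ⟨σ, (geodesic_cons_of_apply_eq hnd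
          (g.apply_eq_of_notMem (List.nodup_cons.1 hnd).1)).2 g, h⟩

theorem Geodesic.supportedIn {l : List E} {σ : Equiv.Perm E} (h : Geodesic l.formPerm σ) {a b : E}
    (hab : σ.SameCycle a b) (hne : a ≠ b) : a ∈ l := by
  by_contra ha
  exact not_sameCycle_of_apply_eq hne (h.apply_eq_of_notMem ha) hab

/-- Case analysis for geodesics to a cycle. -/
theorem Geodesic.cases {x : E} {t : List E} (h : (x :: t).Nodup) {σ : Equiv.Perm E}
    (hg : Geodesic (x :: t).formPerm σ) : (σ x = x ∧ Geodesic t.formPerm σ) ∨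
      ∃ l₀ y l₁ σ₀ σ₁, t = l₀ ++ y :: l₁ ∧ σ = σ₀ * σ₁ * Equiv.swap x y ∧
        Geodesic l₀.formPerm σ₀ ∧ Geodesic (y :: l₁).formPerm σ₁ := by
  by_cases hx : σ x = x
  · exact Or.inl ⟨hx, (geodesic_cons_of_apply_eq h hx).1 hg⟩
  · right
    have hy : σ (σ⁻¹ x) = x := apply_inv_self σ x
    have hne : σ⁻¹ x ≠ x := fun e => hx (by rw [e] at hy; exact hy)
    have hmem : σ⁻¹ x ∈ t := by
      rcases List.mem_cons.1 (hg.supportedIn (a := σ⁻¹ x) (b := x) ⟨1, by simp⟩ hne) with e | h'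
      · exact absurd e hne
      · exact h'
    obtain ⟨l₀, l₁, rfl⟩ := List.append_of_mem hmem
    obtain ⟨σ₀, σ₁, he, g₀, g₁⟩ := hg.exists_glue h hy
    exact ⟨l₀, _, l₁, σ₀, σ₁, rfl, he, g₀, g₁⟩

/-- The relations generated by the pieces of a glued permutation. -/
theorem sameCycle_glue {x y : E} {l₀ l₁ : List E} (h : (x :: (l₀ ++ y :: l₁)).Nodup)
    {σ₀ σ₁ : Equiv.Perm E} (g₀ : Geodesic l₀.formPerm σ₀) (g₁ : Geodesic (y :: l₁).formPerm σ₁) :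
    (∀ a ∈ l₀, ∀ b, (σ₀ * σ₁ * Equiv.swap x y).SameCycle a b ↔ σ₀.SameCycle a b) ∧
    (∀ a ∈ y :: l₁, ∀ b ∈ y :: l₁,
      (σ₀ * σ₁ * Equiv.swap x y).SameCycle a b ↔ σ₁.SameCycle a b) ∧
    (σ₀ * σ₁ * Equiv.swap x y).SameCycle x y := by
  have hinv := fun v : E → ℝ => invariant_glue h g₀ g₁ (v := v)
  have hsub₀ : ∀ a b, σ₀.SameCycle a b → (σ₀ * σ₁ * Equiv.swap x y).SameCycle a b :=
    fun a b hab => sameCycle_of_forall_invariant fun v hv => ((hinv v).1 hv).1.eq_of_sameCycle hab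
  have hsub₁ : ∀ a b, σ₁.SameCycle a b → (σ₀ * σ₁ * Equiv.swap x y).SameCycle a b :=
    fun a b hab => sameCycle_of_forall_invariant fun v hv =>
      ((hinv v).1 hv).2.1.eq_of_sameCycle hab
  refine ⟨fun a ha b => ⟨fun hab => ?_, hsub₀ a b⟩, fun a ha b hb => ⟨fun hab => ?_, hsub₁ a b⟩,
    sameCycle_of_forall_invariant fun v hv => ((hinv v).1 hv).2.2⟩
  -- The indicator of this cycle of `σ₀` vanishes off `l₀`, so `σ₁` and the condition at `x` and `y`
  -- do not see it.
  · have hv : Invariant (σ₀ * σ₁ * Equiv.swap x y) (cycleIndicator σ₀ a) := by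
      have hz : ∀ c ∉ l₀, cycleIndicator σ₀ a c = 0 := fun c hc => by
        have : ¬ σ₀.SameCycle a c := fun hac => hc (g₀.supportedIn hac.symm fun e => hc (e ▸ ha))
        simp [cycleIndicator, this]
      refine (hinv _).2 ⟨invariant_cycleIndicator _ _, fun c => ?_, ?_⟩
      · by_cases hc : c ∈ y :: l₁
        · have hc' : σ₁ c ∈ y :: l₁ := by
            by_contra h'
            have := σ₁.injective (g₁.apply_eq_of_notMem h')
            exact h' (this.symm ▸ hc)
          rw [hz c fun hh => (notMem_of_mem_left h hh).2 hc,
            hz (σ₁ c) fun hh => (notMem_of_mem_left h hh).2 hc']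
        · rw [g₁.apply_eq_of_notMem hc]
      · rw [hz x (head_notMem h).1, hz y fun hh => (notMem_of_mem_left h hh).2 List.mem_cons_self]
    have := hv.eq_of_sameCycle hab
    by_contra hn
    simp [cycleIndicator, hn, Equiv.Perm.SameCycle.refl] at this
  · classical
    -- The indicator of the cycle of `a` under `σ₁` need not agree at `x` and `y`. Its value at `x`,
    -- a point fixed by `σ₀` and `σ₁`, is therefore overwritten by its value at `y`.
    set w : E → ℝ := fun c => cycleIndicator σ₁ a (if c = x then y else c)
    have hw : ∀ c, c ≠ x → w c = cycleIndicator σ₁ a c := fun c hc => by simp [w, hc]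
    have hσ₁x : σ₁ x = x := g₁.apply_eq_of_notMem (head_notMem h).2
    have hv : Invariant (σ₀ * σ₁ * Equiv.swap x y) w := by
      refine (hinv _).2 ⟨fun c => ?_, fun c => ?_, ?_⟩
      · by_cases hc : c ∈ l₀
        · have hc' : σ₀ c ∈ l₀ := by
            by_contra h'
            have := σ₀.injective (g₀.apply_eq_of_notMem h')
            exact h' (this.symm ▸ hc)
          have hz : ∀ d ∈ l₀, w d = 0 := fun d hd => by
            rw [hw d (notMem_of_mem_left h hd).1]
            have : ¬ σ₁.SameCycle a d := fun had => (notMem_of_mem_left h hd).2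
              (g₁.supportedIn had.symm fun e => (notMem_of_mem_left h hd).2 (e ▸ ha))
            simp [cycleIndicator, this]
          rw [hz _ hc, hz _ hc']
        · rw [g₀.apply_eq_of_notMem hc]
      · by_cases hc : c = x
        · rw [hc, hσ₁x]
        · have hc' : σ₁ c ≠ x := fun e => hc (σ₁.injective (e.trans hσ₁x.symm))
          rw [hw _ hc, hw _ hc', invariant_cycleIndicator]
      · have hyx : y ≠ x := fun e => (head_notMem h).2 (by simp [e])
        simp [w, hyx]
    have := hv.eq_of_sameCycle hab
    have hax : a ≠ x := fun e => (head_notMem h).2 (e ▸ ha)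
    have hbx : b ≠ x := fun e => (head_notMem h).2 (e ▸ hb)
    rw [hw _ hax, hw _ hbx] at this
    by_contra hn
    simp [cycleIndicator, hn, Equiv.Perm.SameCycle.refl] at this

/-- The cycle relation of a geodesic is non-crossing. -/
theorem Geodesic.nonCrossing (n : ℕ) : ∀ (l : List E), l.length ≤ n → l.Pairwise (· < ·) →
    ∀ σ : Equiv.Perm E, Geodesic l.formPerm σ →
      NonCrossing (Equiv.Perm.SameCycle.setoid σ) := by
  induction n with
  | zero =>
    intro l hl _ σ hg a b c d hab hbc hcd hac hbd
    obtain rfl := List.eq_nil_of_length_eq_zero (Nat.le_zero.1 hl)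
    exact absurd (hg.supportedIn hac (hab.trans hbc).ne) (by simp)
  | succ n ih =>
    intro l hl hsort σ hg
    cases l with
    | nil => exact ih [] (Nat.zero_le _) hsort σ hg
    | cons x t =>
      rw [List.length_cons] at hl
      have hnd := nodup_of_sorted hsort
      rcases hg.cases hnd with ⟨_, hg⟩ | ⟨l₀, y, l₁, σ₀, σ₁, rfl, rfl, g₀, g₁⟩
      · exact ih t (by omega) (List.pairwise_cons.1 hsort).2 σ hg
      · have hlen : l₀.length ≤ n ∧ (y :: l₁).length ≤ n := by
          simp only [List.length_append, List.length_cons] at hl ⊢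
          omega
        obtain ⟨s₀, s₁, s₂⟩ := sameCycle_glue hnd g₀ g₁
        have n₀ := ih l₀ hlen.1 (sorted_parts hsort).1 σ₀ g₀
        have n₁ := ih (y :: l₁) hlen.2 (sorted_parts hsort).2 σ₁ g₁
        set σ := σ₀ * σ₁ * Equiv.swap x y
        have mem : ∀ {a b}, σ.SameCycle a b → a ≠ b → a = x ∨ a ∈ l₀ ∨ a ∈ y :: l₁ := by
          intro a b hab hne
          rcases List.mem_cons.1 (hg.supportedIn hab hne) with h | h
          · exact Or.inl h
          · exact Or.inr (List.mem_append.1 h)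
        have stay : ∀ {a b}, σ.SameCycle a b → a ∈ l₀ → b ∈ l₀ := by
          intro a b hab ha
          by_cases hne : a = b
          · exact hne ▸ ha
          · exact g₀.supportedIn ((s₀ a ha b).1 hab).symm (Ne.symm hne)
        have xle : ∀ {a b}, σ.SameCycle a b → a ≠ b → x ≤ a := by
          intro a b hab hne
          rcases mem hab hne with rfl | h | h
          · exact le_rfl
          · exact (sorted_left hsort h).1.le
          · exact (sorted_right hsort h).1.le
        intro a b c d hab hbc hcd hac hbd
        change σ.SameCycle a c at hac
        change σ.SameCycle b d at hbd
        change σ.SameCycle a b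
        have hac' := (hab.trans hbc).ne
        have hbd' := (hbc.trans hcd).ne
        have right_of : ∀ {e f}, σ.SameCycle e f → e ≠ f → y ≤ e → e ∈ y :: l₁ := by
          intro e f hef hne hle
          rcases mem hef hne with rfl | h | h
          · exact absurd (sorted_right hsort (a := y) List.mem_cons_self).1 (not_lt.2 hle)
          · exact absurd (sorted_left hsort h).2 (not_lt.2 hle)
          · exact h
        rcases mem hac hac' with rfl | ha | ha
        -- With `a = x`, the points `b`, `c`, `d` all lie in the right piece. Since `y` is in the
        -- cycle of `x`, it can play the part of `a`, and the claim is inherited from `σ₁`.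
        · have hyc : y ≤ c := by
            rcases mem hac.symm hac'.symm with rfl | h | h
            · exact absurd rfl hac'
            · exact absurd rfl ((sorted_left hsort (stay hac.symm h)).1.ne)
            · exact (sorted_right hsort h).2
          have hd : d ∈ y :: l₁ := right_of hbd.symm hbd'.symm (hyc.trans hcd.le)
          have hb : b ∈ y :: l₁ := by
            rcases mem hbd hbd' with rfl | h | h
            · exact absurd hab (lt_irrefl _)
            · exact absurd (sorted_left hsort (stay hbd h)).2
                (not_lt.2 (sorted_right hsort hd).2)
            · exact h
          have hc : c ∈ y :: l₁ := right_of hac.symm hac'.symm hyc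
          rcases (sorted_right hsort hb).2.eq_or_lt with rfl | hlt
          · exact s₂
          · refine s₂.trans ((s₁ y List.mem_cons_self b hb).2 ?_)
            exact n₁ y b c d hlt hbc hcd
              ((s₁ y List.mem_cons_self c hc).1 (s₂.symm.trans hac)) ((s₁ b hb d hd).1 hbd)
        · have hc := stay hac ha
          have hb : b ∈ l₀ := by
            rcases mem hbd hbd' with rfl | h | h
            · exact absurd (hab.trans (sorted_left hsort ha).1) (lt_irrefl _)
            · exact h
            · exact absurd ((sorted_left hsort hc).2.trans_le (sorted_right hsort h).2)
                (not_lt.2 hbc.le)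
          exact (s₀ a ha b).2 (n₀ a b c d hab hbc hcd ((s₀ a ha c).1 hac) ((s₀ b hb d).1 hbd))
        · have hya := (sorted_right hsort ha).2
          have hb := right_of hbd hbd' (hya.trans hab.le)
          have hc := right_of hac.symm hac'.symm (hya.trans (hab.trans hbc).le)
          have hd := right_of hbd.symm hbd'.symm (hya.trans (hab.trans (hbc.trans hcd)).le)
          exact (s₁ a ha b hb).2
            (n₁ a b c d hab hbc hcd ((s₁ a ha c hc).1 hac) ((s₁ b hb d hd).1 hbd))

/-- A geodesic to an increasing cycle is determined by its cycle relation. -/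
theorem Geodesic.eq_of_sameCycle_iff (n : ℕ) : ∀ (l : List E), l.length ≤ n →
    l.Pairwise (· < ·) → ∀ σ τ : Equiv.Perm E, Geodesic l.formPerm σ → Geodesic l.formPerm τ →
      (∀ a b, σ.SameCycle a b ↔ τ.SameCycle a b) → σ = τ := by
  induction n with
  | zero =>
    intro l hl _ σ τ hσ hτ _
    obtain rfl := List.eq_nil_of_length_eq_zero (Nat.le_zero.1 hl)
    ext a
    rw [hσ.apply_eq_of_notMem (by simp), hτ.apply_eq_of_notMem (by simp)]
  | succ n ih =>
    intro l hl hsort σ τ hσ hτ hs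
    cases l with
    | nil => exact ih [] (Nat.zero_le _) hsort σ τ hσ hτ hs
    | cons x t =>
      rw [List.length_cons] at hl
      have hnd := nodup_of_sorted hsort
      rcases hσ.cases hnd with ⟨hx, gσ⟩ | ⟨l₀, y, l₁, σ₀, σ₁, rfl, rfl, g₀, g₁⟩
      · have hx' : τ x = x := by
          by_contra hne
          exact not_sameCycle_of_apply_eq (Ne.symm hne) hx ((hs _ _).2 ⟨1, by simp⟩)
        exact ih t (by omega) (List.pairwise_cons.1 hsort).2 σ τ gσ
          ((geodesic_cons_of_apply_eq hnd hx').1 hτ) hs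
      · obtain ⟨s₀, s₁, s₂⟩ := sameCycle_glue hnd g₀ g₁
        rcases hτ.cases hnd with ⟨hx', -⟩ | ⟨m₀, z, m₁, τ₀, τ₁, he, rfl, k₀, k₁⟩
        · refine absurd ((hs _ _).1 s₂) (not_sameCycle_of_apply_eq (fun e => ?_) hx')
          exact (head_notMem hnd).2 (by simp [e])
        · have hnd' := hnd
          rw [he] at hnd'
          obtain ⟨u₀, u₁, u₂⟩ := sameCycle_glue hnd' k₀ k₁
          -- The relation determines the cut: `y` and `z` are both the first point of the tail in
          -- the cycle of `x`.
          obtain ⟨rfl, rfl, rfl⟩ := first_split_unique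
            (fun a => (σ₀ * σ₁ * Equiv.swap x y).SameCycle x a) he s₂ ((hs _ _).2 u₂)
            (fun a ha hxa => (head_notMem hnd).1 (g₀.supportedIn
              (((s₀ a ha x).1 hxa.symm).symm) (notMem_of_mem_left hnd ha).1.symm))
            (fun a ha hxa => (head_notMem hnd').1 (k₀.supportedIn
              (((u₀ a ha x).1 ((hs _ _).1 hxa.symm)).symm) (notMem_of_mem_left hnd' ha).1.symm))
          have hlen : l₀.length ≤ n ∧ (y :: l₁).length ≤ n := by
            simp only [List.length_append, List.length_cons] at hl ⊢
            omega
          have e₀ : σ₀ = τ₀ := by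
            refine ih l₀ hlen.1 (sorted_parts hsort).1 σ₀ τ₀ g₀ k₀ fun a b => ?_
            by_cases ha : a ∈ l₀
            · rw [← s₀ a ha, ← u₀ a ha, hs]
            · by_cases hab : a = b
              · rw [hab]
                exact iff_of_true (Equiv.Perm.SameCycle.refl _ _) (Equiv.Perm.SameCycle.refl _ _)
              · exact iff_of_false (fun h' => ha (g₀.supportedIn h' hab))
                  fun h' => ha (k₀.supportedIn h' hab)
          have e₁ : σ₁ = τ₁ := by
            refine ih (y :: l₁) hlen.2 (sorted_parts hsort).2 σ₁ τ₁ g₁ k₁ fun a b => ?_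
            by_cases hab : a = b
            · rw [hab]
              exact iff_of_true (Equiv.Perm.SameCycle.refl _ _) (Equiv.Perm.SameCycle.refl _ _)
            by_cases ha : a ∈ y :: l₁
            · by_cases hb : b ∈ y :: l₁
              · rw [← s₁ a ha b hb, ← u₁ a ha b hb, hs]
              · exact iff_of_false (fun h' => hb (g₁.supportedIn h'.symm (Ne.symm hab)))
                  fun h' => hb (k₁.supportedIn h'.symm (Ne.symm hab))
            · exact iff_of_false (fun h' => ha (g₁.supportedIn h' hab))
                fun h' => ha (k₁.supportedIn h' hab)
          rw [e₀, e₁]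

end NonCrossing

end CycleCount

namespace CycleCount

/-! ### Recursion for the weighted sum over geodesics -/

/-- The joint moments of free Marchenko–Pastur elements, defined by the Schwinger–Dyson
recursion. -/
noncomputable def wordMoment {ι : Type*} [DecidableEq ι] (c : ℝ) : List ι → ℝ
  | [] => 1
  | x :: t => c * wordMoment c t + ∑ i : Fin t.length,
      if t[i] = x then wordMoment c (t.take i) * wordMoment c (t.drop i) else 0
termination_by l => l.length
decreasing_by all_goals (simp only [List.length_cons, List.length_take, List.length_drop]; omega)

theorem wordMoment_nil {ι : Type*} [DecidableEq ι] (c : ℝ) : wordMoment c ([] : List ι) = 1 := by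
  rw [wordMoment]

theorem wordMoment_cons {ι : Type*} [DecidableEq ι] (c : ℝ) (x : ι) (t : List ι) :
    wordMoment c (x :: t) = c * wordMoment c t + ∑ i : Fin t.length,
      if t[i] = x then wordMoment c (t.take i) * wordMoment c (t.drop i) else 0 := by
  rw [wordMoment]

variable {E : Type*} [Fintype E] [DecidableEq E] {ι : Type*}

open Classical in
/-- The geodesics to the cycle of a list whose cycles are monochromatic for the colouring `f`. -/
noncomputable def geodesics (f : E → ι) (l : List E) : Finset (Equiv.Perm E) :=
  univ.filter fun σ => Geodesic l.formPerm σ ∧ Invariant σ f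

theorem mem_geodesics {f : E → ι} {l : List E} {σ : Equiv.Perm E} :
    σ ∈ geodesics f l ↔ Geodesic l.formPerm σ ∧ Invariant σ f := by
  simp [geodesics]

theorem geodesics_nil (f : E → ι) : geodesics f [] = {1} := by
  ext σ
  rw [mem_geodesics, Finset.mem_singleton]
  constructor
  · rintro ⟨h, -⟩
    ext a
    rw [h.apply_eq_of_notMem (by simp), Equiv.Perm.one_apply]
  · rintro rfl
    exact ⟨by simp [Geodesic, numCycles_one], fun a => rfl⟩

/-- Gluing is a bijection from pairs of geodesics onto those with `σ y = x`. All permutations act on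
the whole of `E`, so the two pieces together count `card E` cycles too many, and the transposition
merges two more into one; this is the exponent `card E + 1`. -/
theorem sum_geodesics_glue (c : ℝ) (f : E → ι) {x y : E} {l₀ l₁ : List E}
    (h : (x :: (l₀ ++ y :: l₁)).Nodup) (hf : f x = f y) :
    (∑ σ ∈ (geodesics f (x :: (l₀ ++ y :: l₁))).filter (fun σ => σ y = x), c ^ numCycles σ) *
        c ^ (Fintype.card E + 1) =
      (∑ σ ∈ geodesics f l₀, c ^ numCycles σ) * ∑ σ ∈ geodesics f (y :: l₁), c ^ numCycles σ := by
  rw [Finset.sum_mul_sum, ← Finset.sum_product', Finset.sum_mul]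
  symm
  refine Finset.sum_nbij (fun s => s.1 * s.2 * Equiv.swap x y) ?_ ?_ ?_ ?_
  · rintro ⟨σ₀, σ₁⟩ hs
    obtain ⟨h₀, h₁⟩ := Finset.mem_product.1 hs
    rw [mem_geodesics] at h₀ h₁
    refine Finset.mem_filter.2 ⟨mem_geodesics.2 ⟨geodesic_glue h h₀.1 h₁.1,
      (invariant_glue h h₀.1 h₁.1).2 ⟨h₀.2, h₁.2, hf⟩⟩, ?_⟩
    have hx₀ := h₀.1.apply_eq_of_notMem (head_notMem h).1
    have hx₁ := h₁.1.apply_eq_of_notMem (head_notMem h).2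
    simp [hx₀, hx₁]
  · rintro ⟨σ₀, σ₁⟩ hs ⟨τ₀, τ₁⟩ ht he
    obtain ⟨h₀, h₁⟩ := Finset.mem_product.1 (Finset.mem_coe.1 hs)
    obtain ⟨k₀, k₁⟩ := Finset.mem_product.1 (Finset.mem_coe.1 ht)
    obtain ⟨rfl, rfl⟩ := glue_inj h (mem_geodesics.1 h₀).1 (mem_geodesics.1 h₁).1
      (mem_geodesics.1 k₀).1 (mem_geodesics.1 k₁).1 he
    rfl
  · intro σ hσ
    obtain ⟨hσ, hy⟩ := Finset.mem_filter.1 (Finset.mem_coe.1 hσ)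
    rw [mem_geodesics] at hσ
    obtain ⟨σ₀, σ₁, rfl, g₀, g₁⟩ := hσ.1.exists_glue h hy
    obtain ⟨i₀, i₁, -⟩ := (invariant_glue h g₀ g₁).1 hσ.2
    exact ⟨(σ₀, σ₁), Finset.mem_coe.2 (Finset.mem_product.2
      ⟨mem_geodesics.2 ⟨g₀, i₀⟩, mem_geodesics.2 ⟨g₁, i₁⟩⟩), rfl⟩
  · rintro ⟨σ₀, σ₁⟩ hs
    obtain ⟨h₀, h₁⟩ := Finset.mem_product.1 hs
    have := numCycles_glue h (mem_geodesics.1 h₀).1 (mem_geodesics.1 h₁).1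
    rw [← pow_add, ← pow_add, this]
    congr 1
    omega

/-- The geodesics are sorted by the preimage of `x`, which is `x` itself or exactly one entry of
`t`. -/
theorem sum_geodesics_cons (c : ℝ) (f : E → ι) {x : E} {t : List E} (h : (x :: t).Nodup) :
    ∑ σ ∈ geodesics f (x :: t), c ^ numCycles σ =
      ∑ σ ∈ geodesics f t, c ^ numCycles σ + ∑ i : Fin t.length,
        ∑ σ ∈ (geodesics f (x :: t)).filter (fun σ => σ t[i] = x), c ^ numCycles σ := by
  have h1 : geodesics f t = (geodesics f (x :: t)).filter (fun σ => σ x = x) := by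
    ext σ
    rw [Finset.mem_filter, mem_geodesics, mem_geodesics]
    constructor
    · rintro ⟨hg, hi⟩
      have hx := hg.apply_eq_of_notMem (List.nodup_cons.1 h).1
      exact ⟨⟨(geodesic_cons_of_apply_eq h hx).2 hg, hi⟩, hx⟩
    · rintro ⟨⟨hg, hi⟩, hx⟩
      exact ⟨(geodesic_cons_of_apply_eq h hx).1 hg, hi⟩
  rw [h1]
  simp only [Finset.sum_filter]
  rw [Finset.sum_comm, ← Finset.sum_add_distrib]
  refine Finset.sum_congr rfl fun σ hσ => ?_
  have hg := (mem_geodesics.1 hσ).1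
  have hnd := (List.nodup_cons.1 h)
  by_cases hx : σ x = x
  · rw [if_pos hx, Finset.sum_eq_zero, add_zero]
    intro i _
    refine if_neg fun hi => hnd.1 ?_
    rw [← σ.injective (hi.trans hx.symm)]
    exact List.getElem_mem _
  · rw [if_neg hx, zero_add]
    have hy : σ (σ⁻¹ x) = x := apply_inv_self σ x
    have hmem : σ⁻¹ x ∈ t := by
      by_contra hn
      by_cases hxx : σ⁻¹ x = x
      · rw [hxx] at hy; exact hx hy
      · have : σ⁻¹ x ∉ x :: t := fun hh => by
          rcases List.mem_cons.1 hh with e | e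
          · exact hxx e
          · exact hn e
        exact hxx ((hg.apply_eq_of_notMem this).symm.trans hy)
    obtain ⟨k, hk, hke⟩ := List.getElem_of_mem hmem
    rw [Finset.sum_eq_single ⟨k, hk⟩]
    · exact (if_pos (by simp only [Fin.getElem_fin]; rw [hke, hy])).symm
    · intro j _ hj
      refine if_neg fun hj' => hj (Fin.ext ?_)
      refine (List.Nodup.getElem_inj_iff hnd.2 (hi := j.2) (hj := hk)).1 ?_
      rw [hke]
      exact σ.injective (hj'.trans hy.symm)
    · simp

/-- The points outside `l` are fixed and contribute `card E - l.length` spurious cycles. The powers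
of `c` on the two sides remove them without subtraction in the exponent, and what remains obeys the
recursion of `wordMoment`. -/
theorem sum_geodesics (c : ℝ) (hc : c ≠ 0) [DecidableEq ι] (f : E → ι) (n : ℕ) :
    ∀ l : List E, l.length ≤ n → l.Nodup →
      (∑ σ ∈ geodesics f l, c ^ numCycles σ) * c ^ l.length =
        c ^ Fintype.card E * wordMoment c (l.map f) := by
  have hnil : (∑ σ ∈ geodesics f [], c ^ numCycles σ) * c ^ ([] : List E).length =
      c ^ Fintype.card E * wordMoment c (([] : List E).map f) := by
    rw [geodesics_nil, Finset.sum_singleton, numCycles_one, List.map_nil, wordMoment_nil,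
      List.length_nil, pow_zero]
  induction n with
  | zero =>
    intro l hl _
    obtain rfl := List.eq_nil_of_length_eq_zero (Nat.le_zero.1 hl)
    exact hnil
  | succ n ih =>
    intro l hl hnd
    cases l with
    | nil => exact hnil
    | cons x t =>
      rw [List.length_cons] at hl
      rw [sum_geodesics_cons c f hnd, List.map_cons, wordMoment_cons, add_mul, mul_add,
        List.length_cons]
      congr 1
      · rw [pow_succ, ← mul_assoc, ih t (by omega) (List.nodup_cons.1 hnd).2]
        ring
      · rw [Finset.sum_mul, Finset.mul_sum]
        refine Fintype.sum_equiv (finCongr (by simp)) _ _ fun i => ?_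
        have hsplit : t = t.take i ++ t[i] :: t.drop (i + 1) := by
          rw [Fin.getElem_fin, List.getElem_cons_drop, List.take_append_drop]
        have hdrop : t.drop i = t[i] :: t.drop (i + 1) := by
          rw [Fin.getElem_fin, List.getElem_cons_drop]
        have hnd' : (x :: (t.take i ++ t[i] :: t.drop (i + 1))).Nodup := hsplit ▸ hnd
        have hgi : (t.map f)[(finCongr (by simp : t.length = (t.map f).length) i)] = f t[i] := by
          simp
        rw [hgi]
        by_cases hf : f t[i] = f x
        · rw [if_pos hf]
          have key := sum_geodesics_glue c f hnd' hf.symm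
          rw [← hsplit, ← hdrop] at key
          have e0 := ih (t.take i) (by rw [List.length_take]; omega)
            ((List.nodup_cons.1 hnd).2.sublist (List.take_sublist _ _))
          have e1 := ih (t.drop i) (by rw [List.length_drop]; omega)
            ((List.nodup_cons.1 hnd).2.sublist (List.drop_sublist _ _))
          have hlen : c ^ t.length = c ^ (t.take i).length * c ^ (t.drop i).length := by
            rw [← pow_add, ← List.length_append, List.take_append_drop]
          have hcn : c ^ Fintype.card E ≠ 0 := pow_ne_zero _ hc
          rw [List.map_take, List.map_drop] at *
          simp only [finCongr_apply, Fin.val_cast]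
          refine mul_left_cancel₀ hcn ?_
          calc _ = (∑ σ ∈ (geodesics f (x :: t)).filter (fun σ => σ t[i] = x), c ^ numCycles σ) *
                c ^ (Fintype.card E + 1) * c ^ t.length := by ring
            _ = ((∑ σ ∈ geodesics f (t.take i), c ^ numCycles σ) * c ^ (t.take i).length) *
                ((∑ σ ∈ geodesics f (t.drop i), c ^ numCycles σ) * c ^ (t.drop i).length) := by
              rw [key, hlen]; ring
            _ = _ := by rw [e0, e1]; ring
        · rw [if_neg hf, mul_zero, Finset.sum_eq_zero, zero_mul]
          intro σ hσ
          obtain ⟨hσ, hy⟩ := Finset.mem_filter.1 hσ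
          exact absurd ((mem_geodesics.1 hσ).2 t[i]).symm (by rw [hy]; exact hf)

end CycleCount

namespace MarchenkoPastur

/-! ### The moments of the Marchenko–Pastur distribution -/

/-! ### From the quadratic to the linear moment recursion -/

section Combinatorial

open PowerSeries

/-- The quadratic recursion for the moments implies a linear one. -/
theorem linear_recursion (c : ℝ) (m : ℕ → ℝ) (h0 : m 0 = 1)
    (h : ∀ k, m (k + 1) = c * m k + ∑ i ∈ range k, m i * m (k - i)) (k : ℕ) :
    (k + 3) * m (k + 2) = (2 * k + 3) * (1 + c) * m (k + 1) - k * (1 - c) ^ 2 * m k := by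
  set M : PowerSeries ℝ := PowerSeries.mk m with hM
  -- The sum in the recursion omits the term `i = k`, which equals `m k`. Completing it to a full
  -- convolution changes `c` to `c - 1`.
  set b : PowerSeries ℝ := PowerSeries.C (c - 1) with hb
  have hquad : M = 1 + b * (PowerSeries.X * M) + PowerSeries.X * (M * M) := by
    ext n
    cases n with
    | zero => simp [hM, hb, h0]
    | succ n =>
      simp only [map_add, hb, PowerSeries.coeff_C_mul, PowerSeries.coeff_succ_X_mul]
      rw [PowerSeries.coeff_mul]
      simp only [hM, PowerSeries.coeff_mk, PowerSeries.coeff_one]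
      rw [Finset.Nat.sum_antidiagonal_eq_sum_range_succ (fun i j => m i * m j), h,
        Finset.sum_range_succ, Nat.sub_self, h0, if_neg (Nat.succ_ne_zero n)]
      ring
  -- Completing the square in the quadratic equation for `M`: the square of `Q` is the discriminant
  -- `D`, a polynomial. Differentiating `Q ^ 2 = D` and multiplying by `Q` gives a linear
  -- differential equation, whose coefficients are the recursion.
  set Q : PowerSeries ℝ := 2 * (PowerSeries.X * M) + b * PowerSeries.X - 1 with hQ
  set D : PowerSeries ℝ := (b * PowerSeries.X - 1) ^ 2 - 4 * PowerSeries.X with hD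
  have hQD : Q ^ 2 = D := by
    rw [hQ, hD]
    linear_combination (-4 * PowerSeries.X) * hquad
  have hder : 2 * D * PowerSeries.derivative ℝ Q = PowerSeries.derivative ℝ D * Q := by
    rw [← hQD]
    simp only [Derivation.leibniz_pow, smul_eq_mul, nsmul_eq_mul]
    push_cast
    ring
  have hD' : PowerSeries.derivative ℝ D = 2 * (b * (b * PowerSeries.X - 1) - 2) := by
    have h2 : PowerSeries.derivative ℝ b = 0 := PowerSeries.derivative_C
    have h4 : PowerSeries.derivative ℝ (4 : PowerSeries ℝ) = 0 := by
      have : (4 : PowerSeries ℝ) = PowerSeries.C 4 := (map_ofNat PowerSeries.C 4).symm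
      rw [this]; exact PowerSeries.derivative_C
    rw [hD]
    simp only [map_sub, Derivation.leibniz_pow, Derivation.leibniz, smul_eq_mul, nsmul_eq_mul, h2,
      h4, PowerSeries.derivative_X, PowerSeries.derivative_one]
    push_cast
    ring
  have hlin : D * PowerSeries.derivative ℝ Q = (b * (b * PowerSeries.X - 1) - 2) * Q := by
    have h2 : (PowerSeries.C (1 / 2 : ℝ)) * 2 = 1 := by
      have : (2 : PowerSeries ℝ) = PowerSeries.C 2 := (map_ofNat PowerSeries.C 2).symm
      rw [this, ← map_mul]
      norm_num
    rw [hD'] at hder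
    linear_combination (PowerSeries.C (1 / 2 : ℝ)) * hder -
      (D * PowerSeries.derivative ℝ Q - (b * (b * PowerSeries.X - 1) - 2) * Q) * h2
  have hlin' : PowerSeries.derivative ℝ Q -
      PowerSeries.C (2 * (c + 1)) * (PowerSeries.X * PowerSeries.derivative ℝ Q) +
      PowerSeries.C ((c - 1) ^ 2) * (PowerSeries.X * (PowerSeries.X * PowerSeries.derivative ℝ Q)) =
      PowerSeries.C ((c - 1) ^ 2) * (PowerSeries.X * Q) - PowerSeries.C (c + 1) * Q := by
    have e1 : PowerSeries.C (c + 1) = b + 2 := by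
      have : (2 : PowerSeries ℝ) = PowerSeries.C 2 := (map_ofNat PowerSeries.C 2).symm
      rw [hb, this, ← map_add]
      congr 1
      ring
    have e2 : PowerSeries.C (2 * (c + 1)) = 2 * (b + 2) := by
      rw [map_mul, e1, map_ofNat]
    rw [map_pow, ← hb, e1, e2]
    rw [hD] at hlin
    linear_combination hlin
  have hq : ∀ n, PowerSeries.coeff (n + 2) Q = 2 * m (n + 1) := by
    intro n
    have : (2 : PowerSeries ℝ) = PowerSeries.C 2 := (map_ofNat PowerSeries.C 2).symm
    rw [hQ, this, map_sub, map_add, PowerSeries.coeff_C_mul, PowerSeries.coeff_succ_X_mul, hb,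
      PowerSeries.coeff_C_mul, PowerSeries.coeff_X, PowerSeries.coeff_one, hM,
      PowerSeries.coeff_mk]
    simp
  have hc := congrArg (PowerSeries.coeff (k + 2)) hlin'
  simp only [map_sub, map_add, PowerSeries.coeff_C_mul, PowerSeries.coeff_succ_X_mul,
    PowerSeries.coeff_derivative, add_mul, map_one, one_mul, hq] at hc
  push_cast at hc
  -- For `k = 0` the coefficient of `Q` at degree one appears; it is not covered by `hq`, but it
  -- cancels between the two sides.
  cases k with
  | zero =>
    simp only [Nat.cast_zero, Nat.zero_add] at hc ⊢
    linarith
  | succ k =>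
    rw [show PowerSeries.coeff (k + 1 + 1) Q = 2 * m (k + 1) from hq k] at hc
    push_cast at hc ⊢
    linarith

end Combinatorial

/-! ### Integration by parts for the Marchenko–Pastur density -/

section Integral

theorem hasDerivAt_sqrt_quadratic {a b x : ℝ} (hx : x ∈ Set.Ioo a b) :
    HasDerivAt (fun x => √((b - x) * (x - a))) ((a + b - 2 * x) / (2 * √((b - x) * (x - a)))) x := by
  have hq : 0 < (b - x) * (x - a) := mul_pos (sub_pos.2 hx.2) (sub_pos.2 hx.1)
  exact ((((hasDerivAt_id' x).const_sub b).fun_mul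
    ((hasDerivAt_id' x).sub_const a)).sqrt hq.ne').congr_deriv (by ring)

/-- The integral of `√((b - x) (x - a)) x ^ k`. -/
noncomputable def quadraticMoment (a b : ℝ) (k : ℕ) : ℝ :=
  ∫ x in a..b, √((b - x) * (x - a)) * x ^ k

theorem intervalIntegrable_quadraticMoment (a b : ℝ) (k : ℕ) :
    IntervalIntegrable (fun x => √((b - x) * (x - a)) * x ^ k) volume a b := by
  apply Continuous.intervalIntegrable
  fun_prop

/-- With `q = (b - x) (x - a)`, the function `x ^ (j + 1) * q ^ (3 / 2)` vanishes at both ends;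
integrating its derivative gives the identity. -/
theorem quadraticMoment_recursion {a b : ℝ} (hab : a ≤ b) (j : ℕ) :
    (j + 4) * quadraticMoment a b (j + 2) =
      (2 * j + 5) * ((a + b) / 2) * quadraticMoment a b (j + 1) -
        (j + 1) * (a * b) * quadraticMoment a b j := by
  have key : ∫ x in a..b, (√((b - x) * (x - a)) *
      ((j + 1) * x ^ j * ((b - x) * (x - a)) + 3 / 2 * x ^ (j + 1) * (a + b - 2 * x))) =
      b ^ (j + 1) * ((b - b) * (b - a)) * √((b - b) * (b - a)) -
        a ^ (j + 1) * ((b - a) * (a - a)) * √((b - a) * (a - a)) := by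
    refine intervalIntegral.integral_eq_sub_of_hasDerivAt_of_le hab
      (f := fun x => x ^ (j + 1) * ((b - x) * (x - a)) * √((b - x) * (x - a))) ?_ ?_ ?_
    · apply Continuous.continuousOn
      fun_prop
    · intro x hx
      have hq : 0 < (b - x) * (x - a) := mul_pos (sub_pos.2 hx.2) (sub_pos.2 hx.1)
      refine (((hasDerivAt_pow (j + 1) x).fun_mul (((hasDerivAt_id' x).const_sub b).fun_mul
        ((hasDerivAt_id' x).sub_const a))).fun_mul
          (hasDerivAt_sqrt_quadratic hx)).congr_deriv ?_
      have hs : √((b - x) * (x - a)) ≠ 0 := (Real.sqrt_pos.2 hq).ne'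
      have hs2 := Real.sq_sqrt hq.le
      have e : x ^ (j + 1) * ((b - x) * (x - a)) *
          ((a + b - 2 * x) / (2 * √((b - x) * (x - a)))) =
          x ^ (j + 1) * √((b - x) * (x - a)) * ((a + b - 2 * x) / 2) := by
        nth_rewrite 1 [← hs2]
        field_simp
      rw [e]
      push_cast
      ring
    · apply Continuous.intervalIntegrable
      fun_prop
  have hexp : ∀ x : ℝ, √((b - x) * (x - a)) *
      ((j + 1) * x ^ j * ((b - x) * (x - a)) + 3 / 2 * x ^ (j + 1) * (a + b - 2 * x)) =
      -(j + 4) * (√((b - x) * (x - a)) * x ^ (j + 2)) +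
        (2 * j + 5) * ((a + b) / 2) * (√((b - x) * (x - a)) * x ^ (j + 1)) -
        (j + 1) * (a * b) * (√((b - x) * (x - a)) * x ^ j) := fun x => by ring
  simp only [hexp] at key
  rw [intervalIntegral.integral_sub, intervalIntegral.integral_add,
    intervalIntegral.integral_const_mul, intervalIntegral.integral_const_mul,
    intervalIntegral.integral_const_mul] at key
  · unfold quadraticMoment
    simp only [sub_self, zero_mul, mul_zero] at key
    linarith
  all_goals
    apply Continuous.intervalIntegrable
    fun_prop

/-- The case `j = -1` of the same computation: the derivative of `q ^ (3 / 2)` integrates to zero.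
-/
theorem quadraticMoment_one {a b : ℝ} (hab : a ≤ b) :
    3 * quadraticMoment a b 1 = 3 * ((a + b) / 2) * quadraticMoment a b 0 := by
  have key : ∫ x in a..b, (√((b - x) * (x - a)) * (3 / 2 * (a + b - 2 * x))) =
      ((b - b) * (b - a)) * √((b - b) * (b - a)) - ((b - a) * (a - a)) * √((b - a) * (a - a)) := by
    refine intervalIntegral.integral_eq_sub_of_hasDerivAt_of_le hab
      (f := fun x => ((b - x) * (x - a)) * √((b - x) * (x - a))) ?_ ?_ ?_
    · apply Continuous.continuousOn
      fun_prop
    · intro x hx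
      have hq : 0 < (b - x) * (x - a) := mul_pos (sub_pos.2 hx.2) (sub_pos.2 hx.1)
      refine ((((hasDerivAt_id' x).const_sub b).fun_mul
        ((hasDerivAt_id' x).sub_const a)).fun_mul (hasDerivAt_sqrt_quadratic hx)).congr_deriv ?_
      have hs : √((b - x) * (x - a)) ≠ 0 := (Real.sqrt_pos.2 hq).ne'
      have hs2 := Real.sq_sqrt hq.le
      have e : ((b - x) * (x - a)) * ((a + b - 2 * x) / (2 * √((b - x) * (x - a)))) =
          √((b - x) * (x - a)) * ((a + b - 2 * x) / 2) := by
        nth_rewrite 1 [← hs2]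
        field_simp
      rw [e]
      ring
    · apply Continuous.intervalIntegrable
      fun_prop
  have hexp : ∀ x : ℝ, √((b - x) * (x - a)) * (3 / 2 * (a + b - 2 * x)) =
      3 * ((a + b) / 2) * (√((b - x) * (x - a)) * x ^ 0) -
        3 * (√((b - x) * (x - a)) * x ^ 1) := fun x => by ring
  simp only [hexp] at key
  rw [intervalIntegral.integral_sub, intervalIntegral.integral_const_mul,
    intervalIntegral.integral_const_mul] at key
  · unfold quadraticMoment
    simp only [sub_self, zero_mul, mul_zero] at key
    linarith
  all_goals
    apply Continuous.intervalIntegrable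
    fun_prop

/-- The area of a half disc of radius `(b - a) / 2`. -/
theorem quadraticMoment_zero {a b : ℝ} (hab : a < b) :
    quadraticMoment a b 0 = Real.pi * (b - a) ^ 2 / 8 := by
  have h := intervalIntegral.integral_comp_mul_add (fun x => √((b - x) * (x - a)))
    (a := -1) (b := 1) (c := (b - a) / 2) (by linarith) ((a + b) / 2)
  have h2 : ∀ x : ℝ, √((b - ((b - a) / 2 * x + (a + b) / 2)) *
      ((b - a) / 2 * x + (a + b) / 2 - a)) = (b - a) / 2 * √(1 - x ^ 2) := by
    intro x
    rw [← Real.sqrt_sq (by linarith : 0 ≤ (b - a) / 2), ← Real.sqrt_mul (sq_nonneg _),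
      Real.sqrt_sq (by linarith : 0 ≤ (b - a) / 2)]
    congr 1
    ring
  simp only [h2, intervalIntegral.integral_const_mul, integral_sqrt_one_sub_sq] at h
  have e1 : (b - a) / 2 * -1 + (a + b) / 2 = a := by ring
  have e2 : (b - a) / 2 * 1 + (a + b) / 2 = b := by ring
  rw [e1, e2, smul_eq_mul] at h
  unfold quadraticMoment
  simp only [pow_zero, mul_one]
  have hba : b - a ≠ 0 := by linarith
  field_simp at h
  linarith

/-- An antiderivative of `√((b - x) (x - a)) / x`. -/
theorem hasDerivAt_antiderivative {a b r x : ℝ} (ha : 0 ≤ a) (hr : 0 ≤ r) (hrab : r ^ 2 = a * b)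
    (hx : x ∈ Set.Ioo a b) :
    HasDerivAt (fun x => √((b - x) * (x - a)) + (a + b) / 2 * Real.arcsin ((2 * x - a - b) / (b - a)) -
      r * Real.arcsin (((a + b) * x - 2 * (a * b)) / (x * (b - a))))
      (√((b - x) * (x - a)) / x) x := by
  have hq : 0 < (b - x) * (x - a) := mul_pos (sub_pos.2 hx.2) (sub_pos.2 hx.1)
  have hx0 : 0 < x := ha.trans_lt hx.1
  have hba : 0 < b - a := by linarith [hx.1, hx.2]
  set s := √((b - x) * (x - a)) with hs
  have hs0 : 0 < s := Real.sqrt_pos.2 hq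
  have hs2 : s ^ 2 = (b - x) * (x - a) := Real.sq_sqrt hq.le
  have h1 : HasDerivAt (fun x => √((b - x) * (x - a))) ((a + b - 2 * x) / (2 * s)) x :=
    hasDerivAt_sqrt_quadratic hx
  have h2 : HasDerivAt (fun x => Real.arcsin ((2 * x - a - b) / (b - a))) (1 / s) x := by
    have e : 1 - ((2 * x - a - b) / (b - a)) ^ 2 = (2 * s / (b - a)) ^ 2 := by
      rw [div_pow, div_pow, mul_pow, hs2]
      field_simp
      ring
    have hpos : 0 < (2 * s / (b - a)) ^ 2 := by positivity
    have hu : HasDerivAt (fun x => (2 * x - a - b) / (b - a)) (2 / (b - a)) x := by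
      have := ((((hasDerivAt_id' x).const_mul 2).sub_const a).sub_const b).div_const (b - a)
      simpa using this
    have := (Real.hasDerivAt_arcsin (x := (2 * x - a - b) / (b - a))
      (by intro h; rw [h] at e; norm_num at e; linarith [e ▸ hpos])
      (by intro h; rw [h] at e; norm_num at e; linarith [e ▸ hpos])).comp x hu
    refine this.congr_deriv ?_
    rw [e, Real.sqrt_sq (by positivity)]
    field_simp
  have h3 : HasDerivAt (fun x => r * Real.arcsin (((a + b) * x - 2 * (a * b)) / (x * (b - a))))
      (r ^ 2 / (x * s)) x := by
    -- If `r = 0`, that is `a = 0`, the second arcsine has the constant argument `1` on the interval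
    -- and is not differentiated: its coefficient vanishes.
    rcases hr.eq_or_lt with h0 | hr0
    · subst h0
      simpa using hasDerivAt_const x (0 : ℝ)
    have e : 1 - (((a + b) * x - 2 * (a * b)) / (x * (b - a))) ^ 2 =
        (2 * r * s / (x * (b - a))) ^ 2 := by
      rw [div_pow, div_pow, mul_pow _ s, mul_pow 2 r, hs2, hrab]
      field_simp
      ring
    have hpos : 0 < (2 * r * s / (x * (b - a))) ^ 2 := by positivity
    have hu : HasDerivAt (fun x => ((a + b) * x - 2 * (a * b)) / (x * (b - a)))
        (2 * r ^ 2 / (x ^ 2 * (b - a))) x := by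
      have := (((hasDerivAt_id' x).const_mul (a + b)).sub_const (2 * (a * b))).div
        ((hasDerivAt_id' x).mul_const (b - a)) (mul_ne_zero hx0.ne' hba.ne')
      refine this.congr_deriv ?_
      rw [hrab]
      field_simp
      ring
    have := ((Real.hasDerivAt_arcsin (x := ((a + b) * x - 2 * (a * b)) / (x * (b - a)))
      (by intro h; rw [h] at e; norm_num at e; linarith [e ▸ hpos])
      (by intro h; rw [h] at e; norm_num at e; linarith [e ▸ hpos])).comp x hu).const_mul r
    refine this.congr_deriv ?_
    rw [e, Real.sqrt_sq (by positivity)]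
    field_simp
  refine ((h1.fun_add (h2.const_mul ((a + b) / 2))).fun_sub h3).congr_deriv ?_
  rw [hrab]
  field_simp
  rw [hs2]
  ring

end Integral

end MarchenkoPastur

namespace MarchenkoPastur

section Integral

/-- The integral of `√((b - x) (x - a)) / x`. -/
theorem integral_sqrt_div {a b r : ℝ} (ha : 0 ≤ a) (hab : a < b) (hr : 0 ≤ r)
    (hrab : r ^ 2 = a * b) :
    IntervalIntegrable (fun x => √((b - x) * (x - a)) / x) volume a b ∧
      ∫ x in a..b, √((b - x) * (x - a)) / x = Real.pi * ((a + b) / 2 - r) := by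
  have hba : 0 < b - a := sub_pos.2 hab
  have hcont : ContinuousOn (fun x => √((b - x) * (x - a)) +
      (a + b) / 2 * Real.arcsin ((2 * x - a - b) / (b - a)) -
      r * Real.arcsin (((a + b) * x - 2 * (a * b)) / (x * (b - a)))) (Set.Icc a b) := by
    refine ContinuousOn.sub ?_ ?_
    · apply Continuous.continuousOn
      have := Real.continuous_arcsin
      fun_prop
    · rcases hr.eq_or_lt with h0 | hr0
      · simp only [← h0, zero_mul]
        exact continuousOn_const
      · have ha0 : 0 < a := by
          rcases ha.eq_or_lt with h | h
          · rw [← h, zero_mul] at hrab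
            exact absurd hrab (pow_pos hr0 2).ne'
          · exact h
        refine continuousOn_const.mul (Real.continuous_arcsin.comp_continuousOn ?_)
        refine ContinuousOn.div (by fun_prop) (by fun_prop) fun x hx => ?_
        exact mul_ne_zero (ha0.trans_le hx.1).ne' hba.ne'
  have hder := fun x (hx : x ∈ Set.Ioo a b) => hasDerivAt_antiderivative ha hr hrab hx
  have hint : IntervalIntegrable (fun x => √((b - x) * (x - a)) / x) volume a b := by
    rw [intervalIntegrable_iff_integrableOn_Ioc_of_le hab.le]
    -- For `a = 0` the integrand is unbounded near `0`. Integrability holds because it is a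
    -- non-negative derivative of a function continuous up to the ends.
    exact intervalIntegral.integrableOn_deriv_of_nonneg hcont hder
      fun x hx => div_nonneg (Real.sqrt_nonneg _) (ha.trans hx.1.le)
  refine ⟨hint, ?_⟩
  rw [intervalIntegral.integral_eq_sub_of_hasDerivAt_of_le hab.le hcont hder hint]
  have e1 : (2 * b - a - b) / (b - a) = 1 := by
    rw [div_eq_one_iff_eq hba.ne']; ring
  have e2 : (2 * a - a - b) / (b - a) = -1 := by
    rw [div_eq_iff hba.ne']; ring
  rw [e1, e2, Real.arcsin_one, Real.arcsin_neg_one]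
  simp only [sub_self, zero_mul, mul_zero, Real.sqrt_zero]
  rcases hr.eq_or_lt with h0 | hr0
  · rw [← h0]
    ring
  · have ha0 : a ≠ 0 := by
      rintro rfl
      rw [zero_mul] at hrab
      exact absurd hrab (pow_pos hr0 2).ne'
    have hb0 : b ≠ 0 := (ha.trans_lt hab).ne'
    have e3 : ((a + b) * b - 2 * (a * b)) / (b * (b - a)) = 1 := by
      rw [div_eq_one_iff_eq (mul_ne_zero hb0 hba.ne')]; ring
    have e4 : ((a + b) * a - 2 * (a * b)) / (a * (b - a)) = -1 := by
      rw [div_eq_iff (mul_ne_zero ha0 hba.ne')]; ring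
    rw [e3, e4, Real.arcsin_one, Real.arcsin_neg_one]
    ring

/-- The density of the absolutely continuous part of the Marchenko–Pastur distribution. -/
noncomputable def density (a b x : ℝ) : ℝ := √((b - x) * (x - a)) / (2 * Real.pi * x)

theorem density_nonneg {a b x : ℝ} (ha : 0 ≤ a) (hx : x ∈ Set.Icc a b) : 0 ≤ density a b x :=
  div_nonneg (Real.sqrt_nonneg _) (mul_nonneg (by positivity) (ha.trans hx.1))

theorem measurable_density (a b : ℝ) : Measurable (density a b) := by
  unfold density
  fun_prop

theorem integral_density_mul_pow {a b r : ℝ} (ha : 0 ≤ a) (hab : a < b) (hr : 0 ≤ r)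
    (hrab : r ^ 2 = a * b) (k : ℕ) :
    IntegrableOn (fun x => density a b x * x ^ k) (Set.Icc a b) ∧
      ∫ x in Set.Icc a b, density a b x * x ^ k =
        match k with
        | 0 => ((a + b) / 2 - r) / 2
        | k + 1 => quadraticMoment a b k / (2 * Real.pi) := by
  have hpi := Real.pi_pos
  cases k with
  | zero =>
    obtain ⟨h1, h2⟩ := integral_sqrt_div ha hab hr hrab
    have e : (fun x => density a b x * x ^ 0) =
        fun x => (2 * Real.pi)⁻¹ * (√((b - x) * (x - a)) / x) := by
      funext x
      rw [density, pow_zero, mul_one, inv_mul_eq_div, div_div, mul_comm x]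
    rw [e]
    refine ⟨?_, ?_⟩
    · rw [integrableOn_Icc_iff_integrableOn_Ioc,
        ← intervalIntegrable_iff_integrableOn_Ioc_of_le hab.le]
      exact h1.const_mul _
    · rw [integral_Icc_eq_integral_Ioc, ← intervalIntegral.integral_of_le hab.le,
        intervalIntegral.integral_const_mul, h2]
      simp only
      field_simp
  | succ k =>
    have e : Set.EqOn (fun x => density a b x * x ^ (k + 1))
        (fun x => (2 * Real.pi)⁻¹ * (√((b - x) * (x - a)) * x ^ k)) (Set.Ioc a b) := by
      intro x hx
      have hx0 : x ≠ 0 := (ha.trans_lt hx.1).ne'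
      simp only [density]
      field_simp
      ring
    have h1 := (intervalIntegrable_quadraticMoment a b k).const_mul (2 * Real.pi)⁻¹
    rw [intervalIntegrable_iff_integrableOn_Ioc_of_le hab.le] at h1
    refine ⟨?_, ?_⟩
    · rw [integrableOn_Icc_iff_integrableOn_Ioc]
      exact h1.congr_fun e.symm measurableSet_Ioc
    · rw [integral_Icc_eq_integral_Ioc, setIntegral_congr_fun measurableSet_Ioc e,
        ← intervalIntegral.integral_of_le hab.le, intervalIntegral.integral_const_mul,
        inv_mul_eq_div]
      rfl

end Integral

theorem marchenkoPastur_eq (c : ℝ) : marchenkoPastur c =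
    ENNReal.ofReal (max (1 - c) 0) • Measure.dirac 0 +
      (volume.restrict (Set.Icc ((1 - √c) ^ 2) ((1 + √c) ^ 2))).withDensity fun x =>
        ENNReal.ofReal (density ((1 - √c) ^ 2) ((1 + √c) ^ 2) x) := rfl

/-- Here `(a + b) / 2 = 1 + c` and `√(a b) = |1 - c|`, so the absolutely continuous part has mass
`(1 + c - |1 - c|) / 2 = min 1 c`, which the atom completes to `1`. For positive powers the atom at
`0` does not count and the factor `1 / x` cancels. -/
theorem integrable_and_integral (c : ℝ) (hc : 0 < c) (k : ℕ) :
    Integrable (fun t : ℝ => t ^ k) (marchenkoPastur c) ∧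
      ∫ t, t ^ k ∂(marchenkoPastur c) =
        match k with
        | 0 => 1
        | k + 1 => quadraticMoment ((1 - √c) ^ 2) ((1 + √c) ^ 2) k / (2 * Real.pi) := by
  have hs : √c ^ 2 = c := Real.sq_sqrt hc.le
  have hs0 : 0 < √c := Real.sqrt_pos.2 hc
  rw [marchenkoPastur_eq]
  have ha : 0 ≤ (1 - √c) ^ 2 := sq_nonneg _
  have hab : (1 - √c) ^ 2 < (1 + √c) ^ 2 := by nlinarith
  have hr : |1 - c| ^ 2 = (1 - √c) ^ 2 * (1 + √c) ^ 2 := by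
    rw [sq_abs]
    nth_rewrite 1 [← hs]
    ring
  have hmid : ((1 - √c) ^ 2 + (1 + √c) ^ 2) / 2 = 1 + c := by linear_combination hs
  set a := (1 - √c) ^ 2
  set b := (1 + √c) ^ 2
  obtain ⟨h1, h2⟩ := integral_density_mul_pow ha hab (abs_nonneg _) hr k
  set ν := (volume.restrict (Set.Icc a b)).withDensity fun x => ENNReal.ofReal (density a b x)
    with hν
  have hmeas : Measurable fun x => (density a b x).toNNReal := (measurable_density a b).real_toNNReal
  have hcongr : ∀ x ∈ Set.Icc a b,
      (density a b x).toNNReal • x ^ k = density a b x * x ^ k := fun x hx => by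
    rw [NNReal.smul_def, Real.coe_toNNReal _ (density_nonneg ha hx), smul_eq_mul]
  have i1 : Integrable (fun t : ℝ => t ^ k) ν := by
    rw [hν]
    refine (integrable_withDensity_iff_integrable_smul hmeas).2 ?_
    exact IntegrableOn.congr_fun h1 (fun x hx => (hcongr x hx).symm) measurableSet_Icc
  have i2 : ∫ t, t ^ k ∂ν = ∫ x in Set.Icc a b, density a b x * x ^ k := by
    rw [hν]
    refine (integral_withDensity_eq_integral_smul hmeas _).trans ?_
    exact setIntegral_congr_fun measurableSet_Icc hcongr
  have j1 : Integrable (fun t : ℝ => t ^ k) (ENNReal.ofReal (max (1 - c) 0) • Measure.dirac 0) :=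
    (integrable_dirac (by simp)).smul_measure ENNReal.ofReal_ne_top
  have j2 : ∫ t, t ^ k ∂(ENNReal.ofReal (max (1 - c) 0) • Measure.dirac (0 : ℝ)) =
      max (1 - c) 0 * 0 ^ k := by
    rw [integral_smul_measure, integral_dirac, ENNReal.toReal_ofReal (le_max_right _ _),
      smul_eq_mul]
  refine ⟨j1.add_measure i1, ?_⟩
  rw [integral_add_measure j1 i1, j2, i2, h2]
  cases k with
  | zero =>
    simp only [pow_zero, mul_one, hmid]
    rcases le_total c 1 with h | h
    · rw [abs_of_nonneg (by linarith), max_eq_left (by linarith)]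
      ring
    · rw [abs_of_nonpos (by linarith), max_eq_right (by linarith)]
      ring
  | succ k =>
    simp only [pow_succ, mul_zero, zero_add]

/-- A sequence that satisfies the moment recursion is the moment sequence of the
Marchenko–Pastur distribution. -/
theorem integral_pow_eq (c : ℝ) (hc : 0 < c) (m : ℕ → ℝ) (h0 : m 0 = 1)
    (h : ∀ k, m (k + 1) = c * m k + ∑ i ∈ range k, m i * m (k - i)) (k : ℕ) :
    ∫ t, t ^ k ∂(marchenkoPastur c) = m k := by
  have hpi := Real.pi_pos
  have hs : √c ^ 2 = c := Real.sq_sqrt hc.le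
  have hs0 : 0 < √c := Real.sqrt_pos.2 hc
  have hab : (1 - √c) ^ 2 < (1 + √c) ^ 2 := by nlinarith
  have hmid : ((1 - √c) ^ 2 + (1 + √c) ^ 2) / 2 = 1 + c := by linear_combination hs
  have hprod : (1 - √c) ^ 2 * (1 + √c) ^ 2 = (1 - c) ^ 2 := by
    nth_rewrite 3 [← hs]
    ring
  have hdiff : ((1 + √c) ^ 2 - (1 - √c) ^ 2) ^ 2 = 16 * c := by
    nth_rewrite 3 [← hs]
    ring
  rw [(integrable_and_integral c hc k).2]
  have q0 := quadraticMoment_zero hab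
  have q1 := quadraticMoment_one hab.le
  have qr := fun j => quadraticMoment_recursion hab.le j
  rw [hmid] at q1
  simp only [hmid, hprod] at qr
  rw [hdiff] at q0
  set I := quadraticMoment ((1 - √c) ^ 2) ((1 + √c) ^ 2)
  -- With this shift of index, both sequences obey the same second-order recursion; they agree at
  -- the first two places.
  have key : ∀ n, I n = 2 * Real.pi * m (n + 1) ∧ I (n + 1) = 2 * Real.pi * m (n + 2) := by
    have hm := linear_recursion c m h0 h
    have hm1 : m 1 = c := by simpa [h0] using h 0
    intro n
    induction n with
    | zero =>
      have e0 : I 0 = 2 * Real.pi * m 1 := by rw [q0, hm1]; ring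
      refine ⟨e0, ?_⟩
      have := hm 0
      simp only [Nat.cast_zero, zero_mul, mul_zero, zero_add, sub_zero] at this
      rw [Nat.zero_add]
      rw [e0] at q1
      linear_combination (1 / 3 : ℝ) * q1 - 2 * Real.pi / 3 * this
    | succ n ih =>
      refine ⟨ih.2, ?_⟩
      have e1 := qr n
      have e2 := hm (n + 1)
      push_cast at e2
      rw [ih.1, ih.2] at e1
      have hn : (n + 4 : ℝ) ≠ 0 := by positivity
      refine mul_left_cancel₀ hn ?_
      rw [show n + 1 + 1 = n + 2 from rfl, show n + 1 + 2 = n + 3 from rfl] at *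
      linear_combination e1 - 2 * Real.pi * e2
  cases k with
  | zero => exact h0.symm
  | succ k =>
    simp only
    rw [(key k).1]
    field_simp

end MarchenkoPastur

/-! ### Gaussian moments and Wick's formula -/

namespace GaussianTensor

theorem integrable_norm_pow_mul_exp (k : ℕ) :
    Integrable (fun z : ℂ => ‖z‖ ^ k * (Real.pi⁻¹ * Real.exp (-‖z‖ ^ 2))) ∧
      ∫ z : ℂ, ‖z‖ ^ k * (Real.pi⁻¹ * Real.exp (-‖z‖ ^ 2)) = Real.Gamma (k / 2 + 1) := by
  have h := Complex.integral_rpow_mul_exp_neg_rpow (p := 2) (q := k) (by norm_num)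
    (lt_of_lt_of_le (by norm_num) (Nat.cast_nonneg k))
  have hpi := Real.pi_pos
  have e : (fun z : ℂ => ‖z‖ ^ k * (Real.pi⁻¹ * Real.exp (-‖z‖ ^ 2))) =
      fun z => Real.pi⁻¹ * (‖z‖ ^ (k : ℝ) * Real.exp (-‖z‖ ^ (2 : ℝ))) := by
    funext z
    rw [Real.rpow_natCast, Real.rpow_two]
    ring
  have hval : ∫ z : ℂ, ‖z‖ ^ k * (Real.pi⁻¹ * Real.exp (-‖z‖ ^ 2)) = Real.Gamma (k / 2 + 1) := by
    rw [e, integral_const_mul, h, add_div, div_self two_ne_zero]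
    field_simp
  refine ⟨Integrable.of_integral_ne_zero ?_, hval⟩
  rw [hval]
  exact (Real.Gamma_pos_of_pos (by positivity)).ne'

theorem measurable_density : Measurable fun z : ℂ => (Real.pi⁻¹ * Real.exp (-‖z‖ ^ 2)).toNNReal := by
  fun_prop

theorem density_smul (z w : ℂ) : (Real.pi⁻¹ * Real.exp (-‖z‖ ^ 2)).toNNReal • w =
    ((Real.pi⁻¹ * Real.exp (-‖z‖ ^ 2) : ℝ) : ℂ) * w := by
  rw [NNReal.smul_def, Real.coe_toNNReal _ (by positivity)]
  exact Complex.real_smul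

theorem integrable_moment (m n : ℕ) :
    Integrable (fun z : ℂ => z ^ m * star z ^ n) stdComplexGaussian := by
  refine (integrable_withDensity_iff_integrable_smul measurable_density).2 ?_
  refine ((integrable_norm_pow_mul_exp (m + n)).1).mono' ?_ (ae_of_all _ fun z => ?_)
  · apply Measurable.aestronglyMeasurable
    simp only [density_smul]
    have : Measurable (star : ℂ → ℂ) := continuous_star.measurable
    fun_prop
  · rw [density_smul, norm_mul, norm_mul, norm_pow, norm_pow, norm_star, pow_add,
      Complex.norm_real, Real.norm_of_nonneg (by positivity)]
    exact (mul_comm _ _).le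

theorem integral_moment (m n : ℕ) :
    ∫ z : ℂ, z ^ m * star z ^ n ∂stdComplexGaussian = if m = n then (n.factorial : ℂ) else 0 := by
  have h : ∫ z : ℂ, z ^ m * star z ^ n ∂stdComplexGaussian =
      ∫ z : ℂ, ((Real.pi⁻¹ * Real.exp (-‖z‖ ^ 2) : ℝ) : ℂ) * (z ^ m * star z ^ n) := by
    refine (integral_withDensity_eq_integral_smul measurable_density _).trans ?_
    simp only [density_smul]
  rw [h]
  split_ifs with hmn
  · subst hmn
    have e : ∀ z : ℂ, ((Real.pi⁻¹ * Real.exp (-‖z‖ ^ 2) : ℝ) : ℂ) * (z ^ m * star z ^ m) =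
        ((‖z‖ ^ (2 * m) * (Real.pi⁻¹ * Real.exp (-‖z‖ ^ 2)) : ℝ) : ℂ) := by
      intro z
      rw [← mul_pow, Complex.star_def, Complex.mul_conj, Complex.normSq_eq_norm_sq, mul_comm,
        pow_mul]
      push_cast
      ring
    simp only [e]
    rw [integral_complex_ofReal, (integrable_norm_pow_mul_exp (2 * m)).2]
    push_cast
    rw [mul_div_cancel_left₀ _ two_ne_zero, Real.Gamma_nat_eq_factorial]
    simp
  · have hne : (m : ℝ) - n ≠ 0 := sub_ne_zero.2 (by exact_mod_cast hmn)
    -- Rotation by the angle `π / (m - n)` preserves the density and multiplies `z ^ m * star z ^ n`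
    -- by `exp (π i) = -1`, so the integral equals its own negative.
    set ζ : Circle := Circle.exp (Real.pi / (m - n)) with hζ
    have hp := (rotation ζ).measurePreserving
    have hrot := hp.integral_comp (rotation ζ).toHomeomorph.measurableEmbedding
      (fun z : ℂ => ((Real.pi⁻¹ * Real.exp (-‖z‖ ^ 2) : ℝ) : ℂ) * (z ^ m * star z ^ n))
    have hz : (ζ : ℂ) ^ m * star (ζ : ℂ) ^ n = -1 := by
      have hne' : (m : ℂ) - n ≠ 0 := by exact_mod_cast hne
      rw [hζ, Circle.coe_exp, Complex.star_def, ← Complex.exp_conj, ← Complex.exp_nat_mul,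
        ← Complex.exp_nat_mul, ← Complex.exp_add, ← Complex.exp_pi_mul_I]
      congr 1
      simp only [map_mul, Complex.conj_ofReal, Complex.conj_I]
      push_cast
      field_simp
      ring
    have e : ∀ z : ℂ, ((Real.pi⁻¹ * Real.exp (-‖rotation ζ z‖ ^ 2) : ℝ) : ℂ) *
        ((rotation ζ z) ^ m * star (rotation ζ z) ^ n) =
        -(((Real.pi⁻¹ * Real.exp (-‖z‖ ^ 2) : ℝ) : ℂ) * (z ^ m * star z ^ n)) := by
      intro z
      rw [LinearIsometryEquiv.norm_map, rotation_apply, star_mul', mul_pow, mul_pow]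
      linear_combination (((Real.pi⁻¹ * Real.exp (-‖z‖ ^ 2) : ℝ) : ℂ) * (z ^ m * star z ^ n)) * hz
    simp only [e] at hrot
    rw [integral_neg] at hrot
    have := neg_eq_iff_add_eq_zero.1 hrot
    rw [← two_mul] at this
    exact (mul_eq_zero.1 this).resolve_left two_ne_zero

/-! ### Permutation counts and Wick's formula -/

section Counting

set_option linter.unusedSectionVars false

variable {K I : Type*} [Fintype K] [DecidableEq K] [Fintype I] [DecidableEq I]

/-- Such a `σ` maps the fibres of `u` onto those of `v`, so the fibre sizes must agree. If they do,
these `σ` form a coset of the stabilizer of `u`, a product of symmetric groups. The right side is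
then the product over `i` of the Gaussian moments computed in `integral_moment`. -/
theorem card_perm_comp_eq (u v : K → I) :
    Fintype.card {σ : Equiv.Perm K // ∀ k, u k = v (σ k)} =
      ∏ i, if Fintype.card {k // u k = i} = Fintype.card {k // v k = i}
        then (Fintype.card {k // v k = i}).factorial else 0 := by
  by_cases h : ∀ i, Fintype.card {k // u k = i} = Fintype.card {k // v k = i}
  · let σ₀ : Equiv.Perm K := Equiv.ofFiberEquiv fun i => Fintype.equivOfCardEq (h i)
    have hσ₀ : ∀ k, v (σ₀ k) = u k := fun k =>
      Equiv.ofFiberEquiv_map (fun i => Fintype.equivOfCardEq (h i)) k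
    have e : {σ : Equiv.Perm K // ∀ k, u k = v (σ k)} ≃ {g : Equiv.Perm K // u ∘ g = u} :=
      (Equiv.mulLeft σ₀⁻¹).subtypeEquiv fun σ => by
        have : ∀ k, u ((Equiv.mulLeft σ₀⁻¹ σ) k) = v (σ k) := fun k => by
          rw [← hσ₀]
          exact congrArg v (CycleCount.apply_inv_self σ₀ (σ k))
        constructor
        · exact fun hk => funext fun k => (this k).trans (hk k).symm
        · exact fun hk k => ((this k).symm.trans (congrFun hk k)).symm
    rw [Fintype.card_congr e, DomMulAct.stabilizer_card]
    exact Finset.prod_congr rfl fun i _ => by rw [if_pos (h i), h i]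
  · push Not at h
    obtain ⟨i, hi⟩ := h
    rw [Finset.prod_eq_zero (Finset.mem_univ i) (if_neg hi), Fintype.card_eq_zero_iff]
    exact ⟨fun σ => hi (Fintype.card_congr (σ.1.subtypeEquiv fun k => by rw [σ.2 k]))⟩

theorem prod_comp_eq (z : I → ℂ) (u : K → I) :
    ∏ k, z (u k) = ∏ i, z i ^ Fintype.card {k // u k = i} := by
  rw [← Finset.prod_fiberwise univ u]
  refine Finset.prod_congr rfl fun i _ => ?_
  rw [Fintype.card_subtype, ← Finset.prod_const]
  exact Finset.prod_congr rfl fun k hk => by rw [(Finset.mem_filter.1 hk).2]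

variable {Ω : Type*} [MeasurableSpace Ω] {P : Measure Ω} [IsProbabilityMeasure P]

/-- Wick's formula for independent standard complex Gaussian variables. -/
theorem wick {X : Ω → I → ℂ} (hlaw : ∀ i, HasLaw (fun ω => X ω i) stdComplexGaussian P)
    (hind : iIndepFun (fun i ω => X ω i) P) (u v : K → I) :
    Integrable (fun ω => ∏ k, (X ω (u k) * star (X ω (v k)))) P ∧
      ∫ ω, ∏ k, (X ω (u k) * star (X ω (v k))) ∂P =
        (Nat.card {σ : Equiv.Perm K // ∀ k, u k = v (σ k)} : ℂ) := by
  rw [Nat.card_eq_fintype_card]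
  set a : I → ℕ := fun i => Fintype.card {k // u k = i}
  set b : I → ℕ := fun i => Fintype.card {k // v k = i}
  have hrew : (fun ω => ∏ k, (X ω (u k) * star (X ω (v k)))) =
      (fun x : I → ℂ => ∏ i, (x i ^ a i * star (x i) ^ b i)) ∘ X := by
    funext ω
    simp only [Function.comp_apply]
    rw [Finset.prod_mul_distrib, Finset.prod_mul_distrib, prod_comp_eq (X ω),
      prod_comp_eq (fun i => star (X ω i))]
  have hprob : IsProbabilityMeasure stdComplexGaussian := by
    by_cases hI : Nonempty I
    · obtain ⟨i⟩ := hI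
      exact (hlaw i).isProbabilityMeasure_iff.1 inferInstance
    · constructor
      have := integral_moment 0 0
      simp only [pow_zero, mul_one, if_true, Nat.factorial_zero, Nat.cast_one, integral_const] at this
      have h1 : stdComplexGaussian.real Set.univ = 1 := by
        simpa using this
      have := (ENNReal.toReal_eq_one_iff _).1 h1
      exact this
  have hmap : HasLaw X (Measure.pi fun _ => stdComplexGaussian) P := by
    have := hind.hasLaw_pi hlaw
    exact this
  have hint : Integrable (fun x : I → ℂ => ∏ i, (x i ^ a i * star (x i) ^ b i))
      (Measure.pi fun _ => stdComplexGaussian) :=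
    Integrable.fintype_prod_dep fun i => integrable_moment (a i) (b i)
  rw [hrew]
  refine ⟨?_, ?_⟩
  · rw [← hmap.map_eq] at hint
    exact hint.comp_aemeasurable hmap.aemeasurable
  · rw [hmap.integral_comp hint.aestronglyMeasurable,
      integral_fintype_prod_eq_prod (fun i (z : ℂ) => z ^ a i * star z ^ b i), card_perm_comp_eq]
    push_cast
    refine Finset.prod_congr rfl fun i _ => ?_
    rw [integral_moment]

end Counting

end GaussianTensor

namespace GaussianTensor

/-! ### Expansion of traces of words -/

section Trace

variable {n : Type*} [Fintype n] [DecidableEq n]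

theorem prod_ofFn_apply {p : ℕ} (M : Fin (p + 1) → Matrix n n ℂ) (i j : n) :
    (List.ofFn M).prod i j = ∑ x : Fin p → n, ∏ k : Fin (p + 1),
      M k ((Fin.cons i x : Fin (p + 1) → n) k) ((Fin.snoc x j : Fin (p + 1) → n) k) := by
  induction p generalizing i with
  | zero => simp [Fin.snoc]
  | succ p ih =>
    rw [List.ofFn_succ, List.prod_cons, Matrix.mul_apply,
      ← (Fin.consEquiv fun _ : Fin (p + 1) => n).sum_comp, Fintype.sum_prod_type]
    refine Finset.sum_congr rfl fun l _ => ?_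
    rw [ih, Finset.mul_sum]
    refine Finset.sum_congr rfl fun x _ => ?_
    rw [Fin.prod_univ_succ (n := p + 1)]
    congr 1
    refine Finset.prod_congr rfl fun k _ => ?_
    rw [Fin.cons_succ]
    have : (Fin.snoc ((Fin.consEquiv fun _ : Fin (p + 1) => n) (l, x)) j : Fin (p + 2) → n) =
        Fin.cons l (Fin.snoc x j : Fin (p + 1) → n) := by
      exact (Fin.cons_snoc_eq_snoc_cons l x j).symm
    rw [this, Fin.cons_succ]
    rfl

theorem trace_prod_ofFn {p : ℕ} (M : Fin (p + 1) → Matrix n n ℂ) :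
    (List.ofFn M).prod.trace =
      ∑ x : Fin (p + 1) → n, ∏ k, M k (x k) (x (finRotate (p + 1) k)) := by
  rw [Matrix.trace, ← (Fin.consEquiv fun _ : Fin (p + 1) => n).sum_comp, Fintype.sum_prod_type]
  refine Finset.sum_congr rfl fun i _ => ?_
  rw [Matrix.diag_apply, prod_ofFn_apply]
  refine Finset.sum_congr rfl fun x _ => ?_
  rw [Fin.snoc_eq_cons_rotate]
  rfl

end Trace

theorem finRotate_val {p : ℕ} (k : Fin p) : (finRotate p k).val = (k.val + 1) % p := by
  cases p with
  | zero => exact k.elim0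
  | succ p =>
    rw [finRotate_apply, Fin.val_add, Fin.val_one', Nat.add_mod_mod]

/-- The tensor leg (`true` for `B`, `false` for `C`) that carries the matrix index. -/
def leg : Marginal → Bool
  | Marginal.AB => true
  | Marginal.AC => false

theorem leg_injective : Function.Injective leg := by
  rintro ⟨⟩ ⟨⟩ h <;> first | rfl | exact absurd h (by decide)

section Legs

variable {p : ℕ} (f : Fin p → Marginal)

/-- The legs that carry the matrix indices, in cyclic order. -/
def matrixLegs : List (Fin p × Bool) := (List.finRange p).map fun k => (k, leg (f k))

theorem nodup_matrixLegs : (matrixLegs f).Nodup :=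
  (List.nodup_finRange p).map fun _ _ h => congrArg Prod.fst h

theorem formPerm_matrixLegs (k : Fin p) :
    (matrixLegs f).formPerm (k, leg (f k)) = (finRotate p k, leg (f (finRotate p k))) := by
  have hlen : (matrixLegs f).length = p := by simp [matrixLegs]
  have hget : ∀ (i : ℕ) (hi : i < (matrixLegs f).length),
      (matrixLegs f)[i] = (⟨i, hlen ▸ hi⟩, leg (f ⟨i, hlen ▸ hi⟩)) := by
    intro i hi
    simp [matrixLegs]
  have h := List.formPerm_apply_getElem _ (nodup_matrixLegs f) k.1 (hlen.symm ▸ k.2)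
  rw [hget, hget] at h
  have hlt : (k.1 + 1) % (matrixLegs f).length < p := by
    rw [hlen]; exact Nat.mod_lt _ k.pos
  have e : (⟨(k.1 + 1) % (matrixLegs f).length, hlt⟩ : Fin p) = finRotate p k := by
    refine Fin.ext ?_
    rw [finRotate_val]
    simp only [hlen]
  rw [e] at h
  exact h

theorem formPerm_matrixLegs_of_ne {k : Fin p} {b : Bool} (h : b ≠ leg (f k)) :
    (matrixLegs f).formPerm (k, b) = (k, b) := by
  refine List.formPerm_apply_of_notMem fun hmem => ?_
  obtain ⟨j, -, hj⟩ := List.mem_map.1 hmem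
  obtain ⟨rfl, rfl⟩ := Prod.mk.inj hj
  exact h rfl

theorem formPerm_finRange : (List.finRange p).formPerm = finRotate p := by
  ext k
  have h := List.formPerm_apply_getElem _ (List.nodup_finRange p) k.1 (by simp)
  simp only [List.getElem_finRange, List.length_finRange] at h
  rw [finRotate_val]
  have := congrArg Fin.val h
  simpa using this

/-- The permutation `σ`, acting on both tensor legs. -/
def legPerm (σ : Equiv.Perm (Fin p)) : Equiv.Perm (Fin p × Bool) :=
  Equiv.prodCongr σ (Equiv.refl Bool)

theorem legPerm_apply (σ : Equiv.Perm (Fin p)) (k : Fin p) (b : Bool) :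
    legPerm σ (k, b) = (σ k, b) := rfl

/-- The number of independent indices of dimension `N` in the Wick contraction `σ`. -/
noncomputable def loops (σ : Equiv.Perm (Fin p)) : ℕ :=
  numCycles ((matrixLegs f).formPerm * legPerm σ)

end Legs

/-! ### The expected trace as a sum over permutations -/

section Expectation

variable {a n d p : ℕ}

/-- The tensor index of the entry of the marginal `m` with matrix index `i`, traced index `t`. -/
def entryIndex (m : Marginal) (i : Fin a × Fin n) (t : Fin n × Fin d) : TensorIndex a n n d :=
  match m with
  | Marginal.AB => (i.1, i.2, t.1, t.2)
  | Marginal.AC => (i.1, t.1, i.2, t.2)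

theorem marginal_apply (X : TensorIndex a n n d → ℂ) (m : Marginal) (i j : Fin a × Fin n) :
    marginal X m i j =
      ∑ t : Fin n × Fin d, X (entryIndex m i t) * star (X (entryIndex m j t)) := by
  rw [Fintype.sum_prod_type]
  cases m <;> rfl

/-- The index set of the trace of a word: indices of the first leg, of the two middle legs and of
the last leg. -/
abbrev WordIndex (a n d p : ℕ) : Type :=
  (Fin p → Fin a) × (Fin p × Bool → Fin n) × (Fin p → Fin d)

/-- Reordering the matrix indices and the traced indices of a word. -/
def wordIndexEquiv (f : Fin p → Marginal) :
    WordIndex a n d p ≃ (Fin p → Fin a × Fin n) × (Fin p → Fin n × Fin d) where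
  toFun w := (fun k => (w.1 k, w.2.1 (k, leg (f k))), fun k => (w.2.1 (k, !leg (f k)), w.2.2 k))
  invFun y := (fun k => (y.1 k).1,
    fun q => if q.2 = leg (f q.1) then (y.1 q.1).2 else (y.2 q.1).1, fun k => (y.2 k).2)
  left_inv := by
    rintro ⟨α, s, δ⟩
    refine Prod.ext rfl (Prod.ext ?_ rfl)
    funext ⟨k, b⟩
    by_cases h : b = leg (f k)
    · simp [h]
    · simp only [if_neg h]
      have : (!leg (f k)) = b := by
        cases b <;> cases hl : leg (f k) <;> simp_all
      rw [this]
  right_inv := by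
    rintro ⟨x, t⟩
    refine Prod.ext ?_ ?_
    · funext k
      simp
    · funext k
      simp

/-- The tensor index of the `k`-th factor `X` in the word. -/
def plainIndex (w : WordIndex a n d p) (k : Fin p) : TensorIndex a n n d :=
  (w.1 k, w.2.1 (k, true), w.2.1 (k, false), w.2.2 k)

/-- The tensor index of the `k`-th factor `X̄` in the word. -/
def conjIndex (f : Fin p → Marginal) (w : WordIndex a n d p) (k : Fin p) : TensorIndex a n n d :=
  (w.1 (finRotate p k), w.2.1 ((matrixLegs f).formPerm (k, true)),
    w.2.1 ((matrixLegs f).formPerm (k, false)), w.2.2 k)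

/-- From the factor `X` to the factor `X̄` at the same position, the first leg and the leg with the
matrix index advance to the next position, while the traced legs keep their index. The cycle of
`matrixLegs` records this, as it fixes the traced middle legs. -/
theorem trace_word (X : TensorIndex a n n d → ℂ) (f : Fin (p + 1) → Marginal) :
    (List.ofFn fun i => marginal X (f i)).prod.trace =
      ∑ w : WordIndex a n d (p + 1), ∏ k, (X (plainIndex w k) * star (X (conjIndex f w k))) := by
  rw [trace_prod_ofFn, ← (wordIndexEquiv f).symm.sum_comp, Fintype.sum_prod_type]
  refine Finset.sum_congr rfl fun x _ => ?_
  simp only [marginal_apply]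
  rw [Finset.prod_univ_sum, Fintype.piFinset_univ]
  refine Finset.sum_congr rfl fun t _ => Finset.prod_congr rfl fun k _ => ?_
  set w := (wordIndexEquiv f).symm (x, t) with hw
  have hx : ((wordIndexEquiv f) w).1 = x := by rw [hw, Equiv.apply_symm_apply]
  have ht : ((wordIndexEquiv f) w).2 = t := by rw [hw, Equiv.apply_symm_apply]
  have hplain : entryIndex (f k) (((wordIndexEquiv f) w).1 k) (((wordIndexEquiv f) w).2 k) =
      plainIndex w k := by
    simp only [wordIndexEquiv, Equiv.coe_fn_mk, plainIndex]
    cases f k <;> rfl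
  have hconj : entryIndex (f k) (((wordIndexEquiv f) w).1 (finRotate (p + 1) k))
      (((wordIndexEquiv f) w).2 k) = conjIndex f w k := by
    have h1 := formPerm_matrixLegs f k
    have h2 := formPerm_matrixLegs_of_ne f (k := k) (b := !leg (f k)) (by simp)
    simp only [wordIndexEquiv, Equiv.coe_fn_mk, conjIndex]
    revert h1 h2
    cases f k <;> intro h1 h2
    · simp only [leg, Bool.not_true] at h1 h2 ⊢
      simp only [entryIndex, h1, h2]
    · simp only [leg, Bool.not_false] at h1 h2 ⊢
      simp only [entryIndex, h1, h2]
  rw [← hplain, ← hconj, hx, ht]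

-- The constraint decouples over the legs: the indices on the first, middle and last legs must be
-- invariant under `γ σ`, under the product that defines `loops`, and under `σ`.
open CycleCount in
theorem card_wordIndex (f : Fin p → Marginal) (σ : Equiv.Perm (Fin p)) :
    Nat.card {w : WordIndex a n d p // ∀ k, plainIndex w k = conjIndex f w (σ k)} =
      a ^ numCycles (finRotate p * σ) * (n ^ loops f σ * d ^ numCycles σ) := by
  rw [loops, ← card_invariant, ← card_invariant, ← card_invariant, ← Nat.card_prod,
    ← Nat.card_prod]
  refine Nat.card_congr
    { toFun := fun w => (⟨w.1.1, fun k => ?_⟩, ⟨w.1.2.1, fun q => ?_⟩, ⟨w.1.2.2, fun k => ?_⟩)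
      invFun := fun w => ⟨(w.1.1, w.2.1.1, w.2.2.1), fun k => ?_⟩
      left_inv := fun w => rfl
      right_inv := fun w => rfl }
  · exact (congrArg Prod.fst (w.2 k)).symm
  · obtain ⟨k, b⟩ := q
    cases b
    · exact (congrArg (fun t => t.2.2.1) (w.2 k)).symm
    · exact (congrArg (fun t => t.2.1) (w.2 k)).symm
  · exact (congrArg (fun t => t.2.2.2) (w.2 k)).symm
  · exact Prod.ext (w.1.2 k).symm (Prod.ext (w.2.1.2 (k, true)).symm
      (Prod.ext (w.2.1.2 (k, false)).symm (w.2.2.2 k).symm))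

variable {Ω : Type*} [MeasurableSpace Ω] {P : Measure Ω} [IsProbabilityMeasure P]

theorem sum_card_subtype_comm {S T : Type*} [Fintype S] [Fintype T] (R : S → T → Prop) :
    ∑ s, Nat.card {t // R s t} = ∑ t, Nat.card {s // R s t} := by
  classical
  simp only [Nat.card_eq_fintype_card, Fintype.card_subtype, Finset.card_filter]
  exact Finset.sum_comm

/-- The genus expansion of the expected trace of a word. -/
theorem integral_trace_word {X : Ω → TensorIndex a n n d → ℂ} (hX : IsGaussianTensor P X)
    (f : Fin (p + 1) → Marginal) :
    Integrable (fun ω => (List.ofFn fun i => marginal (X ω) (f i)).prod.trace) P ∧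
      ∫ ω, (List.ofFn fun i => marginal (X ω) (f i)).prod.trace ∂P =
        ∑ σ : Equiv.Perm (Fin (p + 1)), (a : ℂ) ^ numCycles (finRotate (p + 1) * σ) *
          ((n : ℂ) ^ loops f σ * (d : ℂ) ^ numCycles σ) := by
  simp only [trace_word]
  have hw := fun w : WordIndex a n d (p + 1) =>
    wick hX.hasLaw hX.indep (plainIndex w) (conjIndex f w)
  refine ⟨integrable_finsetSum _ fun w _ => (hw w).1, ?_⟩
  rw [integral_finsetSum _ fun w _ => (hw w).1]
  simp only [(hw _).2]
  -- Pairs of an index assignment and a compatible permutation are counted in the other order.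
  rw [← Nat.cast_sum, sum_card_subtype_comm
    (fun (w : WordIndex a n d (p + 1)) (σ : Equiv.Perm (Fin (p + 1))) =>
      ∀ k, plainIndex w k = conjIndex f w (σ k))]
  simp only [card_wordIndex]
  push_cast
  rfl

end Expectation

end GaussianTensor

namespace GaussianTensor

open CycleCount

/-! ### The exponents of the genus expansion -/

section Loops

variable {p : ℕ} (f : Fin (p + 1) → Marginal) (σ : Equiv.Perm (Fin (p + 1)))

theorem numCycles_finRotate : numCycles (finRotate (p + 1)) = 1 := by
  have := numCycles_formPerm (List.nodup_finRange (p + 1)) (by simp)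
  rw [formPerm_finRange, List.length_finRange, Fintype.card_fin] at this
  omega

theorem eq_of_invariant_finRotate {α : Type*} {v : Fin (p + 1) → α}
    (hv : Invariant (finRotate (p + 1)) v) (k : Fin (p + 1)) : v k = v 0 := by
  induction k using Fin.induction with
  | zero => rfl
  | succ i ih =>
    rw [← ih, ← hv i.castSucc, finRotate_apply, Fin.coeSucc_eq_succ]

/-- Functions invariant under `σ` on both legs are pairs of invariant functions. -/
theorem numCycles_legPerm : numCycles (legPerm σ) = numCycles σ + numCycles σ := by
  -- Cycle counts are compared by counting invariant functions with two values.
  refine Nat.pow_right_injective (le_refl 2) ?_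
  simp only
  rw [pow_add, ← card_invariant, ← card_invariant, ← Nat.card_prod]
  refine Nat.card_congr
    { toFun := fun s => (⟨fun k => s.1 (k, true), fun k => s.2 (k, true)⟩,
        ⟨fun k => s.1 (k, false), fun k => s.2 (k, false)⟩)
      invFun := fun s => ⟨fun q => if q.2 then s.1.1 q.1 else s.2.1 q.1, ?_⟩
      left_inv := ?_
      right_inv := ?_ }
  · rintro ⟨k, b⟩
    cases b
    · exact s.2.2 k
    · exact s.1.2 k
  · rintro ⟨s, hs⟩
    refine Subtype.ext (funext ?_)
    rintro ⟨k, b⟩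
    cases b <;> rfl
  · rintro ⟨s, t⟩
    rfl

/-- If `σ` preserves the letters, it maps matrix legs to matrix legs and traced legs to traced legs.
The loop permutation is then `γ σ` on the former and `σ` on the latter. -/
theorem loops_of_invariant (h : Invariant σ f) :
    loops f σ = numCycles (finRotate (p + 1) * σ) + numCycles σ := by
  refine Nat.pow_right_injective (le_refl 2) ?_
  simp only
  rw [pow_add, loops, ← card_invariant, ← card_invariant, ← card_invariant, ← Nat.card_prod]
  refine Nat.card_congr
    { toFun := fun s => (⟨fun k => s.1 (k, leg (f k)), fun k => ?_⟩,
        ⟨fun k => s.1 (k, !leg (f k)), fun k => ?_⟩)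
      invFun := fun s => ⟨fun q => if q.2 = leg (f q.1) then s.1.1 q.1 else s.2.1 q.1, ?_⟩
      left_inv := ?_
      right_inv := ?_ }
  · have := s.2 (k, leg (f k))
    rw [Equiv.Perm.mul_apply, legPerm_apply, ← h k, formPerm_matrixLegs] at this
    rw [Equiv.Perm.mul_apply]
    dsimp only
    rw [this, h k]
  · have := s.2 (k, !leg (f k))
    rw [Equiv.Perm.mul_apply, legPerm_apply,
      formPerm_matrixLegs_of_ne f (by rw [h k]; simp)] at this
    dsimp only
    rw [h k, this]
  · rintro ⟨k, b⟩
    rw [Equiv.Perm.mul_apply, legPerm_apply]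
    by_cases hb : b = leg (f k)
    · have hb' : b = leg (f (σ k)) := by rw [h k]; exact hb
      nth_rewrite 1 2 [hb']
      rw [formPerm_matrixLegs]
      dsimp only
      rw [if_pos rfl, if_pos (hb'.symm.trans hb)]
      exact s.1.2 k
    · have hb' : b ≠ leg (f (σ k)) := by rw [h k]; exact hb
      rw [formPerm_matrixLegs_of_ne f hb']
      dsimp only
      rw [if_neg hb', if_neg hb]
      exact s.2.2 k
  · rintro ⟨s, hs⟩
    refine Subtype.ext (funext ?_)
    rintro ⟨k, b⟩
    by_cases hb : b = leg (f k)
    · simp [hb]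
    · have : (!leg (f k)) = b := by
        cases b <;> cases hl : leg (f k) <;> simp_all
      simp only [if_neg hb, this]
  · rintro ⟨s, t⟩
    refine Prod.ext (Subtype.ext (funext fun k => ?_)) (Subtype.ext (funext fun k => ?_))
    · simp
    · simp

/-- The sum over the two legs of an invariant function. -/
def sumLegs : (invariantSubmodule (legPerm σ) ⊓ invariantSubmodule (matrixLegs f).formPerm :
    Submodule ℝ (Fin (p + 1) × Bool → ℝ)) →ₗ[ℝ] invariantSubmodule σ where
  toFun v := ⟨fun k => v.1 (k, true) + v.1 (k, false), fun k => by
    have h1 := v.2.1 (k, true)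
    have h2 := v.2.1 (k, false)
    rw [legPerm_apply] at h1 h2
    dsimp only
    rw [h1, h2]⟩
  map_add' v w := Subtype.ext (funext fun k => by
    change v.1 _ + w.1 _ + (v.1 _ + w.1 _) = v.1 _ + v.1 _ + (w.1 _ + w.1 _)
    ring)
  map_smul' r v := Subtype.ext (funext fun k => by
    change r * v.1 _ + r * v.1 _ = r * (v.1 _ + v.1 _)
    ring)

variable {f σ} in
theorem matrixLeg_eq {v : Fin (p + 1) × Bool → ℝ} (hv : Invariant (matrixLegs f).formPerm v)
    (k : Fin (p + 1)) : v (k, leg (f k)) = v (0, leg (f 0)) :=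
  eq_of_invariant_finRotate (v := fun k => v (k, leg (f k)))
    (fun k => by
      have := hv (k, leg (f k))
      rwa [formPerm_matrixLegs] at this) k

variable {f σ} in
theorem eq_zero_of_sumLegs {v : Fin (p + 1) × Bool → ℝ}
    (hv : Invariant (matrixLegs f).formPerm v) (h0 : v (0, leg (f 0)) = 0)
    (hs : ∀ k, v (k, true) + v (k, false) = 0) : v = 0 := by
  funext ⟨k, b⟩
  have h1 := matrixLeg_eq hv k
  rw [h0] at h1
  have h2 := hs k
  cases hl : leg (f k) <;> rw [hl] at h1 <;> rw [h1] at h2 <;> cases b <;>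
    simp only [Pi.zero_apply] <;> linarith

/-- A jointly invariant function is constant on the matrix legs, as the cycle passes through all of
them. Each position has exactly one matrix leg, so this constant and the `σ`-invariant sum over the
two legs determine the function. -/
theorem finrank_inf_le : Module.finrank ℝ
    (invariantSubmodule (legPerm σ) ⊓ invariantSubmodule (matrixLegs f).formPerm :
      Submodule ℝ (Fin (p + 1) × Bool → ℝ)) ≤ 1 + numCycles σ := by
  have h := LinearMap.finrank_le_finrank_of_injective
    (f := ((LinearMap.proj (R := ℝ) (φ := fun _ : Fin (p + 1) × Bool => ℝ) (0, leg (f 0))) ∘ₗ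
      (Submodule.subtype _)).prod (sumLegs f σ)) (by
      refine (injective_iff_map_eq_zero _).2 fun v hv => Subtype.ext ?_
      obtain ⟨h1, h2⟩ := Prod.mk.inj hv
      exact eq_zero_of_sumLegs v.2.2 h1 fun k => congrFun (congrArg Subtype.val h2) k)
  rwa [Module.finrank_prod, Module.finrank_self, finrank_invariantSubmodule] at h

/-- If `σ` maps position `k` to one with the other letter, invariance transports the constant on the
matrix legs to the traced leg at `k`. The sum over the legs at `k` is then twice the constant, so
the sums alone determine the function. -/
theorem finrank_inf_le_of_not_invariant (hf : ¬ Invariant σ f) : Module.finrank ℝ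
    (invariantSubmodule (legPerm σ) ⊓ invariantSubmodule (matrixLegs f).formPerm :
      Submodule ℝ (Fin (p + 1) × Bool → ℝ)) ≤ numCycles σ := by
  have h := LinearMap.finrank_le_finrank_of_injective (f := sumLegs f σ) (by
      refine (injective_iff_map_eq_zero _).2 fun v hv => Subtype.ext ?_
      have hs : ∀ k, v.1 (k, true) + v.1 (k, false) = 0 := fun k =>
        congrFun (congrArg Subtype.val hv) k
      refine eq_zero_of_sumLegs v.2.2 ?_ hs
      unfold Invariant at hf
      push Not at hf
      obtain ⟨k, hk⟩ := hf
      have h1 := matrixLeg_eq v.2.2 k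
      have h2 := matrixLeg_eq v.2.2 (σ k)
      have h3 := v.2.1 (k, leg (f (σ k)))
      rw [legPerm_apply] at h3
      rw [h3] at h2
      have hne : leg (f (σ k)) ≠ leg (f k) := fun e => hk (leg_injective e)
      have h4 := hs k
      cases hl : leg (f k) <;> cases hl' : leg (f (σ k)) <;> rw [hl] at h1 hne <;>
        rw [hl'] at h2 hne
      · exact absurd rfl hne
      · linarith
      · linarith
      · exact absurd rfl hne)
  rwa [finrank_invariantSubmodule] at h

/-- Euler's inequality on the `2 (p + 1)` legs, where the cycle through the `p + 1` matrix legs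
leaves `p + 2` cycles. The dimension on the right is the number of connected components. -/
theorem euler_loops : 2 * numCycles σ + loops f σ ≤ p + 2 * Module.finrank ℝ
    (invariantSubmodule (legPerm σ) ⊓ invariantSubmodule (matrixLegs f).formPerm :
      Submodule ℝ (Fin (p + 1) × Bool → ℝ)) := by
  have h1 := euler_inequality_formPerm (legPerm σ) (nodup_matrixLegs f)
  have h2 := numCycles_formPerm (nodup_matrixLegs f) (by
    intro h
    have := congrArg List.length h
    simp [matrixLegs] at this)
  have h3 : (matrixLegs f).length = p + 1 := by simp [matrixLegs]
  rw [numCycles_legPerm] at h1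
  change numCycles σ + numCycles σ + _ + loops f σ ≤ _ at h1
  simp only [Fintype.card_prod, Fintype.card_fin, Fintype.card_bool] at h1 h2
  omega

theorem loops_le : loops f σ ≤ p + 2 := by
  have h1 := euler_loops f σ
  have h2 := finrank_inf_le f σ
  omega

/-- A `σ` that mixes the letters has at most as many components as cycles, and Euler's inequality
gives `loops f σ ≤ p`. Otherwise `loops_of_invariant` turns equality into the geodesic equation. The
word has length `p + 1`, hence the maximum `p + 2`. -/
theorem loops_eq_iff : loops f σ = p + 2 ↔ σ ∈ geodesics f (List.finRange (p + 1)) := by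
  rw [mem_geodesics, formPerm_finRange]
  unfold Geodesic
  rw [numCycles_finRotate, Fintype.card_fin]
  constructor
  · intro h
    have hinv : Invariant σ f := by
      by_contra hf
      have h1 := euler_loops f σ
      have h2 := finrank_inf_le_of_not_invariant f σ hf
      omega
    have := loops_of_invariant f σ hinv
    exact ⟨by omega, hinv⟩
  · rintro ⟨h, hinv⟩
    have := loops_of_invariant f σ hinv
    omega

theorem numCycles_add_numCycles_le :
    numCycles (finRotate (p + 1) * σ) + numCycles σ ≤ p + 2 := by
  have := numCycles_add_le (finRotate (p + 1)) σ
  rw [numCycles_finRotate, Fintype.card_fin] at this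
  omega

end Loops

end GaussianTensor

namespace GaussianTensor

open CycleCount

/-! ### The limits of the moments -/

instance : DecidableEq Marginal
  | Marginal.AB, Marginal.AB => isTrue rfl
  | Marginal.AC, Marginal.AC => isTrue rfl
  | Marginal.AB, Marginal.AC => isFalse (by intro h; cases h)
  | Marginal.AC, Marginal.AB => isFalse (by intro h; cases h)

theorem sum_geodesics_finRange {p : ℕ} (c : ℝ) (hc : 0 < c) (f : Fin p → Marginal) :
    ∑ σ ∈ geodesics f (List.finRange p), c ^ numCycles σ = wordMoment c (List.ofFn f) := by
  have h := sum_geodesics c hc.ne' f p (List.finRange p) (by simp) (List.nodup_finRange p)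
  rw [List.length_finRange, Fintype.card_fin, ← List.ofFn_eq_map, mul_comm] at h
  exact mul_left_cancel₀ (pow_ne_zero p hc.ne') h

section Limit

variable (NA ND : ℕ → ℕ) (hNA : ∀ N, 0 < NA N) (c : ℝ) (hc : 0 < c)
  (hND : Asymptotics.IsEquivalent atTop (fun N => (ND N : ℝ)) (fun N => c * (NA N : ℝ)))

include hNA hc hND

theorem tendsto_ratio : Tendsto (fun N => (ND N : ℝ) / NA N) atTop (𝓝 c) := by
  have hne : ∀ N, (NA N : ℝ) ≠ 0 := fun N => by exact_mod_cast (hNA N).ne'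
  have h := (Asymptotics.isEquivalent_iff_tendsto_one
    (Eventually.of_forall fun N => mul_ne_zero hc.ne' (hne N))).1 hND
  have h2 := h.const_mul c
  rw [mul_one] at h2
  refine h2.congr fun N => ?_
  have := hne N
  simp only [Pi.div_apply]
  field_simp

/-- `NA` may stay bounded, so a deficit in its exponent gives no decay. It suffices that `i + j ≤ q`
and `NA N ≥ 1` keep these powers bounded while a missing power of `N` supplies the factor `1 / N`.
When `l = q`, the exponent of `NA` must match exactly, which is `hlij`. -/
theorem tendsto_term {q i j l : ℕ} (hij : i + j ≤ q) (hl : l ≤ q) (hlij : l = q → i + j = q) :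
    Tendsto (fun N : ℕ => (((NA N : ℝ) * N) ^ q)⁻¹ * ((NA N : ℝ) ^ i * ((N : ℝ) ^ l *
      (ND N : ℝ) ^ j))) atTop (𝓝 (if l = q then c ^ j else 0)) := by
  have hne : ∀ N, (NA N : ℝ) ≠ 0 := fun N => by exact_mod_cast (hNA N).ne'
  have hone : ∀ N, (1 : ℝ) ≤ NA N := fun N => by exact_mod_cast hNA N
  have hr := (tendsto_ratio NA ND hNA c hc hND).pow j
  split_ifs with h
  · refine hr.congr' ?_
    filter_upwards [eventually_gt_atTop 0] with N hN
    have hN' : (N : ℝ) ≠ 0 := by exact_mod_cast hN.ne'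
    have := hne N
    rw [h, ← hlij h, div_pow, mul_pow, pow_add, pow_add]
    field_simp
  · have hlim : Tendsto (fun N : ℕ => ((ND N : ℝ) / NA N) ^ j * (N : ℝ)⁻¹) atTop (𝓝 0) := by
      have := hr.mul (tendsto_inv_atTop_nhds_zero_nat (𝕜 := ℝ))
      rwa [mul_zero] at this
    refine tendsto_of_tendsto_of_tendsto_of_le_of_le' tendsto_const_nhds hlim
      (Eventually.of_forall fun N => by positivity) ?_
    filter_upwards [eventually_gt_atTop 0] with N hN
    have hN' : (N : ℝ) ≠ 0 := by exact_mod_cast hN.ne'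
    have hN1 : (1 : ℝ) ≤ N := by exact_mod_cast hN
    have h1 : (NA N : ℝ) ^ (i + j) ≤ (NA N : ℝ) ^ q := pow_le_pow_right₀ (hone N) hij
    have h2 : (N : ℝ) ^ (l + 1) ≤ (N : ℝ) ^ q := pow_le_pow_right₀ hN1 (by omega)
    have hNA' : (0 : ℝ) < NA N := lt_of_lt_of_le one_pos (hone N)
    have hN0 : (0 : ℝ) < N := lt_of_lt_of_le one_pos hN1
    rw [inv_mul_le_iff₀ (by positivity), div_pow, mul_pow]
    calc (NA N : ℝ) ^ i * ((N : ℝ) ^ l * (ND N : ℝ) ^ j)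
        = (NA N : ℝ) ^ (i + j) * (N : ℝ) ^ (l + 1) *
          ((ND N : ℝ) ^ j / (NA N : ℝ) ^ j * (N : ℝ)⁻¹) := by
          rw [pow_add, pow_succ]
          field_simp
      _ ≤ _ := by gcongr

variable {Ω : ℕ → Type*} [∀ N, MeasurableSpace (Ω N)] (P : ∀ N, Measure (Ω N))
    [∀ N, IsProbabilityMeasure (P N)] (X : ∀ N, Ω N → TensorIndex (NA N) N N (ND N) → ℂ)
    (hX : ∀ N, IsGaussianTensor (P N) (X N))

include hX

theorem tendsto_word {p : ℕ} (f : Fin p → Marginal) :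
    (∀ N, Integrable (fun ω => (List.ofFn fun i => marginal (X N ω) (f i)).prod.trace) (P N)) ∧
    Tendsto (fun N => (((NA N : ℂ) * (N : ℂ)) ^ (p + 1))⁻¹ *
        ∫ ω, (List.ofFn fun i => marginal (X N ω) (f i)).prod.trace ∂(P N)) atTop
      (𝓝 ((wordMoment c (List.ofFn f) : ℝ) : ℂ)) := by
  cases p with
  | zero =>
    simp only [List.ofFn_zero, List.prod_nil, wordMoment_nil, Matrix.trace_one]
    refine ⟨fun N => integrable_const _, ?_⟩
    refine tendsto_const_nhds.congr' ?_
    filter_upwards [eventually_gt_atTop 0] with N hN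
    have h1 : (NA N : ℂ) ≠ 0 := by exact_mod_cast (hNA N).ne'
    have h2 : (N : ℂ) ≠ 0 := by exact_mod_cast hN.ne'
    simp only [integral_const, probReal_univ, one_smul, Fintype.card_prod, Fintype.card_fin]
    push_cast
    field_simp
  | succ p =>
    refine ⟨fun N => (integral_trace_word (hX N) f).1, ?_⟩
    have hlim : Tendsto (fun N : ℕ => ∑ σ : Equiv.Perm (Fin (p + 1)),
        (((NA N : ℝ) * N) ^ (p + 2))⁻¹ * ((NA N : ℝ) ^ numCycles (finRotate (p + 1) * σ) *
          ((N : ℝ) ^ loops f σ * (ND N : ℝ) ^ numCycles σ))) atTop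
        (𝓝 (∑ σ : Equiv.Perm (Fin (p + 1)), if loops f σ = p + 2 then c ^ numCycles σ else 0)) :=
      tendsto_finsetSum _ fun σ _ => tendsto_term NA ND hNA c hc hND
        (numCycles_add_numCycles_le σ) (loops_le f σ) fun h => by
          have := (mem_geodesics.1 ((loops_eq_iff f σ).1 h)).2
          rw [← h, loops_of_invariant f σ this]
    have hval : (∑ σ : Equiv.Perm (Fin (p + 1)), if loops f σ = p + 2 then c ^ numCycles σ else 0) =
        wordMoment c (List.ofFn f) := by
      rw [← sum_geodesics_finRange c hc f, ← Finset.sum_filter]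
      refine Finset.sum_congr ?_ fun _ _ => rfl
      ext σ
      rw [Finset.mem_filter, loops_eq_iff]
      simp
    rw [hval] at hlim
    refine ((Complex.continuous_ofReal.tendsto _).comp hlim).congr fun N => ?_
    rw [(integral_trace_word (hX N) f).2, Function.comp_apply, Finset.mul_sum]
    push_cast
    rfl

end Limit

theorem isHermitian_marginal {a n d : ℕ} (X : TensorIndex a n n d → ℂ) (m : Marginal) :
    (marginal X m).IsHermitian := by
  ext i j
  rw [Matrix.conjTranspose_apply, marginal_apply, marginal_apply, star_sum]
  refine Finset.sum_congr rfl fun t _ => ?_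
  rw [star_mul, star_star]

/-- `wordMatrix` multiplies from right to left. For Hermitian factors, reversing the order only
conjugates the trace, and this does not affect a real limit. -/
theorem trace_reverse_prod {n : Type*} [Fintype n] [DecidableEq n] (l : List (Matrix n n ℂ))
    (h : ∀ A ∈ l, A.IsHermitian) : l.reverse.prod.trace = star l.prod.trace := by
  rw [← Matrix.trace_conjTranspose, Matrix.conjTranspose_list_prod]
  congr 3
  symm
  refine (List.map_congr_left fun A hA => h A hA).trans (List.map_id _)

end GaussianTensor

namespace GaussianTensor

open CycleCount

/-! ### The limit as a sum over non-crossing partitions -/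

section Partitions

variable {p : ℕ}

theorem setPartition_ext {α β : SetPartition p} (h : ∀ a b, b ∈ α.part a ↔ b ∈ β.part a) :
    α = β := by
  have hpart : ∀ a, α.part a = β.part a := fun a => Finset.ext (h a)
  refine Finpartition.ext (Finset.ext fun s => ⟨fun hs => ?_, fun hs => ?_⟩)
  · obtain ⟨a, ha⟩ := α.nonempty_of_mem_parts hs
    rw [← α.part_eq_of_mem hs ha, hpart]
    exact β.part_mem.2 (Finset.mem_univ a)
  · obtain ⟨a, ha⟩ := β.nonempty_of_mem_parts hs
    rw [← β.part_eq_of_mem hs ha, ← hpart]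
    exact α.part_mem.2 (Finset.mem_univ a)

theorem setPartition_le_iff {α β : SetPartition p} : α ≤ β ↔ ∀ a, α.part a ⊆ β.part a := by
  constructor
  · intro h a
    obtain ⟨t, ht, hle⟩ := h (α.part_mem.2 (Finset.mem_univ a))
    rw [β.part_eq_of_mem ht (hle (α.mem_part (Finset.mem_univ a)))]
    exact hle
  · intro h s hs
    obtain ⟨a, ha⟩ := α.nonempty_of_mem_parts hs
    refine ⟨β.part a, β.part_mem.2 (Finset.mem_univ a), ?_⟩
    rw [← α.part_eq_of_mem hs ha]
    exact h a

/-- The equivalence relation of a partition. -/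
def partSetoid (α : SetPartition p) : Setoid (Fin p) := Setoid.ker α.part

theorem partSetoid_iff {α : SetPartition p} {a b : Fin p} :
    partSetoid α a b ↔ b ∈ α.part a := by
  rw [α.mem_part_iff_part_eq_part (Finset.mem_univ b) (Finset.mem_univ a)]
  exact eq_comm

theorem isNonCrossing_iff {α : SetPartition p} :
    IsNonCrossing α ↔ NonCrossing (partSetoid α) := by
  constructor
  · intro h a b c d hab hbc hcd hac hbd
    have := h a b c d hab hbc hcd (α.part a) (α.part_mem.2 (Finset.mem_univ a)) (α.part b)
      (α.part_mem.2 (Finset.mem_univ b)) (α.mem_part (Finset.mem_univ a)) (partSetoid_iff.1 hac)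
      (α.mem_part (Finset.mem_univ b)) (partSetoid_iff.1 hbd)
    exact this
  · intro h i j k l hij hjk hkl s hs t ht his hks hjt hlt
    have e1 := α.part_eq_of_mem hs his
    have e2 := α.part_eq_of_mem ht hjt
    have := h i j k l hij hjk hkl (partSetoid_iff.2 (e1.symm ▸ hks))
      (partSetoid_iff.2 (e2.symm ▸ hlt))
    rw [← e1, ← e2]
    exact this

open Classical in
/-- The partition into the cycles of a permutation. -/
noncomputable def cyclePartition (σ : Equiv.Perm (Fin p)) : SetPartition p :=
  Finpartition.ofSetoid (Equiv.Perm.SameCycle.setoid σ)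

theorem mem_part_cyclePartition {σ : Equiv.Perm (Fin p)} {a b : Fin p} :
    b ∈ (cyclePartition σ).part a ↔ σ.SameCycle a b := by
  classical
  exact Finpartition.mem_part_ofSetoid_iff_rel

theorem partSetoid_cyclePartition (σ : Equiv.Perm (Fin p)) :
    partSetoid (cyclePartition σ) = Equiv.Perm.SameCycle.setoid σ :=
  Setoid.ext fun _ _ => partSetoid_iff.trans mem_part_cyclePartition

theorem card_parts_cyclePartition (σ : Equiv.Perm (Fin p)) :
    (cyclePartition σ).parts.card = numCycles σ := by
  have hlift : ∀ a b : Fin p, σ.SameCycle a b →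
      (cyclePartition σ).part a = (cyclePartition σ).part b := fun a b hab => by
    have : partSetoid (cyclePartition σ) a b := by rw [partSetoid_cyclePartition]; exact hab
    exact this
  let g : PermCycle σ → {s // s ∈ (cyclePartition σ).parts} :=
    Quotient.lift (fun a => ⟨(cyclePartition σ).part a,
      (cyclePartition σ).part_mem.2 (Finset.mem_univ a)⟩)
      fun a b hab => Subtype.ext (hlift a b hab)
  have hg : Function.Bijective g := by
    constructor
    · intro q r
      induction q using Quotient.inductionOn with
      | h a =>
      induction r using Quotient.inductionOn with
      | h b =>
      intro hab
      have h1 : partSetoid (cyclePartition σ) a b := congrArg Subtype.val hab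
      rw [partSetoid_cyclePartition] at h1
      exact Quotient.sound h1
    · rintro ⟨s, hs⟩
      obtain ⟨a, ha⟩ := (cyclePartition σ).nonempty_of_mem_parts hs
      exact ⟨Quotient.mk _ a, Subtype.ext ((cyclePartition σ).part_eq_of_mem hs ha)⟩
  rw [numCycles, Nat.card_eq_of_bijective g hg, Nat.card_eq_fintype_card, Fintype.card_coe]

theorem mem_part_kerPartition {f : Fin p → Marginal} {a b : Fin p} :
    b ∈ (kerPartition f).part a ↔ f a = f b := by
  classical
  exact Finpartition.mem_part_ofSetoid_iff_rel

theorem le_kerPartition_iff {α : SetPartition p} {f : Fin p → Marginal} :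
    α ≤ kerPartition f ↔ ∀ a b, partSetoid α a b → f a = f b := by
  rw [setPartition_le_iff]
  constructor
  · intro h a b hab
    exact mem_part_kerPartition.1 (h a (partSetoid_iff.1 hab))
  · intro h a b hb
    exact mem_part_kerPartition.2 (h a b (partSetoid_iff.2 hb))

/-- Taking cycles is a bijection: cycles of geodesics do not cross (`Geodesic.nonCrossing`), they
determine the geodesic (`Geodesic.eq_of_sameCycle_iff`), and every non-crossing partition arises
(`exists_geodesic`). Invariance of the word under `σ` is refinement of `kerPartition f`. -/
theorem sum_ncBelowKer (c : ℝ) (f : Fin p → Marginal) :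
    ∑ α ∈ ncBelowKer f, c ^ α.parts.card =
      ∑ σ ∈ geodesics f (List.finRange p), c ^ numCycles σ := by
  classical
  have hsort : (List.finRange p).Pairwise (· < ·) := List.pairwise_lt_finRange p
  symm
  refine Finset.sum_nbij cyclePartition ?_ ?_ ?_ ?_
  · intro σ hσ
    obtain ⟨hg, hi⟩ := mem_geodesics.1 hσ
    refine Finset.mem_filter.2 ⟨Finset.mem_univ _, isNonCrossing_iff.2 ?_,
      le_kerPartition_iff.2 ?_⟩
    · rw [partSetoid_cyclePartition]
      exact Geodesic.nonCrossing _ _ le_rfl hsort σ hg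
    · rw [partSetoid_cyclePartition]
      exact fun a b hab => hi.eq_of_sameCycle hab
  · intro σ hσ τ hτ he
    refine Geodesic.eq_of_sameCycle_iff _ _ le_rfl hsort σ τ
      (mem_geodesics.1 (Finset.mem_coe.1 hσ)).1 (mem_geodesics.1 (Finset.mem_coe.1 hτ)).1
      fun a b => ?_
    rw [← mem_part_cyclePartition, he, mem_part_cyclePartition]
  · intro α hα
    obtain ⟨-, hnc, hle⟩ := Finset.mem_filter.1 (Finset.mem_coe.1 hα)
    obtain ⟨σ, hg, hinv⟩ := exists_geodesic _ (List.finRange p) le_rfl hsort (partSetoid α)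
      (isNonCrossing_iff.1 hnc) (fun a _ _ _ => List.mem_finRange a)
    have hrel := sameCycle_iff_of_invariant_iff hinv
    refine ⟨σ, Finset.mem_coe.2 (mem_geodesics.2 ⟨hg, invariant_iff_sameCycle.2 fun a b hab =>
      le_kerPartition_iff.1 hle a b ((hrel a b).1 hab)⟩), setPartition_ext fun a b => ?_⟩
    rw [mem_part_cyclePartition, hrel, partSetoid_iff]
  · intro σ _
    rw [card_parts_cyclePartition]

end Partitions

/-! ### The limit as a sum over planar maps -/

section Maps

variable {p : ℕ}

theorem bicolouredVertices_eq_zero_iff (f : Fin p → Marginal) (M : BicoloredMap p) :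
    M.bicolouredVertices f = 0 ↔ Invariant M.white f := by
  have hfin : Finite (PermCycle M.white) := Quotient.finite _
  rw [BicoloredMap.bicolouredVertices, Finite.card_eq_zero_iff]
  constructor
  · intro h k
    by_contra hk
    have hcyc : M.white.SameCycle (M.white k) k :=
      Equiv.Perm.sameCycle_apply_left.2 (Equiv.Perm.SameCycle.refl _ _)
    have hq : Quotient.mk (Equiv.Perm.SameCycle.setoid M.white) (M.white k) = Quotient.mk _ k :=
      Quotient.sound hcyc
    refine h.elim ⟨Quotient.mk _ k, ?_⟩
    cases h1 : f k <;> cases h2 : f (M.white k)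
    · exact absurd (h2.trans h1.symm) hk
    · exact ⟨k, M.white k, rfl, hq, h1, h2⟩
    · exact ⟨M.white k, k, hq, rfl, h2, h1⟩
    · exact absurd (h2.trans h1.symm) hk
  · intro h
    refine ⟨?_⟩
    rintro ⟨v, e, e', h1, h2, h3, h4⟩
    have hs : M.white.SameCycle e e' :=
      Quotient.exact (s := Equiv.Perm.SameCycle.setoid M.white) (h1.trans h2.symm)
    have := h.eq_of_sameCycle hs
    rw [h3, h4] at this
    cases this

/-- The map with one black vertex and the white vertices given by `σ`. -/
def oneBlackVertexMap (σ : Equiv.Perm (Fin (p + 1))) : BicoloredMap (p + 1) where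
  white := σ
  black := finRotate (p + 1)
  transitive e e' := by
    have hs : (finRotate (p + 1)).SameCycle e e' := sameCycle_of_forall_invariant fun v hv =>
      (eq_of_invariant_finRotate hv e).trans (eq_of_invariant_finRotate hv e').symm
    obtain ⟨k, hk⟩ := hs
    exact ⟨_, Subgroup.zpow_mem _ (Subgroup.subset_closure (by simp)) k, hk⟩

/-- With one black vertex, Euler's relation in genus 0 reads `#σ + 1 + #(γ σ) - (p + 1) = 2`, which
is the geodesic equation, and `V - 1 = #σ`. There must be at least one edge, since otherwise `γ` has
no cycle and there is no black vertex. -/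
theorem sum_planarMonochrome (c : ℝ) (f : Fin (p + 1) → Marginal) :
    ∑ M ∈ BicoloredMap.planarMonochrome f, c ^ (M.numVertices - 1) =
      ∑ σ ∈ geodesics f (List.finRange (p + 1)), c ^ numCycles σ := by
  classical
  have hgenus : ∀ M : BicoloredMap (p + 1), M.black = finRotate (p + 1) →
      (M.HasGenus 0 ↔ Geodesic (finRotate (p + 1)) M.white) := by
    intro M hM
    rw [BicoloredMap.HasGenus, BicoloredMap.numVertices, BicoloredMap.numFaces, hM,
      numCycles_finRotate]
    unfold Geodesic
    rw [numCycles_finRotate, Fintype.card_fin]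
    push_cast
    omega
  refine Finset.sum_nbij (fun M => M.white) ?_ ?_ ?_ ?_
  · intro M hM
    obtain ⟨-, hb, hg, hm⟩ := Finset.mem_filter.1 hM
    rw [mem_geodesics, formPerm_finRange]
    exact ⟨(hgenus M hb).1 hg, (bicolouredVertices_eq_zero_iff f M).1 hm⟩
  · intro M hM M' hM' he
    obtain ⟨-, hb, -⟩ := Finset.mem_filter.1 (Finset.mem_coe.1 hM)
    obtain ⟨-, hb', -⟩ := Finset.mem_filter.1 (Finset.mem_coe.1 hM')
    exact BicoloredMap.ext he (hb.trans hb'.symm)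
  · intro σ hσ
    rw [Finset.mem_coe, mem_geodesics, formPerm_finRange] at hσ
    refine ⟨oneBlackVertexMap σ, Finset.mem_coe.2 (Finset.mem_filter.2 ⟨Finset.mem_univ _, rfl,
      (hgenus _ rfl).2 hσ.1, (bicolouredVertices_eq_zero_iff f _).2 hσ.2⟩), rfl⟩
  · intro M hM
    obtain ⟨-, hb, -⟩ := Finset.mem_filter.1 hM
    rw [BicoloredMap.numVertices, hb, numCycles_finRotate, Nat.add_sub_cancel]

end Maps

end GaussianTensor

/-! ### Freeness from the Schwinger–Dyson equations -/

namespace SchwingerDyson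

open scoped TensorProduct

variable {ι A : Type*} [Ring A] [Algebra ℂ A]

/-- The functional `φ ⊗ φ`. -/
noncomputable def tensorSquare (φ : A →ₗ[ℂ] ℂ) : A ⊗[ℂ] A →ₗ[ℂ] ℂ :=
  LinearMap.mul' ℂ ℂ ∘ₗ TensorProduct.map φ φ

@[simp]
theorem tensorSquare_tmul (φ : A →ₗ[ℂ] ℂ) (a b : A) : tensorSquare φ (a ⊗ₜ b) = φ a * φ b := rfl

/-- The free difference quotients `D i` with respect to the elements `x i`, with the letter `x i`
kept in the right factor. -/
structure IsDifferenceQuotient [DecidableEq ι] (x : ι → A) (D : ι → A →ₗ[ℂ] A ⊗[ℂ] A) : Prop where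
  map_mul : ∀ i a b, D i (a * b) = D i a * (1 ⊗ₜ b) + (a ⊗ₜ 1) * D i b
  map_gen : ∀ i j, D i (x j) = if j = i then 1 ⊗ₜ x j else 0

namespace IsDifferenceQuotient

variable [DecidableEq ι] {x : ι → A} {D : ι → A →ₗ[ℂ] A ⊗[ℂ] A}

theorem map_one (h : IsDifferenceQuotient x D) (i : ι) : D i 1 = 0 := by
  have h1 := h.map_mul i 1 1
  rw [← Algebra.TensorProduct.one_def] at h1
  simpa using h1

theorem map_pow (h : IsDifferenceQuotient x D) (i : ι) (k : ℕ) :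
    D i (x i ^ k) = ∑ l ∈ range k, (x i ^ l) ⊗ₜ (x i ^ (k - l)) := by
  induction k with
  | zero => simpa using h.map_one i
  | succ k ih =>
    rw [pow_succ, h.map_mul, ih, h.map_gen, if_pos rfl, Finset.sum_range_succ, Finset.sum_mul]
    congr 1
    · refine Finset.sum_congr rfl fun l hl => ?_
      rw [Algebra.TensorProduct.tmul_mul_tmul, mul_one, ← pow_succ,
        Nat.sub_add_comm (Finset.mem_range.1 hl).le]
    · rw [Algebra.TensorProduct.tmul_mul_tmul, mul_one, one_mul, Nat.add_sub_cancel_left, pow_one]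

/-- If `u` is centred against the algebra generated by `x j`, then `D j` of an element of one of
the algebras generated by the `x i` does not contribute. -/
theorem tensorSquare_eq_zero (h : IsDifferenceQuotient x D) (φ : A →ₗ[ℂ] ℂ) {i j : ι} {a : A}
    (ha : a ∈ Algebra.adjoin ℂ {x i}) :
    ∀ u v : A, (i = j → ∀ s ∈ Algebra.adjoin ℂ {x j}, φ (u * s) = 0) →
      tensorSquare φ ((u ⊗ₜ 1) * D j a * (1 ⊗ₜ v)) = 0 := by
  induction ha using Algebra.adjoin_induction with
  | mem y hy =>
    intro u v hu
    rw [Set.mem_singleton_iff.1 hy, h.map_gen]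
    split_ifs with hij
    · rw [Algebra.TensorProduct.tmul_mul_tmul, Algebra.TensorProduct.tmul_mul_tmul,
        tensorSquare_tmul, mul_one, hu hij 1 (one_mem _), zero_mul]
    · simp
  | algebraMap r =>
    intro u v _
    rw [Algebra.algebraMap_eq_smul_one, LinearMap.map_smul, h.map_one]
    simp
  | add a b _ _ iha ihb =>
    intro u v hu
    rw [map_add, mul_add, add_mul, map_add, iha u v hu, ihb u v hu, add_zero]
  | mul a b ha _ iha ihb =>
    intro u v hu
    have h1 : (u ⊗ₜ[ℂ] (1 : A)) * D j (a * b) * (1 ⊗ₜ v) =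
        (u ⊗ₜ 1) * D j a * (1 ⊗ₜ (b * v)) + ((u * a) ⊗ₜ 1) * D j b * (1 ⊗ₜ v) := by
      have e1 : ((1 : A) ⊗ₜ[ℂ] (b * v)) = (1 ⊗ₜ b) * (1 ⊗ₜ v) := by
        rw [Algebra.TensorProduct.tmul_mul_tmul, one_mul]
      have e2 : ((u * a) ⊗ₜ[ℂ] (1 : A)) = (u ⊗ₜ 1) * (a ⊗ₜ 1) := by
        rw [Algebra.TensorProduct.tmul_mul_tmul, one_mul]
      rw [h.map_mul, e1, e2]
      simp only [mul_add, add_mul, mul_assoc]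
    rw [h1, map_add, iha u _ hu, ihb (u * a) v, add_zero]
    intro hij s hs
    rw [mul_assoc]
    exact hu hij _ (mul_mem (hij ▸ ha) hs)

/-- By the Leibniz rule only factors from the algebra of `x j` can contribute. The left tensor
factors produced there are `u`, the prefix, and an element of that algebra, and the functional is
assumed to kill these products. -/
theorem tensorSquare_prod_eq_zero (h : IsDifferenceQuotient x D) (φ : A →ₗ[ℂ] ℂ) (j : ι)
    (b : List (ι × A)) : ∀ u : A, (∀ q ∈ b, q.2 ∈ Algebra.adjoin ℂ {x q.1}) →
      (∀ p a q, b = p ++ (j, a) :: q →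
        ∀ s ∈ Algebra.adjoin ℂ {x j}, φ (u * ((p.map Prod.snd).prod * s)) = 0) →
      tensorSquare φ ((u ⊗ₜ 1) * D j (b.map Prod.snd).prod) = 0 := by
  induction b with
  | nil =>
    intro u _ _
    simp [h.map_one]
  | cons y b ih =>
    intro u hb hu
    rw [List.map_cons, List.prod_cons, h.map_mul, mul_add, map_add, ← mul_assoc,
      h.tensorSquare_eq_zero φ (hb y List.mem_cons_self), zero_add, ← mul_assoc,
      Algebra.TensorProduct.tmul_mul_tmul, mul_one]
    · refine ih _ (fun q hq => hb q (List.mem_cons_of_mem _ hq)) fun p a q hpq s hs => ?_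
      have := hu (y :: p) a q (by rw [hpq, List.cons_append]) s hs
      rwa [List.map_cons, List.prod_cons, mul_assoc, ← mul_assoc] at this
    · rintro hij s hs
      have := hu [] y.2 b (by rw [← hij]; rfl) s hs
      simpa using this

end IsDifferenceQuotient

/-- An alternating word in centred elements of the algebras generated by the `x i`. -/
structure IsAlternating (φ : A →ₗ[ℂ] ℂ) (x : ι → A) (b : List (ι × A)) : Prop where
  chain : b.IsChain fun p q => p.1 ≠ q.1
  mem : ∀ q ∈ b, q.2 ∈ Algebra.adjoin ℂ {x q.1}
  centred : ∀ q ∈ b, φ q.2 = 0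

theorem IsAlternating.of_cons {φ : A →ₗ[ℂ] ℂ} {x : ι → A} {y : ι × A} {b : List (ι × A)}
    (h : IsAlternating φ x (y :: b)) : IsAlternating φ x b where
  chain := h.chain.tail
  mem q hq := h.mem q (List.mem_cons_of_mem _ hq)
  centred q hq := h.centred q (List.mem_cons_of_mem _ hq)

theorem IsAlternating.of_append {φ : A →ₗ[ℂ] ℂ} {x : ι → A} {p q : List (ι × A)}
    (h : IsAlternating φ x (p ++ q)) : IsAlternating φ x p where
  chain := h.chain.left_of_append
  mem r hr := h.mem r (List.mem_append_left _ hr)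
  centred r hr := h.centred r (List.mem_append_left _ hr)

theorem IsAlternating.replace {φ : A →ₗ[ℂ] ℂ} {x : ι → A} {p q : List (ι × A)} {j : ι} {a s : A}
    (h : IsAlternating φ x (p ++ (j, a) :: q)) (hs : s ∈ Algebra.adjoin ℂ {x j}) (h0 : φ s = 0) :
    IsAlternating φ x (p ++ [(j, s)]) where
  chain := by
    have := h.chain
    rw [List.isChain_append] at this ⊢
    refine ⟨this.1, List.isChain_singleton _, fun r hr t ht => ?_⟩
    have h1 := this.2.2 r hr (j, a) (by simp)
    have h2 : t = (j, s) := by simpa using ht.symm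
    rw [h2]
    exact h1
  mem r hr := by
    rcases List.mem_append.1 hr with hr | hr
    · exact h.mem r (List.mem_append_left _ hr)
    · rw [List.mem_singleton.1 hr]; exact hs
  centred r hr := by
    rcases List.mem_append.1 hr with hr | hr
    · exact h.centred r (List.mem_append_left _ hr)
    · rw [List.mem_singleton.1 hr]; exact h0

theorem linear_eq_on_adjoin {x : A} (L : A →ₗ[ℂ] ℂ) (h : ∀ k, L (x ^ k) = 0) {s : A}
    (hs : s ∈ Algebra.adjoin ℂ {x}) : L s = 0 := by
  rw [Algebra.adjoin_singleton_eq_range_aeval] at hs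
  obtain ⟨q, rfl⟩ := hs
  change L (Polynomial.aeval x q) = 0
  rw [Polynomial.aeval_eq_sum_range, map_sum]
  exact Finset.sum_eq_zero fun k _ => by rw [LinearMap.map_smul, h, smul_zero]

variable [DecidableEq ι] {x : ι → A} {D : ι → A →ₗ[ℂ] A ⊗[ℂ] A}

/-- Induction on the length of `b` and then on the power. For `k = 0` the first factor of `b` is
expanded in powers of its generator, which shortens `b`. For `k + 1` the equation `hSD` removes one
letter `x j`. Cuts inside the power leave a right factor `x j ^ (k - l)` times `b`, which is killed
by induction; the derivation keeps the cut letter on that side. Cuts inside `b` leave on the left `x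
j ^ k` times a non-empty prefix `p` and an element `s` of the algebra of `x j`. -/
theorem map_pow_mul_alternating (hD : IsDifferenceQuotient x D) {φ : A →ₗ[ℂ] ℂ} (h1 : φ 1 = 1)
    (c : ℂ) (hSD : ∀ i a, φ (x i * a) = c * φ a + tensorSquare φ (D i a)) (n : ℕ) :
    ∀ b : List (ι × A), b.length ≤ n → b ≠ [] → IsAlternating φ x b →
      ∀ j, (∀ q ∈ b.head?, q.1 ≠ j) → ∀ k, φ (x j ^ k * (b.map Prod.snd).prod) = 0 := by
  induction n with
  | zero => intro b hb hne; exact absurd (List.length_eq_zero_iff.1 (Nat.le_zero.1 hb)) hne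
  | succ n ihn =>
    intro b hb hne hA j hj k
    induction k using Nat.strong_induction_on generalizing b with
    | _ k ihk =>
      cases k with
      | zero =>
        obtain _ | ⟨⟨i, a⟩, b⟩ := b
        · exact absurd rfl hne
        rw [pow_zero, one_mul, List.map_cons, List.prod_cons]
        by_cases hb0 : b = []
        · rw [hb0, List.map_nil, List.prod_nil, mul_one]
          exact hA.centred (i, a) List.mem_cons_self
        · refine linear_eq_on_adjoin (φ ∘ₗ LinearMap.mulRight ℂ (b.map Prod.snd).prod) (fun k => ?_)
            (hA.mem (i, a) List.mem_cons_self)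
          refine ihn b (Nat.le_of_succ_le_succ hb) hb0 hA.of_cons i (fun q hq => ?_) k
          have := hA.chain
          rw [List.isChain_cons] at this
          exact (this.1 q hq).symm
      | succ k =>
        rw [pow_succ', mul_assoc, hSD, ihk k (Nat.lt_succ_self k) b hb hne hA hj, mul_zero,
          zero_add, hD.map_mul, map_add, hD.map_pow, Finset.sum_mul, map_sum]
        have hfirst : ∀ l ∈ range k, tensorSquare φ ((x j ^ l) ⊗ₜ (x j ^ (k - l)) *
            (1 ⊗ₜ (b.map Prod.snd).prod)) = 0 := by
          intro l _
          rw [Algebra.TensorProduct.tmul_mul_tmul, tensorSquare_tmul,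
            ihk (k - l) (Nat.lt_succ_of_le (Nat.sub_le k l)) b hb hne hA hj, mul_zero]
        rw [Finset.sum_eq_zero hfirst, zero_add]
        refine hD.tensorSquare_prod_eq_zero φ j b _ hA.mem fun p a q hpq s hs => ?_
        subst hpq
        have hp : p ≠ [] := by
          rintro rfl
          exact hj (j, a) (by simp) rfl
        have hhead : ∀ r t, p ++ r = t → ∀ q ∈ t.head?, q.1 ≠ j := by
          rintro r t rfl y hy
          refine hj y ?_
          rw [List.head?_append_of_ne_nil _ hp] at hy ⊢
          exact hy
        have hlen : p.length + 1 ≤ n + 1 := by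
          rw [List.length_append, List.length_cons] at hb
          omega
        -- Writing `s` as a centred element plus a constant makes both parts alternating words
        -- behind `x j ^ k`: `p` followed by the centred part, and `p` alone.
        have hc : φ (s - algebraMap ℂ A (φ s)) = 0 := by
          rw [map_sub, Algebra.algebraMap_eq_smul_one, LinearMap.map_smul, h1, smul_eq_mul,
            mul_one, sub_self]
        have e1 := ihk k (Nat.lt_succ_self k) (p ++ [(j, s - algebraMap ℂ A (φ s))])
          (by simpa using hlen) (by simp)
          (hA.replace (sub_mem hs (Subalgebra.algebraMap_mem _ _)) hc) (hhead _ _ rfl)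
        have e2 := ihk k (Nat.lt_succ_self k) p (by omega) hp hA.of_append
          (hhead [] p (List.append_nil p))
        rw [List.map_append, List.prod_append, List.map_singleton, List.prod_singleton,
          mul_sub, mul_sub, map_sub, sub_eq_zero] at e1
        rw [e1, Algebra.algebraMap_eq_smul_one, mul_smul_comm, mul_smul_comm, mul_one,
          LinearMap.map_smul, e2, smul_zero]

/-- Solutions of the Schwinger–Dyson equations of free Poisson elements are free. -/
theorem freeElements (hD : IsDifferenceQuotient x D) {φ : A →ₗ[ℂ] ℂ} (h1 : φ 1 = 1)
    (c : ℂ) (hSD : ∀ i a, φ (x i * a) = c * φ a + tensorSquare φ (D i a)) :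
    FreeElements φ x := by
  intro n i a hi ha h0
  let b : List (ι × A) := List.ofFn fun k : Fin n => (i k.succ, a k.succ)
  have hA : IsAlternating φ x (List.ofFn fun k => (i k, a k)) := by
    refine ⟨?_, ?_, ?_⟩
    · rw [List.isChain_iff_getElem]
      intro k hk
      rw [List.length_ofFn] at hk
      simp only [List.getElem_ofFn]
      exact hi ⟨k, by omega⟩
    · intro q hq
      obtain ⟨k, rfl⟩ := (List.mem_ofFn' _ _).1 hq
      exact ha k
    · intro q hq
      obtain ⟨k, rfl⟩ := (List.mem_ofFn' _ _).1 hq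
      exact h0 k
  have hprod : (List.ofFn a).prod = a 0 * (b.map Prod.snd).prod := by
    rw [List.ofFn_succ, List.prod_cons, List.map_ofFn]
    rfl
  rw [hprod]
  rw [List.ofFn_succ] at hA
  by_cases hb : b = []
  · rw [hb, List.map_nil, List.prod_nil, mul_one, h0]
  · refine linear_eq_on_adjoin (φ ∘ₗ LinearMap.mulRight ℂ (b.map Prod.snd).prod) (fun k => ?_) (ha 0)
    refine map_pow_mul_alternating hD h1 c hSD b.length b le_rfl hb hA.of_cons (i 0)
      (fun q hq => ?_) k
    have := hA.chain
    rw [List.isChain_cons] at this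
    exact (this.1 q hq).symm

end SchwingerDyson

/-! ### The algebra of non-commutative polynomials -/

namespace WordAlgebra

open scoped TensorProduct

/-- The algebra of non-commutative polynomials, spanned by the words. -/
abbrev _root_.WordAlgebra (ι : Type*) : Type _ := MonoidAlgebra ℂ (FreeMonoid ι)

variable {ι : Type*}

/-- The word `l` as an element of the word algebra. -/
noncomputable def word (l : List ι) : WordAlgebra ι := MonoidAlgebra.single (FreeMonoid.ofList l) 1

/-- The letter `i` as an element of the word algebra. -/
noncomputable def letter (i : ι) : WordAlgebra ι := word [i]

theorem word_nil : word ([] : List ι) = 1 := rfl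

theorem word_append (u v : List ι) : word (u ++ v) = word u * word v := by
  simp [word, MonoidAlgebra.single_mul_single]

theorem word_cons (i : ι) (l : List ι) : word (i :: l) = letter i * word l := word_append [i] l

theorem word_eq_prod (l : List ι) : word l = (l.map letter).prod := by
  induction l with
  | nil => rfl
  | cons i l ih => rw [word_cons, ih, List.map_cons, List.prod_cons]

theorem letter_pow (i : ι) (k : ℕ) : letter i ^ k = word (List.replicate k i) := by
  rw [word_eq_prod, List.map_replicate, List.prod_replicate]

theorem induction_words {p : WordAlgebra ι → Prop} (a : WordAlgebra ι) (h0 : p 0)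
    (hadd : ∀ a b, p a → p b → p (a + b)) (hword : ∀ (z : ℂ) l, p (z • word l)) : p a := by
  induction a using MonoidAlgebra.induction_linear with
  | zero => exact h0
  | add a b ha hb => exact hadd a b ha hb
  | single w z =>
    have := hword z w.toList
    rwa [word, MonoidAlgebra.smul_single, smul_eq_mul, mul_one, FreeMonoid.ofList_toList] at this

section Linear

variable {V : Type*} [AddCommGroup V] [Module ℂ V]

/-- The linear map with prescribed values on words. -/
noncomputable def ofWords (g : List ι → V) : WordAlgebra ι →ₗ[ℂ] V :=
  (Finsupp.linearCombination ℂ fun w : FreeMonoid ι => g w.toList) ∘ₗ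
    (MonoidAlgebra.coeffLinearEquiv ℂ).toLinearMap

theorem ofWords_word (g : List ι → V) (l : List ι) : ofWords g (word l) = g l := by
  change Finsupp.linearCombination ℂ (fun w : FreeMonoid ι => g w.toList)
    (Finsupp.single (FreeMonoid.ofList l) 1) = g l
  rw [Finsupp.linearCombination_single, one_smul, FreeMonoid.toList_ofList]

theorem linearMap_ext {F G : WordAlgebra ι →ₗ[ℂ] V} (h : ∀ l, F (word l) = G (word l)) : F = G := by
  refine LinearMap.ext fun a => ?_
  induction a using induction_words with
  | h0 => rw [map_zero, map_zero]
  | hadd a b ha hb => rw [map_add, map_add, ha, hb]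
  | hword z l => rw [LinearMap.map_smul, LinearMap.map_smul, h]

end Linear

/-! ### The involution -/

/-- The involution that reverses words and conjugates coefficients. -/
noncomputable def starHom : WordAlgebra ι →+* (WordAlgebra ι)ᵐᵒᵖ :=
  MonoidAlgebra.liftNCRingHom
    ((algebraMap ℂ (WordAlgebra ι)ᵐᵒᵖ).comp (starRingEnd ℂ))
    (FreeMonoid.lift fun i => MulOpposite.op (letter i)) fun z _ => by
      rw [RingHom.comp_apply]
      exact Algebra.commute_algebraMap_left _ _

theorem starHom_smul_word (z : ℂ) (l : List ι) :
    starHom (z • word l) = MulOpposite.op (star z • word l.reverse) := by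
  rw [word, MonoidAlgebra.smul_single, smul_eq_mul, mul_one]
  rw [starHom, MonoidAlgebra.liftNCRingHom_single, RingHom.comp_apply, FreeMonoid.lift_ofList, ← Algebra.smul_def, MulOpposite.op_smul, word_eq_prod,
    MulOpposite.op_list_prod, List.map_reverse, List.map_reverse, List.reverse_reverse, List.map_map]
  rfl

noncomputable instance : StarRing (WordAlgebra ι) where
  star a := (starHom a).unop
  star_involutive a := by
    induction a using induction_words with
    | h0 => simp
    | hadd a b ha hb => simp only [map_add, MulOpposite.unop_add, ha, hb]
    | hword z l =>
      simp only [starHom_smul_word, MulOpposite.unop_op, star_star, List.reverse_reverse]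
  star_mul a b := by simp
  star_add a b := by simp

theorem star_smul_word (z : ℂ) (l : List ι) : star (z • word l) = star z • word l.reverse :=
  congrArg MulOpposite.unop (starHom_smul_word z l)

theorem star_letter (i : ι) : star (letter i) = letter i := by
  have := star_smul_word 1 [i]
  rwa [one_smul, star_one, one_smul] at this

instance : StarModule ℂ (WordAlgebra ι) where
  star_smul z a := by
    induction a using induction_words with
    | h0 => simp
    | hadd a b ha hb => simp only [smul_add, star_add, ha, hb]
    | hword w l => rw [smul_smul, star_smul_word, star_smul_word, star_mul', smul_smul]

/-! ### Free difference quotients -/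

variable [DecidableEq ι]

/-- The free difference quotient on words. -/
noncomputable def wordQuotient (i : ι) : List ι → WordAlgebra ι ⊗[ℂ] WordAlgebra ι
  | [] => 0
  | j :: l => (if j = i then 1 ⊗ₜ word (j :: l) else 0) + (letter j ⊗ₜ 1) * wordQuotient i l

/-- The free difference quotient, with the cut made in front of the letter `i`. -/
noncomputable def quotient (i : ι) : WordAlgebra ι →ₗ[ℂ] WordAlgebra ι ⊗[ℂ] WordAlgebra ι :=
  ofWords (wordQuotient i)

theorem wordQuotient_append (i : ι) (u v : List ι) :
    wordQuotient i (u ++ v) =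
      wordQuotient i u * (1 ⊗ₜ word v) + (word u ⊗ₜ 1) * wordQuotient i v := by
  induction u with
  | nil =>
    rw [List.nil_append, wordQuotient, zero_mul, zero_add, word_nil,
      ← Algebra.TensorProduct.one_def, one_mul]
  | cons j u ih =>
    rw [List.cons_append, wordQuotient, wordQuotient, ih, mul_add, add_mul, word_cons j u,
      ← List.cons_append, word_append, ← mul_assoc, ← mul_assoc, ← add_assoc]
    congr 2
    · split_ifs
      · rw [Algebra.TensorProduct.tmul_mul_tmul, one_mul, word_cons]
      · rw [zero_mul]
    · rw [Algebra.TensorProduct.tmul_mul_tmul, one_mul]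

theorem isDifferenceQuotient : SchwingerDyson.IsDifferenceQuotient (letter (ι := ι)) quotient where
  map_mul i a b := by
    induction a using induction_words generalizing b with
    | h0 => simp
    | hadd a a' ha ha' =>
      simp only [add_mul, map_add, ha, ha', TensorProduct.add_tmul]
      abel
    | hword z u =>
      induction b using induction_words with
      | h0 => simp
      | hadd b b' hb hb' =>
        simp only [mul_add, map_add, hb, hb', TensorProduct.tmul_add]
        abel
      | hword w v =>
        rw [smul_mul_smul_comm, LinearMap.map_smul, LinearMap.map_smul, LinearMap.map_smul,
          ← word_append]
        simp only [quotient, ofWords_word, wordQuotient_append, TensorProduct.tmul_smul,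
          ← TensorProduct.smul_tmul', smul_mul_assoc, mul_smul_comm, smul_smul, smul_add]
        rw [mul_comm w z]
  map_gen i j := by
    rw [letter, quotient, ofWords_word, wordQuotient, wordQuotient, mul_zero, add_zero]

end WordAlgebra

namespace WordAlgebra

open CycleCount SchwingerDyson
open scoped TensorProduct ComplexOrder

/-! ### The limiting functional -/

section State

variable {ι : Type*} [DecidableEq ι]

/-- The functional on the word algebra whose moments are the `wordMoment`s. -/
noncomputable def moment (ι : Type*) [DecidableEq ι] (c : ℝ) : WordAlgebra ι →ₗ[ℂ] ℂ :=
  ofWords fun l => (wordMoment c l : ℂ)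

theorem moment_word (c : ℝ) (l : List ι) : moment ι c (word l) = wordMoment c l :=
  ofWords_word _ l

theorem moment_one (c : ℝ) : moment ι c 1 = 1 := by
  rw [← word_nil, moment_word, wordMoment_nil, Complex.ofReal_one]

/-- The left factor `word u` is arbitrary for the sake of the induction: each letter passed by the
cut is appended to `u`. -/
theorem tensorSquare_wordQuotient (c : ℝ) (i : ι) (l : List ι) : ∀ u : List ι,
    tensorSquare (moment ι c) ((word u ⊗ₜ 1) * wordQuotient i l) =
      ∑ k : Fin l.length, if l[k] = i then
        (wordMoment c (u ++ l.take k) : ℂ) * (wordMoment c (l.drop k) : ℂ) else 0 := by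
  induction l with
  | nil => intro u; simp [wordQuotient]
  | cons j l ih =>
    intro u
    have h := ih (u ++ [j])
    rw [word_append] at h
    rw [wordQuotient, mul_add, map_add, ← mul_assoc, Algebra.TensorProduct.tmul_mul_tmul, mul_one]
    refine Eq.trans ?_ (Fin.sum_univ_succ fun k : Fin (l.length + 1) => if (j :: l)[k] = i then
      (wordMoment c (u ++ (j :: l).take k) : ℂ) * (wordMoment c ((j :: l).drop k) : ℂ) else 0).symm
    rw [letter, h]
    congr 1
    · by_cases hj : j = i
      · simp [hj, moment_word]
      · simp [hj]
    · simp

/-- On words this is the defining recursion of `wordMoment`, and both sides are linear. -/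
theorem moment_letter_mul (c : ℝ) (i : ι) (a : WordAlgebra ι) :
    moment ι c (letter i * a) = c * moment ι c a + tensorSquare (moment ι c) (quotient i a) := by
  have h : (moment ι c) ∘ₗ LinearMap.mulLeft ℂ (letter i) =
      (c : ℂ) • moment ι c + tensorSquare (moment ι c) ∘ₗ quotient i := by
    refine linearMap_ext fun l => ?_
    have h1 := tensorSquare_wordQuotient c i l []
    rw [word_nil, ← Algebra.TensorProduct.one_def, one_mul] at h1
    change moment ι c (letter i * word l) = c * moment ι c (word l) +
      tensorSquare (moment ι c) (quotient i (word l))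
    rw [← word_cons, moment_word, moment_word, wordMoment_cons, quotient, ofWords_word, h1]
    push_cast
    congr 1
    refine Finset.sum_congr rfl fun k _ => ?_
    split_ifs <;> simp
  exact LinearMap.congr_fun h a

theorem freeElements_letter (c : ℝ) : FreeElements (moment ι c) letter :=
  freeElements isDifferenceQuotient (moment_one c) c (moment_letter_mul c)

theorem hasDistribution_letter {c : ℝ} (hc : 0 < c) (i : ι) :
    HasDistribution (moment ι c) (letter i) (marchenkoPastur c) where
  isSelfAdjoint := star_letter i
  integrable k := (MarchenkoPastur.integrable_and_integral c hc k).1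
  moment_eq k := by
    rw [MarchenkoPastur.integral_pow_eq c hc (fun k => wordMoment c (List.replicate k i)),
      letter_pow, moment_word]
    · exact wordMoment_nil c
    · intro k
      -- On a constant word every position matches, and the recursion becomes the quadratic one of
      -- the Marchenko–Pastur moments.
      rw [List.replicate_succ, wordMoment_cons, ← Fin.sum_univ_eq_sum_range
        (fun j => wordMoment c (List.replicate j i) * wordMoment c (List.replicate (k - j) i))]
      congr 1
      refine Fintype.sum_equiv (finCongr List.length_replicate) _ _ fun j => ?_
      have hj : (j : ℕ) < k := by simpa using j.2
      simp [List.take_replicate, List.drop_replicate, min_eq_left hj.le]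

end State

/-! ### Positivity of the limit -/

section Evaluation

variable {ι n : Type*} [Fintype n] [DecidableEq n]

/-- The evaluation of non-commutative polynomials at the matrices `M i`. -/
noncomputable def eval (M : ι → Matrix n n ℂ) : WordAlgebra ι →ₐ[ℂ] Matrix n n ℂ :=
  MonoidAlgebra.lift ℂ _ _ (FreeMonoid.lift M)

theorem eval_word (M : ι → Matrix n n ℂ) (l : List ι) : eval M (word l) = (l.map M).prod := by
  rw [eval, word, MonoidAlgebra.lift_single, one_smul, FreeMonoid.lift_ofList]

theorem eval_star {M : ι → Matrix n n ℂ} (hM : ∀ i, (M i).IsHermitian) (a : WordAlgebra ι) :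
    eval M (star a) = star (eval M a) := by
  induction a using induction_words with
  | h0 => simp
  | hadd a b ha hb => rw [star_add, map_add, map_add, star_add, ha, hb]
  | hword z l =>
    rw [star_smul_word, map_smul, map_smul, star_smul, eval_word, eval_word]
    congr 1
    rw [Matrix.star_eq_conjTranspose, Matrix.conjTranspose_list_prod, List.map_map,
      List.map_reverse]
    congr 2
    exact List.map_congr_left fun i _ => (hM i).eq.symm

/-- A functional that is a limit in distribution of Hermitian random matrices is a state. -/
theorem isNCState_of_converges {Ω : ℕ → Type*} [∀ N, MeasurableSpace (Ω N)]
    {P : ∀ N, Measure (Ω N)} {n : ℕ → Type*} [∀ N, Fintype (n N)] [∀ N, DecidableEq (n N)]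
    {M : ∀ N, Ω N → ι → Matrix (n N) (n N) ℂ} (hM : ∀ N ω i, (M N ω i).IsHermitian)
    {φ : WordAlgebra ι →ₗ[ℂ] ℂ} (h1 : φ 1 = 1) (h : ConvergesInDistribution P M φ letter) :
    IsNCState φ := by
  -- Convergence on words extends to all polynomials by linearity, so that it applies to `star a *
  -- a`, whose value at Hermitian matrices is positive semidefinite with non-negative real trace.
  have key : ∀ a : WordAlgebra ι,
      (∀ N, Integrable (fun ω => (eval (M N ω) a).trace) (P N)) ∧
      Tendsto (fun N => (Fintype.card (n N) : ℂ)⁻¹ * ∫ ω, (eval (M N ω) a).trace ∂(P N)) atTop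
        (𝓝 (φ a)) := by
    intro a
    induction a using induction_words with
    | h0 => simp
    | hadd a b ha hb =>
      simp only [map_add, Matrix.trace_add]
      refine ⟨fun N => (ha.1 N).add (hb.1 N), ?_⟩
      refine (ha.2.add hb.2).congr fun N => ?_
      rw [integral_add (ha.1 N) (hb.1 N), mul_add]
    | hword z l =>
      have hl := h l.length l.get
      have e1 : ∀ N ω, (List.ofFn fun i => M N ω (l.get i)) = l.map (M N ω) := fun N ω => by
        conv_rhs => rw [← List.ofFn_get l, List.map_ofFn]
        rfl
      have e2 : (List.ofFn fun i => letter (l.get i)) = l.map letter := by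
        conv_rhs => rw [← List.ofFn_get l, List.map_ofFn]
        rfl
      simp only [e1, e2, ← word_eq_prod] at hl
      simp only [map_smul, eval_word, Matrix.trace_smul]
      refine ⟨fun N => (hl.1 N).smul z, ?_⟩
      refine (hl.2.const_smul z).congr fun N => ?_
      rw [integral_smul, mul_smul_comm]
  have hpos : ∀ a : WordAlgebra ι, ∃ r : ℕ → ℝ, (∀ N, 0 ≤ r N) ∧
      Tendsto (fun N => (r N : ℂ)) atTop (𝓝 (φ (star a * a))) := by
    intro a
    refine ⟨fun N => (Fintype.card (n N) : ℝ)⁻¹ *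
      ∫ ω, ((eval (M N ω) (star a * a)).trace).re ∂(P N), fun N => ?_, ?_⟩
    · refine mul_nonneg (by positivity) (integral_nonneg fun ω => ?_)
      rw [map_mul, eval_star (hM N ω)]
      exact (Complex.le_def.1 (Matrix.posSemidef_conjTranspose_mul_self _).trace_nonneg).1
    · refine (key (star a * a)).2.congr fun N => ?_
      push_cast
      rw [← integral_complex_ofReal]
      congr 2
      ext ω
      refine Complex.ext rfl ?_
      rw [map_mul, eval_star (hM N ω), Complex.ofReal_im]
      exact (Complex.le_def.1 (Matrix.posSemidef_conjTranspose_mul_self _).trace_nonneg).2.symm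
  refine ⟨h1, fun a => ?_, fun a => ?_⟩
  · obtain ⟨r, hr, hlim⟩ := hpos a
    have := (Complex.continuous_re.tendsto _).comp hlim
    exact ge_of_tendsto' this fun N => hr N
  · obtain ⟨r, hr, hlim⟩ := hpos a
    have := (Complex.continuous_im.tendsto _).comp hlim
    exact tendsto_nhds_unique this (tendsto_const_nhds.congr fun N => (Complex.ofReal_im _).symm)

end Evaluation

end WordAlgebra

/-! ### Convergence of the normalized marginals -/

namespace GaussianTensor

open CycleCount WordAlgebra

theorem isHermitian_smul_marginal {a n d : ℕ} (X : TensorIndex a n n d → ℂ) (m : Marginal) :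
    (((a : ℂ)⁻¹ * (n : ℂ)⁻¹) • marginal X m).IsHermitian := by
  rw [Matrix.IsHermitian, Matrix.conjTranspose_smul, (isHermitian_marginal X m).eq]
  simp

theorem prod_map_smul {R A : Type*} [CommSemiring R] [Semiring A] [Algebra R A] (r : R)
    (l : List A) : (l.map (r • ·)).prod = r ^ l.length • l.prod := by
  induction l with
  | nil => simp
  | cons a l ih =>
    rw [List.map_cons, List.prod_cons, ih, smul_mul_smul_comm, List.length_cons, pow_succ',
      List.prod_cons]

theorem convergesInDistribution {Ω : ℕ → Type*} [∀ N, MeasurableSpace (Ω N)]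
    (P : ∀ N, Measure (Ω N)) [∀ N, IsProbabilityMeasure (P N)] (NA ND : ℕ → ℕ)
    (hNA : ∀ N, 0 < NA N) (c : ℝ) (hc : 0 < c)
    (hND : Asymptotics.IsEquivalent atTop (fun N => (ND N : ℝ)) (fun N => c * (NA N : ℝ)))
    (X : ∀ N, Ω N → TensorIndex (NA N) N N (ND N) → ℂ)
    (hX : ∀ N, IsGaussianTensor (P N) (X N)) :
    ConvergesInDistribution P (fun N ω m => ((NA N : ℂ)⁻¹ * (N : ℂ)⁻¹) • marginal (X N ω) m)
      (moment Marginal c) letter := by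
  intro p f
  obtain ⟨hI, hT⟩ := tendsto_word NA ND hNA c hc hND P X hX f
  have e1 : ∀ N ω, (List.ofFn fun i => ((NA N : ℂ)⁻¹ * (N : ℂ)⁻¹) • marginal (X N ω) (f i)).prod =
      ((NA N : ℂ)⁻¹ * (N : ℂ)⁻¹) ^ p • (List.ofFn fun i => marginal (X N ω) (f i)).prod := by
    intro N ω
    have := prod_map_smul ((NA N : ℂ)⁻¹ * (N : ℂ)⁻¹) (List.ofFn fun i => marginal (X N ω) (f i))
    rwa [List.map_ofFn, List.length_ofFn] at this
  simp only [e1, Matrix.trace_smul]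
  refine ⟨fun N => (hI N).smul (((NA N : ℂ)⁻¹ * (N : ℂ)⁻¹) ^ p), ?_⟩
  have e2 : (List.ofFn fun i => letter (f i)).prod = word (List.ofFn f) := by
    rw [word_eq_prod, List.map_ofFn]
    rfl
  rw [e2, moment_word]
  refine hT.congr fun N => ?_
  -- The normalized trace supplies the last of the `p + 1` factors `(NA N)⁻¹ (N)⁻¹`.
  rw [integral_smul, Fintype.card_prod, Fintype.card_fin, Fintype.card_fin, smul_eq_mul, ← mul_inv,
    inv_pow, ← mul_assoc, Nat.cast_mul, ← mul_inv, pow_succ']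

theorem tendsto_wordMatrix {Ω : ℕ → Type*} [∀ N, MeasurableSpace (Ω N)]
    (P : ∀ N, Measure (Ω N)) [∀ N, IsProbabilityMeasure (P N)] (NA ND : ℕ → ℕ)
    (hNA : ∀ N, 0 < NA N) (c : ℝ) (hc : 0 < c)
    (hND : Asymptotics.IsEquivalent atTop (fun N => (ND N : ℝ)) (fun N => c * (NA N : ℝ)))
    (X : ∀ N, Ω N → TensorIndex (NA N) N N (ND N) → ℂ)
    (hX : ∀ N, IsGaussianTensor (P N) (X N)) {p : ℕ} (f : Fin p → Marginal) :
    (∀ N, Integrable (fun ω => (wordMatrix (X N ω) f).trace) (P N)) ∧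
      Tendsto
        (fun N => (((NA N : ℂ) * (N : ℂ)) ^ (p + 1))⁻¹ * ∫ ω, (wordMatrix (X N ω) f).trace ∂(P N))
        atTop (𝓝 ((wordMoment c (List.ofFn f) : ℝ) : ℂ)) := by
  obtain ⟨hI, hT⟩ := tendsto_word NA ND hNA c hc hND P X hX f
  have e : ∀ N ω, (wordMatrix (X N ω) f).trace =
      starRingEnd ℂ (List.ofFn fun i => marginal (X N ω) (f i)).prod.trace := by
    intro N ω
    refine trace_reverse_prod _ fun A hA => ?_
    obtain ⟨i, rfl⟩ := (List.mem_ofFn' _ _).1 hA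
    exact isHermitian_marginal _ _
  simp only [e]
  refine ⟨fun N => Complex.conjCLE.toContinuousLinearMap.integrable_comp (hI N), ?_⟩
  have := (Complex.continuous_conj.tendsto _).comp hT
  rw [Complex.conj_ofReal] at this
  refine this.congr fun N => ?_
  rw [Function.comp_apply, map_mul, ← integral_conj]
  simp

end GaussianTensor

theorem mainTheorem3 {Ω : ℕ → Type*} [∀ N, MeasurableSpace (Ω N)] (P : ∀ N, Measure (Ω N))
    [∀ N, IsProbabilityMeasure (P N)] (NA ND : ℕ → ℕ) (hNA : ∀ N, 0 < NA N)
    (c : ℝ) (hc : 0 < c)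
    (hND : Asymptotics.IsEquivalent atTop (fun N => (ND N : ℝ)) (fun N => c * (NA N : ℝ)))
    (X : ∀ N, Ω N → TensorIndex (NA N) N N (ND N) → ℂ)
    (hX : ∀ N, IsGaussianTensor (P N) (X N)) :
    -- convergence to a free pair of Marchenko–Pastur elements
    (∃ (A : Type) (_ : Ring A) (_ : StarRing A) (_ : Algebra ℂ A) (_ : StarModule ℂ A)
        (φ : A →ₗ[ℂ] ℂ) (x : Marginal → A),
      IsNCState φ ∧
      (∀ m, HasDistribution φ (x m) (marchenkoPastur c)) ∧
      FreeElements φ x ∧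
      ConvergesInDistribution P
        (fun N ω m => ((NA N : ℂ)⁻¹ * (N : ℂ)⁻¹) • marginal (X N ω) m) φ x) ∧
    -- the limiting mixed moments exist
    (∀ (p : ℕ) (f : Fin p → Marginal),
      (∀ N, Integrable (fun ω => (wordMatrix (X N ω) f).trace) (P N)) ∧
      -- as a sum over non-crossing partitions
      Tendsto
        (fun N => (((NA N : ℂ) * (N : ℂ)) ^ (p + 1))⁻¹ * ∫ ω, (wordMatrix (X N ω) f).trace ∂(P N))
        atTop (𝓝 (∑ α ∈ ncBelowKer f, (c : ℂ) ^ α.parts.card)) ∧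
      -- as a sum over planar maps, all of whose white vertices are monochromatic
      (1 ≤ p → Tendsto
        (fun N => (((NA N : ℂ) * (N : ℂ)) ^ (p + 1))⁻¹ * ∫ ω, (wordMatrix (X N ω) f).trace ∂(P N))
        atTop (𝓝 (∑ M ∈ BicoloredMap.planarMonochrome f, (c : ℂ) ^ (M.numVertices - 1))))) := by
  have hconv := GaussianTensor.convergesInDistribution P NA ND hNA c hc hND X hX
  -- The functional is given by its moments alone; that it is a state is deduced from the
  -- convergence `hconv`.
  refine ⟨⟨WordAlgebra Marginal, inferInstance, inferInstance, inferInstance, inferInstance,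
    WordAlgebra.moment Marginal c, WordAlgebra.letter,
    WordAlgebra.isNCState_of_converges
      (fun N ω m => GaussianTensor.isHermitian_smul_marginal (X N ω) m)
      (WordAlgebra.moment_one c) hconv,
    fun m => WordAlgebra.hasDistribution_letter hc m, WordAlgebra.freeElements_letter c, hconv⟩,
    fun p f => ?_⟩
  obtain ⟨hI, hT⟩ := GaussianTensor.tendsto_wordMatrix P NA ND hNA c hc hND X hX f
  refine ⟨hI, ?_, fun hp => ?_⟩
  · convert hT using 2
    rw [← GaussianTensor.sum_geodesics_finRange c hc f, ← GaussianTensor.sum_ncBelowKer c f]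
    push_cast
    rfl
  · obtain _ | q := p
    · omega
    convert hT using 2
    rw [← GaussianTensor.sum_geodesics_finRange c hc f, ← GaussianTensor.sum_planarMonochrome c f]
    push_cast
    rfl
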